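/- Let $\mathbb K$ be a field and $(Q,R,\mathrm{Sp})$ a graded skew-gentle triple: $Q=(Q_0,Q_1,s,t)$ is a finite quiver with a degree function $|\cdot|:Q_1\to\mathbb Z$; $\mathrm{Sp}$ is a set of loops of degree $0$; $R$ is a set of paths of length two with $\varepsilon^2\notin R$ for $\varepsilon\in\mathrm{Sp}$; and, with $S=R\cup\{\varepsilon^2\mid\varepsilon\in\mathrm{Sp}\}$, the pair $(Q,S)$ is gentle, i.e. at most two arrows start and at most two arrows end at each vertex, and for every arrow $\alpha$ there is at most one arrow $\beta$ with $\alpha\beta\in S$, at most one $\gamma$ with $\gamma\alpha\in S$, at most one $\beta$ with $t(\beta)=s(\alpha)$ and $\alpha\beta\notin S$, and at most one $\gamma$ with $s(\gamma)=t(\alpha)$ and $\gamma\alpha\notin S$. (Paths $a_l\cdots a_1$ are composed from right to left, and $|a_l\cdots a_1|=\sum|a_i|$.) Let $A=\mathbb KQ/\langle R\cup\{\varepsilon^2-\varepsilon\mid\varepsilon\in\mathrm{Sp}\}\rangle$, a graded algebra with $\mathbb K$-basis the set $\mathcal B$ of paths without subpath in $S$; let $E=\mathbb KQ_0\subset A$,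 let $\overline A\subset A$ be the span of the paths of positive length, so that $A=E\oplus\overline A$, and write $\otimes=\otimes_E$. Let $\Gamma_n$ be the set of paths of length $n$ all of whose subpaths of length two lie in $S$ (so $\Gamma_0=Q_0$, $\Gamma_1=Q_1$), and $\mathrm{Sp}^n=\{\varepsilon^n\mid \varepsilon\in\mathrm{Sp}\}$. *The complex $T_*$.* Let $\mathbb P_n=A\otimes\mathbb K\Gamma_n\otimes A$, with $\mathbb P_n^r$ its part of degree $r$, and for $n\ge1$ let $d_n:\mathbb P_n\to\mathbb P_{n-1}$ be the map of $A$-bimodules with, for $q=a_n\cdots a_1\in\Gamma_n$, $$d_n(1\otimes q\otimes1)=a_n\otimes a_{n-1}\cdots a_1\otimes1+(-1)^n\,1\otimes a_n\cdots a_2\otimes a_1+c_q,$$ where $c_q=-1\otimes\varepsilon^{n-1}\otimes1$ if $q=\varepsilon^n\in\mathrm{Sp}^n$ and $n$ is even, and $c_q=0$ otherwise; the augmentation is $d_0:\mathbb P_0\to A$, $a\otimes e\otimes b\mapsto aeb$. Put $T_N=\bigoplus_{n\ge0}\mathbb P_n^{N+n}$ for $N\in\mathbb Z$, with differential induced by the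 $d_n$. *The complex $B(A,A,A)$.* Let $s$ be the suspension, $|s|=-1$, and $B(A,A,A)=\bigoplus_{n\ge0}A\otimes(s\overline A)^{\otimes n}\otimes A$, graded by the total degree, with the differential $\delta$ that satisfies $\delta(axb)=(-1)^{|a|}a\,\delta(x)\,b$ for homogeneous $a$, vanishes on $A\otimes A$, and, with $\epsilon_{i,n}=\sum_{j=i}^n(|a_j|-1)$ (and $\epsilon_{n+1,n}=0$), is given for homogeneous $a_i\in\overline A$ and $n\ge1$ by $$\begin{aligned}\delta(1\otimes sa_n\otimes\cdots\otimes sa_1\otimes1)={}&a_n\otimes sa_{n-1}\otimes\cdots\otimes sa_1\otimes1\\&+\sum_{i=2}^n(-1)^{\epsilon_{i,n}}\,1\otimes sa_n\otimes\cdots\otimes s(a_ia_{i-1})\otimes\cdots\otimes sa_1\otimes1\\&+(-1)^{\epsilon_{2,n}-1}\,1\otimes sa_n\otimes\cdots\otimes sa_2\otimes a_1;\end{aligned}$$ the augmentation is $A\otimes A\to A$, $a\otimes b\mapsto ab$. *The maps.* For $n\ge0$ let $F^n:\mathbb P_n\to A\otimes(s\overline A)^{\otimes n}\otimes A$ and $G^n$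 in the opposite direction be the $\mathbb K$-linear maps with $F^n(axb)=(-1)^{n|a|}aF^n(x)b$ and $G^n(axb)=(-1)^{n|a|}aG^n(x)b$ for homogeneous $a\in A$ and all $b\in A$, determined as follows. $F^0$ and $G^0$ are the identity of $A\otimes A$ (with $A\otimes\mathbb K\Gamma_0\otimes A=A\otimes A$). For $n\ge1$ and $q=a_n\cdots a_1\in\Gamma_n$, $$F^n(1\otimes q\otimes1)=(-1)^{\sigma(a)}\,1\otimes sa_n\otimes\cdots\otimes sa_1\otimes1,\qquad \sigma(a)=\sum_{i=2}^n(|a_i|+\cdots+|a_n|).$$ For $\alpha=a_l\cdots a_1\in\mathcal B$ with $l\ge1$, $$G^1(1\otimes s\alpha\otimes1)=\sum_{i=1}^l a_l\cdots a_{i+1}\otimes a_i\otimes a_{i-1}\cdots a_1.$$ For $n\ge2$ and composable $\alpha_n,\dots,\alpha_1\in\mathcal B$ of positive lengths, $\alpha_i=a^i_{l_i}\cdots a^i_1$, $$G^n(1\otimes s\alpha_n\otimes\cdots\otimes s\alpha_1\otimes1)=(-1)^{\sigma(\alpha)}\,a^n_{l_n}\cdots a^n_2\otimes a^n_1\alpha_{n-1}\cdots\alpha_2a^1_{l_1}\otimes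 a^1_{l_1-1}\cdots a^1_1$$ if the path $a^n_1\alpha_{n-1}\cdots\alpha_2a^1_{l_1}$ is in $\Gamma_n$, where $\sigma(\alpha)=\sum_{i=2}^n(|\alpha_i|+\cdots+|\alpha_n|)$, and $G^n(1\otimes s\alpha_n\otimes\cdots\otimes s\alpha_1\otimes1)=0$ otherwise. Let $F:T_*\to B(A,A,A)$ and $G:B(A,A,A)\to T_*$ be the maps with components $F^n$, $G^n$. Then $T_*$ and $B(A,A,A)$ are complexes with differential of degree $1$, augmented over $A$, and $F$ and $G$ are comparison morphisms: they preserve the degree $N$, commute with the differentials and are compatible with the augmentations (they lift $\mathrm{id}_A$). Moreover $GF=\mathrm{id}$, and $FG$ is homotopic to $\mathrm{id}$ as a map of complexes of graded bimodules: there is a $\mathbb K$-linear $h:B(A,A,A)\to B(A,A,A)$ of degree $-1$ with $h(axb)=(-1)^{|a|}a\,h(x)\,b$ for homogeneous $a$, such that $\mathrm{id}-FG=\delta h+h\delta$. -/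

import Mathlib

open scoped TensorProduct DirectSum

set_option linter.unusedSectionVars false

noncomputable section

/-- A quiver `(Q₀, Q₁, s, t)` with a grading `|·| : Q₁ → ℤ`. -/
structure GradedQuiver (V Ar : Type*) where
  s : Ar → V
  t : Ar → V
  deg : Ar → ℤ

namespace GradedQuiver

variable {V Ar : Type*} (Q : GradedQuiver V Ar)

/-- `Q.IsPath j [a_l, …, a_1] i`: the arrows form a path `a_l ⋯ a_1` from `i` to `j`
(the rightmost arrow is traversed first); the empty list is a path only if `j = i`. -/
def IsPath : V → List Ar → V → Prop
  | j, [], i => j = i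
  | j, a :: l, i => Q.t a = j ∧ IsPath (Q.s a) l i

/-- Paths `a_l ⋯ a_1`, including the trivial path at each vertex. -/
@[ext]
structure Path where
  tgt : V
  arrows : List Ar
  src : V
  isPath : Q.IsPath tgt arrows src

variable {Q}

theorem IsPath.append {j k i : V} {l m : List Ar} (h : Q.IsPath j l k) (h' : Q.IsPath k m i) :
    Q.IsPath j (l ++ m) i := by
  induction l generalizing j with
  | nil => cases h; exact h'
  | cons a l ih => exact ⟨h.1, ih h.2⟩

theorem IsPath.dropLast {j i : V} {l : List Ar} (h : Q.IsPath j l i) (hl : l ≠ []) :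
    Q.IsPath j l.dropLast (Q.t (l.getLast hl)) := by
  induction l generalizing j with
  | nil => exact absurd rfl hl
  | cons a l ih =>
    cases l with
    | nil => exact h.1.symm
    | cons b l => exact ⟨h.1, ih h.2 (by simp)⟩

theorem IsPath.tail {j i : V} {l : List Ar} (h : Q.IsPath j l i) (hl : l ≠ []) :
    Q.IsPath (Q.s (l.head hl)) l.tail i := by
  cases l with
  | nil => exact absurd rfl hl
  | cons a l => exact h.2

namespace Path

/-- The length `l(p)`. -/
def length (p : Q.Path) : ℕ := p.arrows.length

/-- The degree `|p|`. -/
def degree (p : Q.Path) : ℤ := (p.arrows.map Q.deg).sum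

variable (Q) in
/-- The trivial path `e_i`. -/
def triv (i : V) : Q.Path := ⟨i, [], i, rfl⟩

variable (Q) in
/-- An arrow as a path of length one. -/
def single (a : Ar) : Q.Path := ⟨Q.t a, [a], Q.s a, rfl, rfl⟩

/-- The concatenation `p q` (first `q`, then `p`). -/
def comp (p q : Q.Path) (h : p.src = q.tgt) : Q.Path :=
  ⟨p.tgt, p.arrows ++ q.arrows, q.src, p.isPath.append (h ▸ q.isPath)⟩

/-- `a_l ⋯ a_1 ↦ a_{l-1} ⋯ a_1`. -/
def tail (p : Q.Path) (h : p.arrows ≠ []) : Q.Path :=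
  ⟨Q.s (p.arrows.head h), p.arrows.tail, p.src, p.isPath.tail h⟩

/-- `a_l ⋯ a_1 ↦ a_l ⋯ a_2`. -/
def init (p : Q.Path) (h : p.arrows ≠ []) : Q.Path :=
  ⟨p.tgt, p.arrows.dropLast, Q.t (p.arrows.getLast h), p.isPath.dropLast h⟩

end Path

variable (Q) (K : Type*) [Field K]

/-- The path algebra `K Q`: the vector space on the set of all paths. -/
def PathAlgebra := Q.Path →₀ K

namespace PathAlgebra

instance : AddCommGroup (Q.PathAlgebra K) := inferInstanceAs (AddCommGroup (Q.Path →₀ K))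
instance : Module K (Q.PathAlgebra K) := inferInstanceAs (Module K (Q.Path →₀ K))

variable {Q}

/-- A path as an element of the path algebra. -/
def of (p : Q.Path) : Q.PathAlgebra K := Finsupp.single p (1 : K)

variable (Q) in
/-- The paths form a basis of the path algebra. -/
def pathBasis : Module.Basis Q.Path K (Q.PathAlgebra K) :=
  ⟨LinearEquiv.refl K (Q.Path →₀ K)⟩

@[simp] theorem pathBasis_apply (p : Q.Path) : pathBasis Q K p = of K p := rfl

open Classical in
/-- The product of two paths: their concatenation, or zero if they do not compose. -/
def mulPath (p q : Q.Path) : Q.PathAlgebra K :=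
  if h : p.src = q.tgt then of K (p.comp q h) else 0

variable (Q) in
/-- The bilinear extension of the product of paths. -/
def mulLin : Q.PathAlgebra K →ₗ[K] Q.PathAlgebra K →ₗ[K] Q.PathAlgebra K :=
  (pathBasis Q K).constr K fun p => (pathBasis Q K).constr K fun q => mulPath K p q

instance : Mul (Q.PathAlgebra K) := ⟨fun x y => mulLin Q K x y⟩

theorem mul_def (x y : Q.PathAlgebra K) : x * y = mulLin Q K x y := rfl

theorem of_mul_of (p q : Q.Path) : (of K p * of K q : Q.PathAlgebra K) = mulPath K p q := by
  rw [mul_def, mulLin, ← pathBasis_apply, ← pathBasis_apply, Module.Basis.constr_basis,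
    Module.Basis.constr_basis]

theorem of_mul_of_eq (p q : Q.Path) (h : p.src = q.tgt) :
    (of K p * of K q : Q.PathAlgebra K) = of K (p.comp q h) := by
  rw [of_mul_of, mulPath, dif_pos h]

theorem of_mul_of_ne (p q : Q.Path) (h : p.src ≠ q.tgt) :
    (of K p * of K q : Q.PathAlgebra K) = 0 := by
  rw [of_mul_of, mulPath, dif_neg h]

theorem induction {P : Q.PathAlgebra K → Prop} (x : Q.PathAlgebra K) (h0 : P 0)
    (hadd : ∀ x y, P x → P y → P (x + y)) (hof : ∀ (c : K) p, P (c • of K p)) : P x :=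
  Finsupp.induction_linear (motive := P) x h0 hadd fun p c => by
    have : (Finsupp.single p c : Q.Path →₀ K) = c • Finsupp.single p 1 := by simp
    rw [this]; exact hof c p

instance : NonUnitalNonAssocRing (Q.PathAlgebra K) where
  left_distrib x y z := by simp [mul_def]
  right_distrib x y z := by simp [mul_def]
  zero_mul x := by simp [mul_def]
  mul_zero x := by simp [mul_def]

instance : IsScalarTower K (Q.PathAlgebra K) (Q.PathAlgebra K) :=
  ⟨fun c x y => by simp [mul_def]⟩

instance : SMulCommClass K (Q.PathAlgebra K) (Q.PathAlgebra K) :=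
  ⟨fun c x y => by simp [mul_def]⟩

theorem of_assoc (p q r : Q.Path) :
    (of K p * of K q * of K r : Q.PathAlgebra K) = of K p * (of K q * of K r) := by
  by_cases h : p.src = q.tgt <;> by_cases h' : q.src = r.tgt
  · rw [of_mul_of_eq K p q h, of_mul_of_eq K q r h', of_mul_of_eq K (p.comp q h) r h',
      of_mul_of_eq K p (q.comp r h') h]
    simp [Path.comp]
  · rw [of_mul_of_eq K p q h, of_mul_of_ne K q r h', of_mul_of_ne K (p.comp q h) r h', mul_zero]
  · rw [of_mul_of_ne K p q h, of_mul_of_eq K q r h', of_mul_of_ne K p (q.comp r h') h, zero_mul]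
  · rw [of_mul_of_ne K p q h, of_mul_of_ne K q r h', zero_mul, mul_zero]

protected theorem mul_assoc (x y z : Q.PathAlgebra K) : x * y * z = x * (y * z) := by
  induction x using induction with
  | h0 => simp
  | hadd x x' h h' => simp [add_mul, h, h']
  | hof c p =>
    induction y using induction with
    | h0 => simp
    | hadd x x' h h' => simp only [add_mul, mul_add, h, h']
    | hof c' q =>
      induction z using induction with
      | h0 => simp
      | hadd x x' h h' => simp only [mul_add, h, h']
      | hof c'' r => simp only [smul_mul_assoc, mul_smul_comm, of_assoc]

theorem triv_mul_of [DecidableEq V] (i : V) (p : Q.Path) :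
    (of K (Path.triv Q i) * of K p : Q.PathAlgebra K) = if p.tgt = i then of K p else 0 := by
  split_ifs with h
  · subst h; exact of_mul_of_eq K _ p rfl
  · exact of_mul_of_ne K _ _ (Ne.symm h)

theorem of_mul_triv [DecidableEq V] (i : V) (p : Q.Path) :
    (of K p * of K (Path.triv Q i) : Q.PathAlgebra K) = if p.src = i then of K p else 0 := by
  split_ifs with h
  · subst h; rw [of_mul_of_eq K p _ rfl]; simp [Path.comp, Path.triv]
  · exact of_mul_of_ne K _ _ h

variable [Fintype V]

/-- The unit is the sum of the trivial paths. -/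
instance : One (Q.PathAlgebra K) := ⟨∑ i, of K (Path.triv Q i)⟩

theorem one_def : (1 : Q.PathAlgebra K) = ∑ i, of K (Path.triv Q i) := rfl

instance : Ring (Q.PathAlgebra K) where
  mul_assoc := PathAlgebra.mul_assoc K
  one_mul x := by
    classical
    induction x using induction with
    | h0 => simp
    | hadd x x' h h' => rw [mul_add, h, h']
    | hof c p => rw [mul_smul_comm]; simp [one_def, Finset.sum_mul, triv_mul_of]
  mul_one x := by
    classical
    induction x using induction with
    | h0 => simp
    | hadd x x' h h' => rw [add_mul, h, h']
    | hof c p => rw [smul_mul_assoc]; simp [one_def, Finset.mul_sum, of_mul_triv]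
  __ := (inferInstance : NonUnitalNonAssocRing (Q.PathAlgebra K))
  __ := (inferInstance : AddCommGroup (Q.PathAlgebra K))

instance : Algebra K (Q.PathAlgebra K) := Algebra.ofModule smul_mul_assoc mul_smul_comm

end PathAlgebra

/-- `(Q, S)` is a gentle pair. The relation set `S` consists of paths of length two, and
`(b, a) ∈ S` stands for the path `b a` (first `a`, then `b`). -/
structure IsGentle (S : Set (Ar × Ar)) : Prop where
  composable : ∀ b a, (b, a) ∈ S → Q.s b = Q.t a
  source_le : ∀ i, {a | Q.s a = i}.encard ≤ 2
  target_le : ∀ i, {a | Q.t a = i}.encard ≤ 2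
  rel_right : ∀ a, {b | (a, b) ∈ S}.Subsingleton
  rel_left : ∀ a, {c | (c, a) ∈ S}.Subsingleton
  nonrel_right : ∀ a, {b | Q.s a = Q.t b ∧ (a, b) ∉ S}.Subsingleton
  nonrel_left : ∀ a, {c | Q.s c = Q.t a ∧ (c, a) ∉ S}.Subsingleton

end GradedQuiver

/-- A graded skew-gentle triple `(Q, R, Sp)`. The special loops have degree `0`, so that
`ε² - ε` is homogeneous, and `ε² ∉ R`, so that `R` and `{ε² | ε ∈ Sp}` do not overlap. If `V` is
finite, so is `Ar`, since at most two arrows start at each vertex. -/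
structure SkewGentleTriple (V Ar : Type*) extends GradedQuiver V Ar where
  R : Set (Ar × Ar)
  Sp : Set Ar
  loop : ∀ e ∈ Sp, s e = t e
  deg_special : ∀ e ∈ Sp, deg e = 0
  sq_notMem : ∀ e ∈ Sp, (e, e) ∉ R
  gentle : toGradedQuiver.IsGentle (R ∪ {x | ∃ e ∈ Sp, x = (e, e)})

namespace SkewGentleTriple

open GradedQuiver

variable {V Ar : Type*} (T : SkewGentleTriple V Ar)

/-- The underlying graded quiver. -/
abbrev Q : GradedQuiver V Ar := T.toGradedQuiver

/-- `S = R ∪ {ε² | ε ∈ Sp}`. -/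
def S : Set (Ar × Ar) := T.R ∪ {x | ∃ e ∈ T.Sp, x = (e, e)}

/-- The set `𝓑` of paths without subpaths in `S`. -/
abbrev Bp : Type _ := {p : T.Q.Path // p.arrows.IsChain fun b a => (b, a) ∉ T.S}

/-- The set `Γ_n` of paths of length `n` all of whose subpaths of length two are in `S`. -/
abbrev Gam (n : ℕ) : Type _ :=
  {q : T.Q.Path // q.arrows.length = n ∧ q.arrows.IsChain fun b a => (b, a) ∈ T.S}

variable (K : Type*) [Field K] [Fintype V]

/-- The relations `b a = 0` for `b a ∈ R` and `ε² = ε` for `ε ∈ Sp`. -/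
inductive Rel : T.Q.PathAlgebra K → T.Q.PathAlgebra K → Prop
  | zero (b a : Ar) (h : (b, a) ∈ T.R) :
      Rel (PathAlgebra.of K (Path.single T.Q b) * PathAlgebra.of K (Path.single T.Q a)) 0
  | idem (e : Ar) (h : e ∈ T.Sp) :
      Rel (PathAlgebra.of K (Path.single T.Q e) * PathAlgebra.of K (Path.single T.Q e))
        (PathAlgebra.of K (Path.single T.Q e))

/-- The skew-gentle algebra `A = K Q / ⟨R ∪ {ε² - ε | ε ∈ Sp}⟩`. -/
def Alg := RingQuot (T.Rel K)

instance : Ring (T.Alg K) := inferInstanceAs (Ring (RingQuot (T.Rel K)))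
instance : Algebra K (T.Alg K) := inferInstanceAs (Algebra K (RingQuot (T.Rel K)))
instance : AddCommGroup (T.Alg K) := Ring.toAddCommGroup

/-- The canonical projection `π : K Q → A`. -/
def quot : T.Q.PathAlgebra K →ₐ[K] T.Alg K := RingQuot.mkAlgHom K (T.Rel K)

theorem quot_surjective : Function.Surjective (T.quot K) :=
  RingQuot.mkAlgHom_surjective K (T.Rel K)

theorem quot_rel {x y : T.Q.PathAlgebra K} (h : T.Rel K x y) : T.quot K x = T.quot K y :=
  RingQuot.mkAlgHom_rel K h

/-- The class in `A` of a path. -/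
def cls (p : T.Q.Path) : T.Alg K := T.quot K (PathAlgebra.of K p)

/-- The idempotent `e_i` in `A`; these span the subalgebra `E`. -/
def idem (i : V) : T.Alg K := T.cls K (Path.triv T.Q i)

/-- The class in `A` of an arrow. -/
def arr (a : Ar) : T.Alg K := T.cls K (Path.single T.Q a)

theorem cls_mul_eq (p q : T.Q.Path) (h : p.src = q.tgt) :
    T.cls K p * T.cls K q = T.cls K (p.comp q h) := by
  rw [cls, cls, cls, ← map_mul, PathAlgebra.of_mul_of_eq K p q h]

theorem cls_mul_ne (p q : T.Q.Path) (h : p.src ≠ q.tgt) : T.cls K p * T.cls K q = 0 := by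
  rw [cls, cls, ← map_mul, PathAlgebra.of_mul_of_ne K p q h, map_zero]

theorem arr_mul_zero {b a : Ar} (h : (b, a) ∈ T.R) : T.arr K b * T.arr K a = 0 := by
  rw [arr, arr, cls, cls, ← map_mul, quot_rel T K (Rel.zero b a h), map_zero]

theorem arr_mul_idem {e : Ar} (h : e ∈ T.Sp) : T.arr K e * T.arr K e = T.arr K e := by
  rw [arr, cls, ← map_mul, quot_rel T K (Rel.idem e h)]


/-! ### The basis `𝓑` of `A` -/

variable {T}

/-- The trivial path as an element of `𝓑`. -/
def Bp.triv (T : SkewGentleTriple V Ar) (i : V) : T.Bp := ⟨Path.triv T.Q i, List.isChain_nil⟩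

/-- The class in `A` of an element of `𝓑`. -/
def Bp.cls (p : T.Bp) : T.Alg K := T.cls K p.1

open Classical in
/-- The product of an arrow and an element of `𝓑`, written in `𝓑`. -/
def consBp (a : Ar) (p : T.Bp) : T.Bp →₀ K :=
  if h : T.s a = p.1.tgt then
    if hc : (a :: p.1.arrows).IsChain fun b a => (b, a) ∉ T.S then
      Finsupp.single ⟨(Path.single T.Q a).comp p.1 h, hc⟩ 1
    else if a ∈ T.Sp ∧ p.1.arrows.head? = some a then Finsupp.single p 1
    else 0
  else 0

variable (T)

/-- The action of an arrow on the span of `𝓑`. -/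
def act (a : Ar) : Module.End K (T.Bp →₀ K) := Finsupp.linearCombination K (consBp K a)

open Classical in
/-- The action of a vertex on the span of `𝓑`. -/
def proj (i : V) : Module.End K (T.Bp →₀ K) :=
  Finsupp.linearCombination K fun p => if p.1.tgt = i then Finsupp.single p 1 else 0

/-- The action of a path on the span of `𝓑`. -/
def actPath (p : T.Q.Path) : Module.End K (T.Bp →₀ K) :=
  (p.arrows.map (T.act K)).prod * T.proj K p.src

variable {T}

theorem act_single (a : Ar) (p : T.Bp) : T.act K a (Finsupp.single p 1) = consBp K a p := by
  simp [act]

open Classical in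
theorem proj_single (i : V) (p : T.Bp) :
    T.proj K i (Finsupp.single p 1) = if p.1.tgt = i then Finsupp.single p 1 else 0 := by
  simp [proj]

theorem end_ext {f g : Module.End K (T.Bp →₀ K)}
    (h : ∀ p, f (Finsupp.single p 1) = g (Finsupp.single p 1)) : f = g :=
  Finsupp.lhom_ext' fun p => LinearMap.ext_ring (h p)

theorem act_mul_proj (a : Ar) : T.act K a * T.proj K (T.s a) = T.act K a := by
  refine end_ext K fun p => ?_
  rw [Module.End.mul_apply, proj_single]
  split_ifs with h
  · rfl
  · rw [act_single, consBp, dif_neg (Ne.symm h), map_zero]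

theorem Bp.tgt_of_head {p : T.Bp} {a : Ar} (h : p.1.arrows.head? = some a) :
    p.1.tgt = T.t a := by
  obtain ⟨⟨j, l, i, hp⟩, hc⟩ := p
  cases l with
  | nil => simp at h
  | cons b l =>
    simp only [List.head?_cons, Option.some.injEq] at h
    subst h; exact hp.1.symm

theorem consBp_cases (a : Ar) (p : T.Bp) :
    consBp K a p = 0 ∨ ∃ q : T.Bp, consBp K a p = Finsupp.single q 1 ∧
      q.1.arrows.head? = some a := by
  unfold consBp
  split_ifs with h1 h2 h3
  · exact Or.inr ⟨_, rfl, rfl⟩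
  · exact Or.inr ⟨p, rfl, h3.2⟩
  · exact Or.inl rfl
  · exact Or.inl rfl

theorem proj_mul_act_eq (a : Ar) : T.proj K (T.t a) * T.act K a = T.act K a := by
  refine end_ext K fun p => ?_
  rw [Module.End.mul_apply, act_single]
  rcases consBp_cases K a p with h | ⟨q, h, hq⟩
  · simp [h]
  · rw [h, proj_single, if_pos (Bp.tgt_of_head hq)]

theorem proj_mul_act_ne (a : Ar) {j : V} (hj : T.t a ≠ j) : T.proj K j * T.act K a = 0 := by
  refine end_ext K fun p => ?_
  rw [Module.End.mul_apply, act_single]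
  rcases consBp_cases K a p with h | ⟨q, h, hq⟩
  · simp [h]
  · rw [h, proj_single, if_neg (by rw [Bp.tgt_of_head hq]; exact hj), LinearMap.zero_apply]

theorem proj_mul_actPath_eq (p : T.Q.Path) : T.proj K p.tgt * T.actPath K p = T.actPath K p := by
  obtain ⟨j, l, i, hp⟩ := p
  cases l with
  | nil =>
    cases hp
    simp only [actPath, List.map_nil, List.prod_nil, one_mul]
    refine end_ext K fun p => ?_
    rw [Module.End.mul_apply, proj_single]
    split_ifs with h
    · rw [proj_single, if_pos h]
    · simp
  | cons a l =>
    obtain ⟨rfl, -⟩ := hp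
    simp only [actPath, List.map_cons, List.prod_cons, ← mul_assoc, proj_mul_act_eq]

theorem proj_mul_actPath_ne (p : T.Q.Path) {k : V} (hk : p.tgt ≠ k) :
    T.proj K k * T.actPath K p = 0 := by
  obtain ⟨j, l, i, hp⟩ := p
  cases l with
  | nil =>
    cases hp
    simp only [actPath, List.map_nil, List.prod_nil, one_mul]
    refine end_ext K fun p => ?_
    rw [Module.End.mul_apply, proj_single]
    split_ifs with h
    · rw [proj_single, if_neg (by rw [h]; exact hk), LinearMap.zero_apply]
    · simp
  | cons a l =>
    have hk' : T.t a ≠ k := fun h => hk (hp.1.symm.trans h)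
    simp only [actPath, List.map_cons, List.prod_cons, ← mul_assoc, proj_mul_act_ne K a hk',
      zero_mul]

theorem actPath_single (a : Ar) : T.actPath K (Path.single T.Q a) = T.act K a := by
  simp only [actPath, Path.single, List.map_cons, List.map_nil, List.prod_cons, List.prod_nil,
    mul_one, act_mul_proj]

theorem sum_proj : ∑ i, T.proj K i = 1 := by
  classical
  refine end_ext K fun p => ?_
  simp [LinearMap.sum_apply, proj_single]

variable (T) in
/-- The representation of the path algebra on the span of `𝓑`. -/
def pathRep : T.Q.PathAlgebra K →ₐ[K] Module.End K (T.Bp →₀ K) :=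
  AlgHom.ofLinearMap ((PathAlgebra.pathBasis T.Q K).constr K (T.actPath K))
    (by
      rw [PathAlgebra.one_def, map_sum, ← sum_proj K]
      refine Finset.sum_congr rfl fun i _ => ?_
      rw [← PathAlgebra.pathBasis_apply, Module.Basis.constr_basis]
      simp [actPath, Path.triv])
    (by
      intro x y
      induction x using PathAlgebra.induction with
      | h0 => simp
      | hadd x x' h h' => rw [add_mul, map_add, map_add, h, h', add_mul]
      | hof c p =>
        induction y using PathAlgebra.induction with
        | h0 => simp
        | hadd x x' h h' => rw [mul_add, map_add, map_add, h, h', mul_add]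
        | hof c' q =>
          rw [smul_mul_assoc, mul_smul_comm, map_smul, map_smul, map_smul, map_smul,
            smul_mul_assoc, mul_smul_comm]
          congr 2
          rw [← PathAlgebra.pathBasis_apply, ← PathAlgebra.pathBasis_apply,
            Module.Basis.constr_basis, Module.Basis.constr_basis,
            PathAlgebra.pathBasis_apply, PathAlgebra.pathBasis_apply]
          by_cases h : p.src = q.tgt
          · rw [PathAlgebra.of_mul_of_eq K p q h, ← PathAlgebra.pathBasis_apply,
              Module.Basis.constr_basis]
            conv_rhs => rw [actPath, mul_assoc, h, proj_mul_actPath_eq]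
            simp [actPath, Path.comp, mul_assoc]
          · rw [PathAlgebra.of_mul_of_ne K p q h, map_zero]
            conv_rhs => rw [actPath, mul_assoc, proj_mul_actPath_ne K q (Ne.symm h), mul_zero])

theorem pathRep_of (p : T.Q.Path) : T.pathRep K (PathAlgebra.of K p) = T.actPath K p := by
  rw [← PathAlgebra.pathBasis_apply]
  exact Module.Basis.constr_basis (PathAlgebra.pathBasis T.Q K) K (T.actPath K) p

theorem consBp_of_rel {b a : Ar} (h : (b, a) ∈ T.R) {p : T.Bp} (hp : p.1.arrows.head? = some a) :
    consBp K b p = 0 := by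
  obtain ⟨⟨j, l, i, hl⟩, hc⟩ := p
  cases l with
  | nil => simp at hp
  | cons c l =>
    simp only [List.head?_cons, Option.some.injEq] at hp
    subst hp
    unfold consBp
    split_ifs with h1 h2 h3
    · exact absurd (Or.inl h) (List.isChain_cons_cons.1 h2).1
    · have : c = b := by simpa using h3.2
      subst this
      exact absurd h (T.sq_notMem _ h3.1)
    · rfl
    · rfl

theorem consBp_of_special {e : Ar} (h : e ∈ T.Sp) {p : T.Bp} (hp : p.1.arrows.head? = some e) :
    consBp K e p = Finsupp.single p 1 := by
  have ht := Bp.tgt_of_head hp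
  unfold consBp
  rw [dif_pos ((T.loop e h).trans ht.symm), dif_neg, if_pos ⟨h, hp⟩]
  obtain ⟨⟨j, l, i, hl⟩, hc⟩ := p
  cases l with
  | nil => simp at hp
  | cons c l =>
    simp only [List.head?_cons, Option.some.injEq] at hp
    subst hp
    exact fun h2 => (List.isChain_cons_cons.1 h2).1 (Or.inr ⟨c, h, rfl⟩)

theorem act_mul_act_zero {b a : Ar} (h : (b, a) ∈ T.R) : T.act K b * T.act K a = 0 := by
  refine end_ext K fun p => ?_
  rw [Module.End.mul_apply, act_single]
  rcases consBp_cases K a p with h' | ⟨q, h', hq⟩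
  · simp [h']
  · rw [h', act_single, consBp_of_rel K h hq, LinearMap.zero_apply]

theorem act_mul_act_idem {e : Ar} (h : e ∈ T.Sp) : T.act K e * T.act K e = T.act K e := by
  refine end_ext K fun p => ?_
  rw [Module.End.mul_apply, act_single]
  rcases consBp_cases K e p with h' | ⟨q, h', hq⟩
  · simp [h']
  · rw [h', act_single, consBp_of_special K h hq]

variable (T) in
/-- The representation of `A` on the span of `𝓑`. -/
def rep : T.Alg K →ₐ[K] Module.End K (T.Bp →₀ K) :=
  RingQuot.liftAlgHom K ⟨T.pathRep K, by
    rintro x y (⟨b, a, h⟩ | ⟨e, h⟩)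
    · rw [map_mul, pathRep_of, pathRep_of, actPath_single, actPath_single,
        act_mul_act_zero K h, map_zero]
    · rw [map_mul, pathRep_of, actPath_single, act_mul_act_idem K h]⟩

theorem rep_cls (p : T.Q.Path) : T.rep K (T.cls K p) = T.actPath K p := by
  refine (RingQuot.liftAlgHom_mkAlgHom_apply K _ _ _).trans ?_
  exact pathRep_of K p

theorem cls_mul_arr (a : Ar) (p : T.Bp) :
    Finsupp.linearCombination K (Bp.cls K) (consBp K a p) = T.arr K a * p.cls K := by
  obtain ⟨⟨j, l, i, hl⟩, hc⟩ := p
  unfold consBp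
  split_ifs with h1 h2 h3
  · simp [Bp.cls, arr, cls_mul_eq K (T := T) (Path.single T.Q a) _ h1]
  · cases l with
    | nil => simp at h3
    | cons b l =>
      obtain ⟨h3, h4⟩ := h3
      simp only [List.head?_cons, Option.some.injEq] at h4
      subst h4
      have : T.cls K ⟨j, b :: l, i, hl⟩ = T.arr K b * T.cls K ⟨T.s b, l, i, hl.2⟩ := by
        obtain ⟨rfl, -⟩ := hl
        exact (T.cls_mul_eq K (Path.single T.Q b) ⟨T.s b, l, i, _⟩ rfl).symm
      simp only [Finsupp.linearCombination_single, one_smul, Bp.cls, this]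
      rw [← mul_assoc, arr_mul_idem T K h3]
  · cases l with
    | nil => exact absurd (List.isChain_singleton a) h2
    | cons b l =>
      have hS : (a, b) ∈ T.S := by
        by_contra h
        exact h2 (List.isChain_cons_cons.2 ⟨h, hc⟩)
      have hR : (a, b) ∈ T.R := by
        rcases hS with h | ⟨e, he, h⟩
        · exact h
        · obtain ⟨rfl, rfl⟩ := Prod.mk.inj h
          exact absurd ⟨he, rfl⟩ h3
      have : T.cls K ⟨j, b :: l, i, hl⟩ = T.arr K b * T.cls K ⟨T.s b, l, i, hl.2⟩ := by
        obtain ⟨rfl, -⟩ := hl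
        exact (T.cls_mul_eq K (Path.single T.Q b) ⟨T.s b, l, i, _⟩ rfl).symm
      simp only [map_zero, Bp.cls, this]
      rw [← mul_assoc, arr_mul_zero T K hR, zero_mul]
  · rw [map_zero]
    exact (T.cls_mul_ne K (Path.single T.Q a) _ h1).symm

theorem linearCombination_rep (x : T.Alg K) (y : T.Bp →₀ K) :
    Finsupp.linearCombination K (Bp.cls K) (T.rep K x y) =
      x * Finsupp.linearCombination K (Bp.cls K) y := by
  have hact : ∀ (a : Ar) (y : T.Bp →₀ K), Finsupp.linearCombination K (Bp.cls K) (T.act K a y) =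
      T.arr K a * Finsupp.linearCombination K (Bp.cls K) y := by
    intro a y
    induction y using Finsupp.induction_linear with
    | zero => simp
    | add y y' h h' => simp only [map_add, h, h', mul_add]
    | single p c =>
      rw [← mul_one c, ← smul_eq_mul, ← Finsupp.smul_single, map_smul, act_single, map_smul,
        map_smul, cls_mul_arr, mul_smul_comm]
      simp
  have hproj : ∀ (i : V) (y : T.Bp →₀ K), Finsupp.linearCombination K (Bp.cls K) (T.proj K i y) =
      T.idem K i * Finsupp.linearCombination K (Bp.cls K) y := by
    classical
    intro i y
    induction y using Finsupp.induction_linear with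
    | zero => simp
    | add y y' h h' => simp only [map_add, h, h', mul_add]
    | single p c =>
      rw [← mul_one c, ← smul_eq_mul, ← Finsupp.smul_single, map_smul, proj_single, map_smul,
        map_smul, mul_smul_comm]
      congr 1
      split_ifs with h
      · subst h
        simp only [Finsupp.linearCombination_single, one_smul, Bp.cls, idem]
        exact (T.cls_mul_eq K (Path.triv T.Q p.1.tgt) p.1 rfl).symm
      · simp only [Finsupp.linearCombination_single, one_smul, Bp.cls, idem, map_zero]
        exact (T.cls_mul_ne K (Path.triv T.Q i) p.1 (Ne.symm h)).symm
  have hpath : ∀ (p : T.Q.Path) (y : T.Bp →₀ K),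
      Finsupp.linearCombination K (Bp.cls K) (T.actPath K p y) =
        T.cls K p * Finsupp.linearCombination K (Bp.cls K) y := by
    rintro ⟨j, l, i, hl⟩ y
    induction l generalizing j with
    | nil =>
      cases hl
      simpa [actPath, idem, Path.triv] using hproj i y
    | cons a l ih =>
      have : T.cls K ⟨j, a :: l, i, hl⟩ = T.arr K a * T.cls K ⟨T.s a, l, i, hl.2⟩ := by
        obtain ⟨rfl, -⟩ := hl
        exact (T.cls_mul_eq K (Path.single T.Q a) ⟨T.s a, l, i, _⟩ rfl).symm
      rw [this, mul_assoc, ← ih _ hl.2, ← hact]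
      simp [actPath]
  obtain ⟨x, rfl⟩ := T.quot_surjective K x
  induction x using PathAlgebra.induction with
  | h0 => simp
  | hadd x x' h h' => simp only [map_add, LinearMap.add_apply, h, h', add_mul]
  | hof c p =>
    simp only [map_smul, LinearMap.smul_apply, smul_mul_assoc]
    congr 1
    have := hpath p y
    rwa [← rep_cls] at this

theorem actPath_triv (p : T.Bp) :
    T.actPath K p.1 (∑ i, Finsupp.single (Bp.triv T i) 1) = Finsupp.single p 1 := by
  classical
  obtain ⟨⟨j, l, i, hl⟩, hc⟩ := p
  induction l generalizing j with
  | nil =>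
    cases hl
    simp only [actPath, List.map_nil, List.prod_nil, one_mul, map_sum, proj_single]
    rw [Finset.sum_eq_single i]
    · simp [Bp.triv, Path.triv]
    · intro k _ hk
      simp [Bp.triv, Path.triv, hk]
    · simp
  | cons a l ih =>
    have h := ih (T.s a) hl.2 (List.IsChain.tail hc)
    simp only [actPath, List.map_cons, List.prod_cons, mul_assoc, Module.End.mul_apply] at h ⊢
    rw [h, act_single, consBp, dif_pos rfl, dif_pos hc]
    obtain ⟨rfl, -⟩ := hl
    rfl

variable (T) in
/-- `𝓑` is a `K`-basis of `A`. -/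
def basis : Module.Basis T.Bp K (T.Alg K) :=
  ⟨LinearEquiv.ofLinearMap
    ((LinearMap.applyₗ (∑ i, Finsupp.single (Bp.triv T i) (1 : K))).comp
      (T.rep K).toLinearMap)
    (Finsupp.linearCombination K (Bp.cls K))
    (end_ext K fun p => by
      simp only [LinearMap.comp_apply, Finsupp.linearCombination_single, one_smul, Bp.cls,
        AlgHom.toLinearMap_apply, rep_cls, LinearMap.applyₗ_apply_apply, actPath_triv,
        LinearMap.id_apply])
    (LinearMap.ext fun x => by
      simp only [LinearMap.comp_apply, AlgHom.toLinearMap_apply, LinearMap.applyₗ_apply_apply,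
        linearCombination_rep, LinearMap.id_apply]
      have : Finsupp.linearCombination K (Bp.cls K) (∑ i, Finsupp.single (Bp.triv T i) (1 : K)) =
          (1 : T.Alg K) := by
        rw [← map_one (T.quot K), PathAlgebra.one_def, map_sum, map_sum]
        simp [Bp.cls, cls, Bp.triv]
      rw [this, mul_one])⟩

theorem basis_apply (p : T.Bp) : T.basis K p = p.cls K := by
  simp [basis]

/-! ### Tensor products over `E` -/

theorem cls_cons {j i : V} {a : Ar} {l : List Ar} (h : T.Q.IsPath j (a :: l) i) :
    T.cls K ⟨j, a :: l, i, h⟩ = T.arr K a * T.cls K ⟨T.s a, l, i, h.2⟩ := by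
  obtain ⟨rfl, -⟩ := h
  exact (T.cls_mul_eq K (Path.single T.Q a) ⟨T.s a, l, i, _⟩ rfl).symm

variable (T) in
/-- The complement `Ā` of `E` in `A`, spanned by the classes of the paths of positive length. -/
def Abar : Submodule K (T.Alg K) :=
  Submodule.span K {x | ∃ p : T.Q.Path, p.arrows ≠ [] ∧ T.cls K p = x}

theorem cls_mem_Abar {p : T.Q.Path} (h : p.arrows ≠ []) : T.cls K p ∈ T.Abar K :=
  Submodule.subset_span ⟨p, h, rfl⟩

theorem arr_mem_Abar (a : Ar) : T.arr K a ∈ T.Abar K :=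
  cls_mem_Abar K (p := Path.single T.Q a) (List.cons_ne_nil _ _)

theorem cls_mul_cls_mem (p q : T.Q.Path) (h : p.arrows ≠ [] ∨ q.arrows ≠ []) :
    T.cls K p * T.cls K q ∈ T.Abar K := by
  by_cases h' : p.src = q.tgt
  · rw [cls_mul_eq T K p q h']
    refine cls_mem_Abar K ?_
    simpa [Path.comp, -not_and, not_and_or] using h
  · rw [cls_mul_ne T K p q h']
    exact zero_mem _

theorem alg_induction {P : T.Alg K → Prop} (x : T.Alg K) (h0 : P 0)
    (hadd : ∀ x y, P x → P y → P (x + y)) (hcls : ∀ (c : K) p, P (c • T.cls K p)) : P x := by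
  obtain ⟨x, rfl⟩ := T.quot_surjective K x
  induction x using PathAlgebra.induction with
  | h0 => simpa using h0
  | hadd x y h h' => rw [map_add]; exact hadd _ _ h h'
  | hof c p => rw [map_smul]; exact hcls c p

theorem mul_mem_Abar_left (x : T.Alg K) {y : T.Alg K} (hy : y ∈ T.Abar K) :
    x * y ∈ T.Abar K := by
  induction hy using Submodule.span_induction with
  | zero => simp
  | add y y' _ _ h h' => rw [mul_add]; exact add_mem h h'
  | smul c y _ h => rw [mul_smul_comm]; exact Submodule.smul_mem _ c h
  | mem y h =>
    obtain ⟨p, hp, rfl⟩ := h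
    induction x using alg_induction with
    | h0 => simp
    | hadd x x' h h' => rw [add_mul]; exact add_mem h h'
    | hcls c q =>
      rw [smul_mul_assoc]
      exact Submodule.smul_mem _ c (cls_mul_cls_mem K _ _ (Or.inr hp))

theorem mul_mem_Abar_right {x : T.Alg K} (hx : x ∈ T.Abar K) (y : T.Alg K) :
    x * y ∈ T.Abar K := by
  induction hx using Submodule.span_induction with
  | zero => simp
  | add y y' _ _ h h' => rw [add_mul]; exact add_mem h h'
  | smul c y _ h => rw [smul_mul_assoc]; exact Submodule.smul_mem _ c h
  | mem y h =>
    obtain ⟨p, hp, rfl⟩ := h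
    induction y using alg_induction with
    | h0 => simp
    | hadd x x' h h' => rw [mul_add]; exact add_mem h h'
    | hcls c q =>
      rw [mul_smul_comm]
      exact Submodule.smul_mem _ c (cls_mul_cls_mem K _ _ (Or.inl hp))

theorem Abar_eq_span : T.Abar K =
    Submodule.span K (Set.range fun p : {p : T.Bp // p.1.arrows ≠ []} => T.basis K p.1) := by
  apply le_antisymm
  · refine Submodule.span_le.2 ?_
    rintro _ ⟨⟨j, l, i, h⟩, hl, rfl⟩
    cases l with
    | nil => exact absurd rfl hl
    | cons a l =>
      rw [cls_cons, ← (T.basis K).linearCombination_repr (T.cls K ⟨T.s a, l, i, h.2⟩)]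
      generalize (T.basis K).repr (T.cls K ⟨T.s a, l, i, h.2⟩) = y
      induction y using Finsupp.induction_linear with
      | zero => simp
      | add y y' h h' => rw [map_add, mul_add]; exact add_mem h h'
      | single p c =>
        rw [Finsupp.linearCombination_single, mul_smul_comm]
        refine Submodule.smul_mem _ c ?_
        rw [basis_apply, ← cls_mul_arr]
        rcases consBp_cases K a p with h | ⟨q, h, hq⟩
        · simp [h]
        · rw [h, Finsupp.linearCombination_single, one_smul, ← basis_apply]
          exact Submodule.subset_span ⟨⟨q, fun h => by simp [h] at hq⟩, rfl⟩
  · refine Submodule.span_le.2 ?_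
    rintro _ ⟨⟨p, hp⟩, rfl⟩
    simp only [basis_apply]
    exact cls_mem_Abar K hp

variable (T) in
/-- The factors of `A ⊗ (sĀ)^{⊗ n} ⊗ A`: they are numbered from right to left by `0, …, n + 1`;
the outer factors are `A`, the inner ones `Ā`. -/
def Slot (n : ℕ) (i : Fin (n + 2)) : Submodule K (T.Alg K) :=
  if i = 0 ∨ i = Fin.last (n + 1) then ⊤ else T.Abar K

variable (T) in
/-- The elements of `𝓑` that lie in the `i`-th factor. -/
abbrev SlotIdx (n : ℕ) (i : Fin (n + 2)) : Type _ :=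
  {p : T.Bp // ¬(i = 0 ∨ i = Fin.last (n + 1)) → p.1.arrows ≠ []}

theorem Slot_eq_span (n : ℕ) (i : Fin (n + 2)) : T.Slot K n i =
    Submodule.span K (Set.range fun p : T.SlotIdx n i => T.basis K p.1) := by
  unfold Slot
  split_ifs with h
  · rw [eq_comm, eq_top_iff, ← (T.basis K).span_eq]
    refine Submodule.span_mono ?_
    rintro _ ⟨p, rfl⟩
    exact ⟨⟨p, fun h' => absurd h h'⟩, rfl⟩
  · rw [Abar_eq_span]
    congr 1
    ext x
    exact ⟨fun ⟨p, hp⟩ => ⟨⟨p.1, fun _ => p.2⟩, hp⟩, fun ⟨p, hp⟩ => ⟨⟨p.1, p.2 h⟩, hp⟩⟩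

theorem mem_Slot {n : ℕ} {i : Fin (n + 2)} {x : T.Alg K}
    (h : ¬(i = 0 ∨ i = Fin.last (n + 1)) → x ∈ T.Abar K) : x ∈ T.Slot K n i := by
  unfold Slot
  split_ifs with h'
  · trivial
  · exact h h'

theorem mul_mem_Slot_left (n : ℕ) (i : Fin (n + 2)) (x : T.Alg K) {y : T.Alg K}
    (hy : y ∈ T.Slot K n i) : x * y ∈ T.Slot K n i :=
  mem_Slot K fun h => mul_mem_Abar_left K x (by rwa [Slot, if_neg h] at hy)

theorem mul_mem_Slot_right (n : ℕ) (i : Fin (n + 2)) {x : T.Alg K} (hx : x ∈ T.Slot K n i)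
    (y : T.Alg K) : x * y ∈ T.Slot K n i :=
  mem_Slot K fun h => mul_mem_Abar_right K (by rwa [Slot, if_neg h] at hx) y

variable (T) in
/-- The basis of a factor that consists of elements of `𝓑`. -/
def slotBasis (n : ℕ) (i : Fin (n + 2)) : Module.Basis (T.SlotIdx n i) K (T.Slot K n i) :=
  (Module.Basis.span ((T.basis K).linearIndependent.comp (fun p : T.SlotIdx n i => p.1)
    Subtype.val_injective)).map (LinearEquiv.ofEq _ _ (Slot_eq_span K n i).symm)

theorem slotBasis_apply (n : ℕ) (i : Fin (n + 2)) (p : T.SlotIdx n i) :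
    (T.slotBasis K n i p : T.Alg K) = T.cls K p.1.1 := by
  simp only [slotBasis, Module.Basis.map_apply, LinearEquiv.coe_ofEq_apply,
    Module.Basis.span_apply, Function.comp, basis_apply, Bp.cls]

variable (T) in
/-- The tensor product over `K` of the factors. -/
def PreBar (n : ℕ) : Type _ := ⨂[K] i : Fin (n + 2), T.Slot K n i

instance (n : ℕ) : AddCommGroup (T.PreBar K n) :=
  inferInstanceAs (AddCommGroup (⨂[K] i : Fin (n + 2), T.Slot K n i))
instance (n : ℕ) : Module K (T.PreBar K n) :=
  inferInstanceAs (Module K (⨂[K] i : Fin (n + 2), T.Slot K n i))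

variable (T) in
/-- The pure tensor `x_{n+1} ⊗ ⋯ ⊗ x_0` over `K`. -/
def preBar (n : ℕ) (x : ∀ i, T.Slot K n i) : T.PreBar K n := PiTensorProduct.tprod K x

variable (T) in
/-- The basis of pure tensors of elements of `𝓑`. -/
def preBarBasis (n : ℕ) : Module.Basis (∀ i, T.SlotIdx n i) K (T.PreBar K n) :=
  Basis.piTensorProduct (T.slotBasis K n)

theorem preBarBasis_apply (n : ℕ) (p : ∀ i, T.SlotIdx n i) :
    T.preBarBasis K n p = T.preBar K n fun i => T.slotBasis K n i (p i) :=
  Basis.piTensorProduct_apply _ _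

variable (T) in
/-- Left multiplication by `e_v` on the `i`-th factor. -/
def slotLeft (n : ℕ) (v : V) (i : Fin (n + 2)) : T.Slot K n i →ₗ[K] T.Slot K n i :=
  (LinearMap.mulLeft K (T.idem K v)).restrict fun _ h => mul_mem_Slot_left K n i _ h

variable (T) in
/-- Right multiplication by `e_v` on the `i`-th factor. -/
def slotRight (n : ℕ) (v : V) (i : Fin (n + 2)) : T.Slot K n i →ₗ[K] T.Slot K n i :=
  (LinearMap.mulRight K (T.idem K v)).restrict fun _ h => mul_mem_Slot_right K n i h _

theorem slotLeft_coe (n : ℕ) (v : V) (i : Fin (n + 2)) (x : T.Slot K n i) :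
    (T.slotLeft K n v i x : T.Alg K) = T.idem K v * x := rfl

theorem slotRight_coe (n : ℕ) (v : V) (i : Fin (n + 2)) (x : T.Slot K n i) :
    (T.slotRight K n v i x : T.Alg K) = x * T.idem K v := rfl

variable (T) in
/-- Right multiplication by `e_v` on the `j`-th factor. -/
def preBarRight (n : ℕ) (j : Fin (n + 2)) (v : V) : T.PreBar K n →ₗ[K] T.PreBar K n :=
  PiTensorProduct.map fun i => if i = j then T.slotRight K n v i else LinearMap.id

variable (T) in
/-- Left multiplication by `e_v` on the `j`-th factor. -/
def preBarLeft (n : ℕ) (j : Fin (n + 2)) (v : V) : T.PreBar K n →ₗ[K] T.PreBar K n :=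
  PiTensorProduct.map fun i => if i = j then T.slotLeft K n v i else LinearMap.id

variable (T) in
/-- `⋯ ⊗ x_{j+1} ⊗ x_j ⊗ ⋯ ↦ ⋯ ⊗ x_{j+1} e_v ⊗ x_j ⊗ ⋯ - ⋯ ⊗ x_{j+1} ⊗ e_v x_j ⊗ ⋯`. -/
def barRel (n : ℕ) (k : Fin (n + 1) × V) : T.PreBar K n →ₗ[K] T.PreBar K n :=
  T.preBarRight K n k.1.succ k.2 - T.preBarLeft K n k.1.castSucc k.2

variable (T) in
/-- `A ⊗_E (sĀ)^{⊗_E n} ⊗_E A`. -/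
def Bar (n : ℕ) : Type _ := T.PreBar K n ⧸ ⨆ k, LinearMap.range (T.barRel K n k)

instance (n : ℕ) : AddCommGroup (T.Bar K n) :=
  inferInstanceAs (AddCommGroup (T.PreBar K n ⧸ ⨆ k, LinearMap.range (T.barRel K n k)))
instance (n : ℕ) : Module K (T.Bar K n) :=
  inferInstanceAs (Module K (T.PreBar K n ⧸ ⨆ k, LinearMap.range (T.barRel K n k)))

variable (T) in
/-- The element `x_{n+1} ⊗ s x_n ⊗ ⋯ ⊗ s x_1 ⊗ x_0` of `A ⊗_E (sĀ)^{⊗_E n} ⊗_E A`. -/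
def bar (n : ℕ) (x : Fin (n + 2) → T.Alg K) (hx : ∀ i, x i ∈ T.Slot K n i) : T.Bar K n :=
  Submodule.Quotient.mk (p := ⨆ k, LinearMap.range (T.barRel K n k))
    (T.preBar K n fun i => ⟨x i, hx i⟩)

open Classical in
/-- If the maps `r k` are diagonal in the basis `b`, the quotient by their images has as a basis
the vectors of `b` that are killed by all `r k`. -/
def quotBasis {M ι κ : Type*} [AddCommGroup M] [Module K M] (b : Module.Basis ι K M)
    (r : κ → M →ₗ[K] M) (C : ι → Prop) (c : κ → ι → K) (hr : ∀ k i, r k (b i) = c k i • b i)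
    (hC : ∀ i, C i → ∀ k, c k i = 0) (hN : ∀ i, ¬ C i → ∃ k, c k i ≠ 0) :
    Module.Basis {i // C i} K (M ⧸ ⨆ k, LinearMap.range (r k)) :=
  ⟨LinearEquiv.ofLinearMap
    (Submodule.liftQ _
      (b.constr K fun i => if h : C i then Finsupp.single (⟨i, h⟩ : {i // C i}) (1 : K) else 0)
      (iSup_le fun k => by
        rintro _ ⟨x, rfl⟩
        rw [LinearMap.mem_ker, ← LinearMap.comp_apply]
        suffices h : (b.constr K fun i => if h : C i then
            Finsupp.single (⟨i, h⟩ : {i // C i}) (1 : K) else 0) ∘ₗ r k = 0 by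
          rw [h, LinearMap.zero_apply]
        refine b.ext fun i => ?_
        rw [LinearMap.comp_apply, hr, map_smul, Module.Basis.constr_basis]
        split_ifs with h
        · rw [hC i h k, zero_smul, LinearMap.zero_apply]
        · rw [smul_zero, LinearMap.zero_apply]))
    (Finsupp.linearCombination K fun i => Submodule.Quotient.mk (b i.1))
    (Finsupp.lhom_ext' fun i => LinearMap.ext_ring (by
      simp only [LinearMap.comp_apply, Finsupp.lsingle_apply, Finsupp.linearCombination_single,
        one_smul, Submodule.liftQ_apply, Module.Basis.constr_basis, dif_pos i.2,
        LinearMap.id_apply]))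
    (Submodule.linearMap_qext _ (b.ext fun i => by
      simp only [LinearMap.comp_apply, Submodule.mkQ_apply, Submodule.liftQ_apply,
        Module.Basis.constr_basis, LinearMap.id_apply]
      split_ifs with h
      · simp
      · rw [map_zero, eq_comm, Submodule.Quotient.mk_eq_zero]
        obtain ⟨k, hk⟩ := hN i h
        refine Submodule.mem_iSup_of_mem k ⟨(c k i)⁻¹ • b i, ?_⟩
        rw [map_smul, hr, smul_smul, inv_mul_cancel₀ hk, one_smul]))⟩

theorem quotBasis_apply {M ι κ : Type*} [AddCommGroup M] [Module K M] (b : Module.Basis ι K M)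
    (r : κ → M →ₗ[K] M) (C : ι → Prop) (c : κ → ι → K) (hr : ∀ k i, r k (b i) = c k i • b i)
    (hC : ∀ i, C i → ∀ k, c k i = 0) (hN : ∀ i, ¬ C i → ∃ k, c k i ≠ 0) (i : {i // C i}) :
    quotBasis K b r C c hr hC hN i = Submodule.Quotient.mk (b i.1) := by
  simp [quotBasis]

theorem idem_mul_cls [DecidableEq V] (v : V) (p : T.Q.Path) :
    T.idem K v * T.cls K p = if p.tgt = v then T.cls K p else 0 := by
  rw [idem, cls, cls, ← map_mul, PathAlgebra.triv_mul_of]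
  split_ifs <;> simp

theorem cls_mul_idem [DecidableEq V] (v : V) (p : T.Q.Path) :
    T.cls K p * T.idem K v = if p.src = v then T.cls K p else 0 := by
  rw [idem, cls, cls, ← map_mul, PathAlgebra.of_mul_triv]
  split_ifs <;> simp

theorem tprod_if {n : ℕ} (f : ∀ i : Fin (n + 2), T.Slot K n i →ₗ[K] T.Slot K n i)
    (x : ∀ i, T.Slot K n i) (j : Fin (n + 2)) (c : K) (h : f j (x j) = c • x j) :
    PiTensorProduct.map (fun i => if i = j then f i else LinearMap.id)
      (PiTensorProduct.tprod K x) = c • PiTensorProduct.tprod K x := by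
  rw [PiTensorProduct.map_tprod]
  have : (fun i => (if i = j then f i else LinearMap.id) (x i)) =
      Function.update x j (c • x j) := by
    funext i
    by_cases hi : i = j
    · subst hi; simp [h]
    · simp [hi]
  rw [this, MultilinearMap.map_update_smul, Function.update_eq_self]

open Classical in
theorem barRel_basis (n : ℕ) (k : Fin (n + 1) × V) (p : ∀ i, T.SlotIdx n i) :
    T.barRel K n k (T.preBarBasis K n p) =
      (((if (p k.1.succ).1.1.src = k.2 then 1 else 0) -
        (if (p k.1.castSucc).1.1.tgt = k.2 then 1 else 0) : K)) • T.preBarBasis K n p := by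
  have h1 : T.preBarRight K n k.1.succ k.2 (T.preBarBasis K n p) =
      (if (p k.1.succ).1.1.src = k.2 then 1 else 0 : K) • T.preBarBasis K n p := by
    rw [preBarBasis_apply]
    refine tprod_if K _ _ _ _ (Subtype.ext ?_)
    refine (slotRight_coe K n _ _ _).trans ?_
    rw [slotBasis_apply, cls_mul_idem]
    split_ifs
    · rw [one_smul, slotBasis_apply]
    · rw [zero_smul]; rfl
  have h2 : T.preBarLeft K n k.1.castSucc k.2 (T.preBarBasis K n p) =
      (if (p k.1.castSucc).1.1.tgt = k.2 then 1 else 0 : K) • T.preBarBasis K n p := by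
    rw [preBarBasis_apply]
    refine tprod_if K _ _ _ _ (Subtype.ext ?_)
    refine (slotLeft_coe K n _ _ _).trans ?_
    rw [slotBasis_apply, idem_mul_cls]
    split_ifs
    · rw [one_smul, slotBasis_apply]
    · rw [zero_smul]; rfl
  rw [barRel, LinearMap.sub_apply, h1, h2, sub_smul]

variable (T) in
/-- The index set of the basis `α_{n+1} ⊗ sα_n ⊗ ⋯ ⊗ sα_1 ⊗ α_0` of `A ⊗_E (sĀ)^{⊗_E n} ⊗_E A`:
`α_j ∈ 𝓑`, of positive length for `1 ≤ j ≤ n`, with `t(α_j) = s(α_{j+1})`. -/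
abbrev BarWord (n : ℕ) : Type _ :=
  {α : ∀ i : Fin (n + 2), T.SlotIdx n i //
    ∀ j : Fin (n + 1), (α j.castSucc).1.1.tgt = (α j.succ).1.1.src}

/-- The path `α_j` in a word. -/
def BarWord.path {n : ℕ} (α : T.BarWord n) (j : Fin (n + 2)) : T.Q.Path := (α.1 j).1.1

variable (T) in
open Classical in
/-- The basis of `A ⊗_E (sĀ)^{⊗_E n} ⊗_E A`. -/
def barBasis (n : ℕ) : Module.Basis (T.BarWord n) K (T.Bar K n) :=
  quotBasis K (T.preBarBasis K n) (T.barRel K n)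
    (fun α => ∀ j : Fin (n + 1), (α j.castSucc).1.1.tgt = (α j.succ).1.1.src) _
    (barRel_basis K n) (fun p hp k => by rw [hp k.1, sub_self])
    (fun p hp => by
      obtain ⟨j, hj⟩ := not_forall.1 hp
      exact ⟨(j, (p j.succ).1.1.src), by simp [hj]⟩)

theorem cls_path_mem {n : ℕ} (α : T.BarWord n) (j : Fin (n + 2)) :
    T.cls K (α.path j) ∈ T.Slot K n j :=
  mem_Slot K fun h => cls_mem_Abar K ((α.1 j).2 h)

theorem barBasis_apply (n : ℕ) (α : T.BarWord n) :
    T.barBasis K n α = T.bar K n (fun j => T.cls K (α.path j)) (cls_path_mem K α) := by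
  refine (quotBasis_apply K _ _ _ _ _ _ _ α).trans ?_
  rw [preBarBasis_apply, bar]
  congr 2
  funext i
  exact Subtype.ext (slotBasis_apply K n i _)

variable (T) in
/-- `A ⊗_K K Γ_n ⊗_K A`. -/
def PreCS (n : ℕ) : Type _ := (T.Alg K ⊗[K] (T.Gam n →₀ K)) ⊗[K] T.Alg K

instance (n : ℕ) : AddCommGroup (T.PreCS K n) :=
  inferInstanceAs (AddCommGroup ((T.Alg K ⊗[K] (T.Gam n →₀ K)) ⊗[K] T.Alg K))
instance (n : ℕ) : Module K (T.PreCS K n) :=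
  inferInstanceAs (Module K ((T.Alg K ⊗[K] (T.Gam n →₀ K)) ⊗[K] T.Alg K))

variable (T) in
/-- The tensor `a ⊗ q ⊗ b` over `K`, for `q ∈ Γ_n`. -/
def preCS (n : ℕ) (a : T.Alg K) (q : T.Gam n) (b : T.Alg K) : T.PreCS K n :=
  (a ⊗ₜ[K] Finsupp.single q (1 : K)) ⊗ₜ[K] b

variable (T) in
/-- The basis of tensors of elements of `𝓑`, `Γ_n` and `𝓑`. -/
def preCSBasis (n : ℕ) : Module.Basis ((T.Bp × T.Gam n) × T.Bp) K (T.PreCS K n) :=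
  ((T.basis K).tensorProduct Finsupp.basisSingleOne).tensorProduct (T.basis K)

theorem preCSBasis_apply (n : ℕ) (x : (T.Bp × T.Gam n) × T.Bp) :
    T.preCSBasis K n x = T.preCS K n (x.1.1.cls K) x.1.2 (x.2.cls K) := by
  refine (Module.Basis.tensorProduct_apply' _ _ _).trans ?_
  rw [Module.Basis.tensorProduct_apply', basis_apply, basis_apply, Finsupp.coe_basisSingleOne]
  rfl

variable (T) in
open Classical in
/-- Left multiplication by `e_v` on `K Γ_n`. -/
def gamLeft (n : ℕ) (v : V) : (T.Gam n →₀ K) →ₗ[K] (T.Gam n →₀ K) :=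
  Finsupp.linearCombination K fun q => if q.1.tgt = v then Finsupp.single q 1 else 0

variable (T) in
open Classical in
/-- Right multiplication by `e_v` on `K Γ_n`. -/
def gamRight (n : ℕ) (v : V) : (T.Gam n →₀ K) →ₗ[K] (T.Gam n →₀ K) :=
  Finsupp.linearCombination K fun q => if q.1.src = v then Finsupp.single q 1 else 0

variable (T) in
/-- The map `f ⊗ g ⊗ h` on `A ⊗_K K Γ_n ⊗_K A`. -/
def preCSMap (n : ℕ) (f : T.Alg K →ₗ[K] T.Alg K) (g : (T.Gam n →₀ K) →ₗ[K] (T.Gam n →₀ K))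
    (h : T.Alg K →ₗ[K] T.Alg K) : T.PreCS K n →ₗ[K] T.PreCS K n :=
  TensorProduct.map (TensorProduct.map f g) h

variable (T) in
/-- `a ⊗ q ⊗ b ↦ a e_v ⊗ q ⊗ b - a ⊗ e_v q ⊗ b` and `a ⊗ q ⊗ b ↦ a ⊗ q e_v ⊗ b - a ⊗ q ⊗ e_v b`. -/
def csRel (n : ℕ) : V ⊕ V → (T.PreCS K n →ₗ[K] T.PreCS K n)
  | Sum.inl v => T.preCSMap K n (LinearMap.mulRight K (T.idem K v)) LinearMap.id LinearMap.id -
      T.preCSMap K n LinearMap.id (T.gamLeft K n v) LinearMap.id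
  | Sum.inr v => T.preCSMap K n LinearMap.id (T.gamRight K n v) LinearMap.id -
      T.preCSMap K n LinearMap.id LinearMap.id (LinearMap.mulLeft K (T.idem K v))

variable (T) in
/-- `A ⊗_E K Γ_n ⊗_E A`. -/
def CS (n : ℕ) : Type _ := T.PreCS K n ⧸ ⨆ k, LinearMap.range (T.csRel K n k)

instance (n : ℕ) : AddCommGroup (T.CS K n) :=
  inferInstanceAs (AddCommGroup (T.PreCS K n ⧸ ⨆ k, LinearMap.range (T.csRel K n k)))
instance (n : ℕ) : Module K (T.CS K n) :=
  inferInstanceAs (Module K (T.PreCS K n ⧸ ⨆ k, LinearMap.range (T.csRel K n k)))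

variable (T) in
/-- The element `a ⊗ q ⊗ b` of `A ⊗_E K Γ_n ⊗_E A`, for `q ∈ Γ_n`. -/
def cs (n : ℕ) (a : T.Alg K) (q : T.Gam n) (b : T.Alg K) : T.CS K n :=
  Submodule.Quotient.mk (p := ⨆ k, LinearMap.range (T.csRel K n k)) (T.preCS K n a q b)

theorem preCSMap_smul (n : ℕ) (f : T.Alg K →ₗ[K] T.Alg K)
    (g : (T.Gam n →₀ K) →ₗ[K] (T.Gam n →₀ K)) (h : T.Alg K →ₗ[K] T.Alg K) (a b : T.Alg K)
    (q : T.Gam n) (c c' c'' : K) (hf : f a = c • a)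
    (hg : g (Finsupp.single q 1) = c' • Finsupp.single q 1) (hh : h b = c'' • b) :
    T.preCSMap K n f g h (T.preCS K n a q b) = (c * c' * c'') • T.preCS K n a q b := by
  have : (f a ⊗ₜ[K] g (Finsupp.single q 1)) ⊗ₜ[K] h b =
      (c * c' * c'') • ((a ⊗ₜ[K] (Finsupp.single q 1 : T.Gam n →₀ K)) ⊗ₜ[K] b) := by
    rw [hf, hg, hh, TensorProduct.smul_tmul_smul, TensorProduct.smul_tmul_smul]
  exact this

open Classical in
/-- The factor by which `csRel` acts on a tensor of paths. -/
def csCoeff (n : ℕ) : V ⊕ V → (T.Bp × T.Gam n) × T.Bp → K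
  | Sum.inl v, x => (if x.1.1.1.src = v then 1 else 0) - (if x.1.2.1.tgt = v then 1 else 0)
  | Sum.inr v, x => (if x.1.2.1.src = v then 1 else 0) - (if x.2.1.tgt = v then 1 else 0)

theorem csRel_basis (n : ℕ) (k : V ⊕ V) (x : (T.Bp × T.Gam n) × T.Bp) :
    T.csRel K n k (T.preCSBasis K n x) = csCoeff K n k x • T.preCSBasis K n x := by
  classical
  obtain ⟨⟨p, q⟩, r⟩ := x
  rw [preCSBasis_apply]
  cases k with
  | inl v =>
    rw [csRel, LinearMap.sub_apply, csCoeff, sub_smul,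
      preCSMap_smul K n _ _ _ _ _ _ (if p.1.src = v then 1 else 0) 1 1
        (by simp [Bp.cls, cls_mul_idem]) (by simp) (by simp),
      preCSMap_smul K n _ _ _ _ _ _ 1 (if q.1.tgt = v then 1 else 0) 1
        (by simp) (by simp [gamLeft]) (by simp)]
    simp
  | inr v =>
    rw [csRel, LinearMap.sub_apply, csCoeff, sub_smul,
      preCSMap_smul K n _ _ _ _ _ _ 1 (if q.1.src = v then 1 else 0) 1
        (by simp) (by simp [gamRight]) (by simp),
      preCSMap_smul K n _ _ _ _ _ _ 1 1 (if r.1.tgt = v then 1 else 0)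
        (by simp) (by simp) (by simp [Bp.cls, idem_mul_cls])]
    simp

variable (T) in
/-- The index set of the basis `p ⊗ q ⊗ r` of `A ⊗_E K Γ_n ⊗_E A`. -/
abbrev CSWord (n : ℕ) : Type _ :=
  {x : (T.Bp × T.Gam n) × T.Bp // x.1.1.1.src = x.1.2.1.tgt ∧ x.1.2.1.src = x.2.1.tgt}

variable (T) in
/-- The basis of `A ⊗_E K Γ_n ⊗_E A`. -/
def csBasis (n : ℕ) : Module.Basis (T.CSWord n) K (T.CS K n) :=
  quotBasis K (T.preCSBasis K n) (T.csRel K n)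
    (fun x => x.1.1.1.src = x.1.2.1.tgt ∧ x.1.2.1.src = x.2.1.tgt) _ (csRel_basis K n)
    (fun x hx k => by
      cases k with
      | inl v => rw [csCoeff, hx.1, sub_self]
      | inr v => rw [csCoeff, hx.2, sub_self])
    (fun x hx => by
      rcases not_and_or.1 hx with h | h
      · exact ⟨Sum.inl x.1.1.1.src, by simp [csCoeff, Ne.symm h]⟩
      · exact ⟨Sum.inr x.1.2.1.src, by simp [csCoeff, Ne.symm h]⟩)

theorem csBasis_apply (n : ℕ) (x : T.CSWord n) :
    T.csBasis K n x = T.cs K n (x.1.1.1.cls K) x.1.1.2 (x.1.2.cls K) := by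
  refine (quotBasis_apply K _ _ _ _ _ _ _ x).trans ?_
  rw [preCSBasis_apply, cs]

/-! ### Gradings -/

variable (T) in
/-- The homogeneous component of degree `i` of `A`. -/
def algDeg (i : ℤ) : Submodule K (T.Alg K) :=
  Submodule.span K {x | ∃ p : T.Q.Path, p.degree = i ∧ T.cls K p = x}

variable (T) in
/-- The component `ℙ_n^r` of degree `r` of `ℙ_n = A ⊗_E K Γ_n ⊗_E A`. -/
def csDeg (n : ℕ) (r : ℤ) : Submodule K (T.CS K n) :=
  Submodule.span K {y | ∃ (i k : ℤ) (a b : T.Alg K) (q : T.Gam n), a ∈ T.algDeg K i ∧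
    b ∈ T.algDeg K k ∧ i + q.1.degree + k = r ∧ y = T.cs K n a q b}

variable (T) in
/-- The component of degree `N` of `A ⊗_E (sĀ)^{⊗_E n} ⊗_E A`, where `|s| = -1`. -/
def barDeg (n : ℕ) (N : ℤ) : Submodule K (T.Bar K n) :=
  Submodule.span K {y | ∃ (d : Fin (n + 2) → ℤ) (x : Fin (n + 2) → T.Alg K)
    (hx : ∀ j, x j ∈ T.Slot K n j), (∀ j, x j ∈ T.algDeg K (d j)) ∧
    ∑ j, d j - n = N ∧ y = T.bar K n x hx}

/-! ### Bimodule structures -/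

variable (T) in
/-- Left multiplication by `c ∈ A` on `A ⊗_E K Γ_n ⊗_E A`. -/
def csLeft (n : ℕ) (c : T.Alg K) : T.CS K n →ₗ[K] T.CS K n :=
  (T.csBasis K n).constr K fun x => T.cs K n (c * x.1.1.1.cls K) x.1.1.2 (x.1.2.cls K)

variable (T) in
/-- Right multiplication by `c ∈ A` on `A ⊗_E K Γ_n ⊗_E A`. -/
def csRight (n : ℕ) (c : T.Alg K) : T.CS K n →ₗ[K] T.CS K n :=
  (T.csBasis K n).constr K fun x => T.cs K n (x.1.1.1.cls K) x.1.1.2 (x.1.2.cls K * c)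

theorem update_mem_Slot {n : ℕ} {x : Fin (n + 2) → T.Alg K} (hx : ∀ j, x j ∈ T.Slot K n j)
    {i : Fin (n + 2)} {y : T.Alg K} (hy : y ∈ T.Slot K n i) (j : Fin (n + 2)) :
    Function.update x i y j ∈ T.Slot K n j := by
  by_cases h : j = i
  · subst h; simpa using hy
  · simpa [h] using hx j

variable (T) in
/-- Left multiplication by `c ∈ A` on `A ⊗_E (sĀ)^{⊗_E n} ⊗_E A`. -/
def barLeft (n : ℕ) (c : T.Alg K) : T.Bar K n →ₗ[K] T.Bar K n :=
  (T.barBasis K n).constr K fun α => T.bar K n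
    (Function.update (fun j => T.cls K (α.path j)) (Fin.last (n + 1))
      (c * T.cls K (α.path (Fin.last (n + 1)))))
    (update_mem_Slot K (cls_path_mem K α) (mul_mem_Slot_left K n _ _ (cls_path_mem K α _)))

variable (T) in
/-- Right multiplication by `c ∈ A` on `A ⊗_E (sĀ)^{⊗_E n} ⊗_E A`. -/
def barRight (n : ℕ) (c : T.Alg K) : T.Bar K n →ₗ[K] T.Bar K n :=
  (T.barBasis K n).constr K fun α => T.bar K n
    (Function.update (fun j => T.cls K (α.path j)) 0 (T.cls K (α.path 0) * c))
    (update_mem_Slot K (cls_path_mem K α) (mul_mem_Slot_right K n _ (cls_path_mem K α _) _))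

/-! ### The two-sided bar resolution -/

/-- `(x_{n+2}, …, x_0) ↦ (x_{n+2}, …, x_{j+1} x_j, …, x_0)`. -/
def contract {n : ℕ} (j : Fin (n + 2)) (x : Fin (n + 3) → T.Alg K) (k : Fin (n + 2)) : T.Alg K :=
  if k < j then x k.castSucc else if k = j then x k.succ * x k.castSucc else x k.succ

theorem contract_mem {n : ℕ} (j : Fin (n + 2)) {x : Fin (n + 3) → T.Alg K}
    (hx : ∀ i, x i ∈ T.Slot K (n + 1) i) (k : Fin (n + 2)) :
    contract K j x k ∈ T.Slot K n k := by
  refine mem_Slot K fun hk => ?_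
  rw [not_or] at hk
  have h1 : x k.castSucc ∈ T.Abar K := by
    have := hx k.castSucc
    rwa [Slot, if_neg] at this
    rintro (h | h)
    · exact hk.1 (Fin.ext (by simpa using congrArg Fin.val h))
    · have := congrArg Fin.val h
      simp at this
      omega
  have h2 : x k.succ ∈ T.Abar K := by
    have := hx k.succ
    rwa [Slot, if_neg] at this
    rintro (h | h)
    · exact Fin.succ_ne_zero _ h
    · refine hk.2 (Fin.ext ?_)
      have := congrArg Fin.val h
      simp at this
      simpa using this
  unfold contract
  split_ifs
  · exact h1
  · exact mul_mem_Abar_left K _ h1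
  · exact h2

/-- `ε_{i,n} = ∑_{j=i}^{n} (|α_j| - 1)`. -/
def eps {n : ℕ} (α : T.BarWord n) (i : ℕ) : ℤ :=
  ∑ j : Fin (n + 2) with i ≤ j.val ∧ j.val ≤ n, ((α.path j).degree - 1)

variable (T) in
/-- The external differential `δ₁` on `A ⊗_E (sĀ)^{⊗_E (n+1)} ⊗_E A`, the extension of the formula
for `1 ⊗ sα_{n+1} ⊗ ⋯ ⊗ sα_1 ⊗ 1` by `δ₁(a x b) = (-1)^{|a|} a δ₁(x) b`. The summand `j` is the
one with the product `α_{j+1} α_j`; the internal differential is zero. -/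
def barDiff (n : ℕ) : T.Bar K (n + 1) →ₗ[K] T.Bar K n :=
  (T.barBasis K (n + 1)).constr K fun α => ∑ j : Fin (n + 2),
    ((α.path (Fin.last (n + 2))).degree +
      (if j = 0 then eps α 2 - 1 else eps α (j.val + 1))).negOnePow •
      T.bar K n (contract K j fun i => T.cls K (α.path i)) (contract_mem K j (cls_path_mem K α))

variable (T) in
/-- The augmentation `A ⊗_E A → A`, `a ⊗ b ↦ a b`. -/
def barAug : T.Bar K 0 →ₗ[K] T.Alg K :=
  (T.barBasis K 0).constr K fun α => T.cls K (α.path 1) * T.cls K (α.path 0)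

/-! ### The two-sided CS-projective resolution -/

namespace Gam

theorem ne_nil {n : ℕ} (q : T.Gam (n + 1)) : q.1.arrows ≠ [] := by
  intro h
  have := q.2.1
  simp [h] at this

/-- `a_{n+1} a_n ⋯ a_1 ↦ a_n ⋯ a_1`. -/
def tail {n : ℕ} (q : T.Gam (n + 1)) : T.Gam n :=
  ⟨q.1.tail q.ne_nil, by simp [Path.tail, q.2.1], q.2.2.tail⟩

/-- `a_{n+1} ⋯ a_2 a_1 ↦ a_{n+1} ⋯ a_2`. -/
def init {n : ℕ} (q : T.Gam (n + 1)) : T.Gam n :=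
  ⟨q.1.init q.ne_nil, by simp [Path.init, q.2.1], q.2.2.dropLast⟩

/-- The arrow `a_{n+1}` of `a_{n+1} ⋯ a_1`. -/
def first {n : ℕ} (q : T.Gam (n + 1)) : Ar := q.1.arrows.head q.ne_nil

/-- The arrow `a_1` of `a_{n+1} ⋯ a_1`. -/
def last {n : ℕ} (q : T.Gam (n + 1)) : Ar := q.1.arrows.getLast q.ne_nil

/-- `q ∈ Sp^n`, that is, `q = ε^n` with `ε ∈ Sp`. -/
def IsSpecial {n : ℕ} (q : T.Gam n) : Prop := ∃ e ∈ T.Sp, q.1.arrows = List.replicate n e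

variable (T) in
/-- `Γ_0 = Q_0`. -/
def vertex (i : V) : T.Gam 0 := ⟨Path.triv T.Q i, rfl, List.isChain_nil⟩

variable (T) in
/-- `Γ_1 = Q_1`. -/
def arrow (a : Ar) : T.Gam 1 := ⟨Path.single T.Q a, rfl, List.isChain_singleton a⟩

end Gam

variable (T) in
open Classical in
/-- The differential `d_{n+1}` of the CS-resolution, a map of `A`-bimodules. For `q = ε^{n+1}`, the
paths `a_n ⋯ a_1` and `a_{n+1} ⋯ a_2` are both `ε^n`, and there is one more summand
`- 1 ⊗ ε^n ⊗ 1` if `n + 1` is even. -/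
def csDiff (n : ℕ) : T.CS K (n + 1) →ₗ[K] T.CS K n :=
  (T.csBasis K (n + 1)).constr K fun ⟨⟨⟨p, q⟩, r⟩, _⟩ =>
    T.cs K n (p.cls K * T.arr K q.first) q.tail (r.cls K) +
    (-1 : K) ^ (n + 1) • T.cs K n (p.cls K) q.init (T.arr K q.last * r.cls K) -
    if q.IsSpecial ∧ Even (n + 1) then T.cs K n (p.cls K) q.tail (r.cls K) else 0

variable (T) in
/-- The augmentation `d_0 : A ⊗_E K Γ_0 ⊗_E A → A`, `a ⊗ e ⊗ b ↦ a e b`. -/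
def csAug : T.CS K 0 →ₗ[K] T.Alg K :=
  (T.csBasis K 0).constr K fun ⟨⟨⟨p, q⟩, r⟩, _⟩ => p.cls K * T.cls K q.1 * r.cls K

/-! ### The comparison maps -/

/-- `σ = ∑_{i=2}^{n} (d_i + ⋯ + d_n)`. -/
def sigma (n : ℕ) (d : ℕ → ℤ) : ℤ := ∑ i ∈ Finset.Icc 2 n, ∑ j ∈ Finset.Icc i n, d j

/-- The factors of `p ⊗ s a_n ⊗ ⋯ ⊗ s a_1 ⊗ r`, numbered from right to left, where
`q = a_n ⋯ a_1 ∈ Γ_n`. -/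
def fTuple {n : ℕ} (p : T.Bp) (q : T.Gam n) (r : T.Bp) (j : Fin (n + 2)) : T.Alg K :=
  if h : j = 0 ∨ j = Fin.last (n + 1) then (if j = 0 then r.cls K else p.cls K)
  else T.arr K (q.1.arrows[n - j.val]'(by
    have h1 : j.val ≠ 0 := fun h' => h (Or.inl (Fin.ext h'))
    have h2 : j.val ≠ n + 1 := fun h' => h (Or.inr (Fin.ext h'))
    have := q.2.1
    omega))

theorem fTuple_mem {n : ℕ} (p : T.Bp) (q : T.Gam n) (r : T.Bp) (j : Fin (n + 2)) :
    fTuple K p q r j ∈ T.Slot K n j := by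
  refine mem_Slot K fun h => ?_
  rw [fTuple, dif_neg h]
  exact arr_mem_Abar K _

variable (T) in
/-- The map `F` on `A ⊗_E K Γ_n ⊗_E A`:
`F(p ⊗ q ⊗ r) = (-1)^{n |p| + σ(a)} p ⊗ s a_n ⊗ ⋯ ⊗ s a_1 ⊗ r` for `q = a_n ⋯ a_1`. -/
def compF (n : ℕ) : T.CS K n →ₗ[K] T.Bar K n :=
  (T.csBasis K n).constr K fun ⟨⟨⟨p, q⟩, r⟩, _⟩ =>
    (n * p.1.degree + sigma n fun j => (q.1.arrows.map T.deg).getD (n - j) 0).negOnePow •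
      T.bar K n (fTuple K p q r) (fTuple_mem K p q r)

variable (T) in
/-- The product in `A` of the arrows in a list; the empty product is `1`. -/
def listProd (l : List Ar) : T.Alg K := (l.map (T.arr K)).prod

/-- The sequence of arrows `a_1^n α_{n-1} ⋯ α_2 a_{l(α_1)}^1`, with `n + 2` in place of `n`. -/
def coreList {n : ℕ} (α : T.BarWord (n + 2)) : List Ar :=
  (α.path ⟨n + 2, by omega⟩).arrows.getLast?.toList ++
    (List.finRange n).reverse.flatMap (fun k => (α.path ⟨k.val + 2, by omega⟩).arrows) ++
    (α.path ⟨1, by omega⟩).arrows.head?.toList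

variable (T) in
open Classical in
/-- The map `G` on `A ⊗_E (sĀ)^{⊗_E n} ⊗_E A`, extended from `1 ⊗ sα_n ⊗ ⋯ ⊗ sα_1 ⊗ 1` by
`G(a x b) = (-1)^{n |a|} a G(x) b`. -/
def compG : ∀ n : ℕ, T.Bar K n →ₗ[K] T.CS K n
  | 0 => (T.barBasis K 0).constr K fun α =>
      T.cs K 0 (T.cls K (α.path 1)) (Gam.vertex T (α.path 1).src) (T.cls K (α.path 0))
  | 1 => (T.barBasis K 1).constr K fun α =>
      (α.path 2).degree.negOnePow • ∑ i : Fin (α.path 1).arrows.length,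
        T.cs K 1 (T.cls K (α.path 2) * T.listProd K ((α.path 1).arrows.take i))
          (Gam.arrow T (α.path 1).arrows[i])
          (T.listProd K ((α.path 1).arrows.drop (i + 1)) * T.cls K (α.path 0))
  | n + 2 => (T.barBasis K (n + 2)).constr K fun α =>
      if h : ∃ γ : T.Gam (n + 2), γ.1.arrows = coreList α then
        ((n + 2 : ℕ) * (α.path (Fin.last (n + 3))).degree +
          sigma (n + 2) fun j => if h : j < n + 4 then (α.path ⟨j, h⟩).degree else 0).negOnePow •
        T.cs K (n + 2)
          (T.cls K (α.path (Fin.last (n + 3))) *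
            T.listProd K (α.path ⟨n + 2, by omega⟩).arrows.dropLast)
          h.choose
          (T.listProd K (α.path ⟨1, by omega⟩).arrows.tail * T.cls K (α.path 0))
      else 0

/-! ### Total complexes -/

variable (T) in
/-- The total space `T_*` of the CS-resolution. -/
abbrev TotCS : Type _ := ⨁ n, T.CS K n

variable (T) in
/-- The total space `B(A, A, A)` of the bar resolution. -/
abbrev TotBar : Type _ := ⨁ n, T.Bar K n

variable (T) in
/-- The component `T_N`, the direct sum of the `ℙ_n^r` with `N = r - n`. -/
def totCSDeg (N : ℤ) : Submodule K (T.TotCS K) :=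
  ⨆ n : ℕ, (T.csDeg K n (N + n)).map (DirectSum.lof K ℕ (T.CS K) n)

variable (T) in
/-- The component `B(A, A, A)_N`. -/
def totBarDeg (N : ℤ) : Submodule K (T.TotBar K) :=
  ⨆ n : ℕ, (T.barDeg K n N).map (DirectSum.lof K ℕ (T.Bar K) n)

variable (T) in
/-- The differential of `T_*`. -/
def totCSDiff : T.TotCS K →ₗ[K] T.TotCS K :=
  DirectSum.toModule K ℕ _ fun
    | 0 => 0
    | n + 1 => DirectSum.lof K ℕ (T.CS K) n ∘ₗ T.csDiff K n

variable (T) in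
/-- The differential of `B(A, A, A)`. -/
def totBarDiff : T.TotBar K →ₗ[K] T.TotBar K :=
  DirectSum.toModule K ℕ _ fun
    | 0 => 0
    | n + 1 => DirectSum.lof K ℕ (T.Bar K) n ∘ₗ T.barDiff K n

variable (T) in
/-- The augmentation `T_* → A`. -/
def totCSAug : T.TotCS K →ₗ[K] T.Alg K :=
  DirectSum.toModule K ℕ _ fun
    | 0 => T.csAug K
    | _ + 1 => 0

variable (T) in
/-- The augmentation `B(A, A, A) → A`. -/
def totBarAug : T.TotBar K →ₗ[K] T.Alg K :=
  DirectSum.toModule K ℕ _ fun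
    | 0 => T.barAug K
    | _ + 1 => 0

variable (T) in
/-- `a x b` for `x ∈ B(A, A, A)`. -/
def totBarAct (a b : T.Alg K) : T.TotBar K →ₗ[K] T.TotBar K :=
  DirectSum.lmap fun n => T.barLeft K n a ∘ₗ T.barRight K n b

variable (T) in
/-- `a x b` for `x ∈ T_*`. -/
def totCSAct (a b : T.Alg K) : T.TotCS K →ₗ[K] T.TotCS K :=
  DirectSum.lmap fun n => T.csLeft K n a ∘ₗ T.csRight K n b

variable (T) in
/-- The map `F : T_* → B(A, A, A)`. -/
def totF : T.TotCS K →ₗ[K] T.TotBar K := DirectSum.lmap (T.compF K)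

variable (T) in
/-- The map `G : B(A, A, A) → T_*`. -/
def totG : T.TotBar K →ₗ[K] T.TotCS K := DirectSum.lmap (T.compG K)

end SkewGentleTriple

end

noncomputable section

namespace SkewGentleTriple

open GradedQuiver

variable {V Ar : Type*} {T : SkewGentleTriple V Ar} (K : Type*) [Field K] [Fintype V]

/-! ### Products of basis elements -/

/-! Both complexes are contractible over `A` by explicit maps. There is a `K`-linear contraction
`s`, compatible with right multiplication but not with left multiplication, such that `d s + s d =
id - u ε`, where `ε` is the augmentation and `u(a) = 1 ⊗ a`. On the bar resolution `s` inserts a new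
leading factor `1`. On `T_*` it moves the last arrow `a` of `p` in `p ⊗ q ⊗ r` into `q` if `a q`
lies in `Γ`, and gives zero otherwise; in length `0` it is the sum over all factorizations `p = p' a
p''`. As left modules, both complexes are generated by the words with idempotent leading factor, and
`s` kills these generators. `ContractedComplex` records exactly this situation.

On a generator `x` the identity above becomes `x = s d x + u ε x` (`ContractedComplex.gen_eq`).
Hence everything that respects leading factors up to sign can be checked by induction on the length.
The equations `d d = 0` and `ε d = 0` follow in this way. If a map `f` satisfies `f x = s f d x + u
ε x` on generators, then `f d x` is a cycle of augmentation zero, so `d f x = d s f d x = f d x`,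
and `f` is a morphism of augmented complexes. This recursion is `ContractedComplex.Comparison`.

The given formulas for `F` and `G` satisfy the recursion (`comparison_totF`, `comparison_totG`). For
`F`, only the summand `a_n ⊗ a_{n-1} ⋯ a_1 ⊗ 1` of `d_n` survives `s`, and prepending an arrow to
`q` corresponds to `s` on the bar side. For `G`, a generator of positive length is `s β` for a word
`β`, and two facts suffice: `G s β = s G β` if the leading factor of `β` has positive length
(`compG_shift`), and `s s = 0` on `T_*` (`csContr_csContr`). Special loops and the extra summand of
`d_n` for even `n` enter in `csDiff_csContr_succ`, which says that `s` contracts `T_*`.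

Since `F` sends generators to combinations of generators, `G F` satisfies the recursion that the
identity satisfies, so `G F = id`. This fails for `F G`, because `G` of a generator can have
nontrivial left factors. The homotopy is the solution of `h x = s (x - F G x - h d x)` on
generators. It commutes with right multiplication because `s`, `F`, `G` and `d` do. -/

theorem map_sign_smul {R M N : Type*} [Ring R] [AddCommGroup M] [AddCommGroup N] [Module R M]
    [Module R N] (f : M →ₗ[R] N) (u : ℤˣ) (x : M) : f (u • x) = u • f x := by
  rw [Units.smul_def, Units.smul_def, map_zsmul]

/-- Left multiplication by an arrow either concatenates, or absorbs a repeated special loop, or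
gives zero; sums never occur. Absorption respects degrees because special loops have degree `0`. The
clause on last arrows matters later: the contraction of `T_*` looks only at the last arrow of the
left factor. -/
theorem arr_mul_cls_cases (a : Ar) (q : T.Bp) :
    T.arr K a * q.cls K = 0 ∨ ∃ r : T.Bp, T.arr K a * q.cls K = r.cls K ∧
      r.1.degree = T.deg a + q.1.degree ∧ r.1.src = q.1.src ∧ r.1.tgt = T.t a ∧
      r.1.arrows ≠ [] ∧ (q.1.arrows ≠ [] → r.1.arrows.getLast? = q.1.arrows.getLast?) := by
  rw [← cls_mul_arr]
  unfold consBp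
  split_ifs with h1 h2 h3
  · refine Or.inr ⟨⟨(Path.single T.Q a).comp q.1 h1, h2⟩,
      by rw [Finsupp.linearCombination_single, one_smul], ?_, rfl, rfl, ?_, ?_⟩
    · simp [Path.degree, Path.comp, Path.single]
    · simp [Path.comp, Path.single]
    · intro hq
      simp only [Path.comp, Path.single, List.singleton_append]
      obtain ⟨b, l, hl⟩ := List.exists_cons_of_ne_nil hq
      rw [hl, List.getLast?_cons_cons]
  · refine Or.inr ⟨q, by rw [Finsupp.linearCombination_single, one_smul], ?_, rfl,
      Bp.tgt_of_head h3.2, ?_, fun _ => rfl⟩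
    · rw [T.deg_special a h3.1, zero_add]
    · intro h; simp [h] at h3
  · exact Or.inl (map_zero _)
  · exact Or.inl (map_zero _)

/-- Induction on the arrows of `p`, each step being the case of one arrow. It means that a path
times a word is again a word with the same generator, or zero. -/
theorem cls_mul_cls_cases (p q : T.Bp) :
    p.cls K * q.cls K = 0 ∨ ∃ r : T.Bp, p.cls K * q.cls K = r.cls K ∧
      r.1.degree = p.1.degree + q.1.degree ∧ r.1.src = q.1.src ∧ r.1.tgt = p.1.tgt ∧
      (p.1.arrows ≠ [] ∨ q.1.arrows ≠ [] → r.1.arrows ≠ []) ∧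
      (q.1.arrows ≠ [] → r.1.arrows.getLast? = q.1.arrows.getLast?) := by
  obtain ⟨⟨j, l, i, hl⟩, hc⟩ := p
  induction l generalizing j with
  | nil =>
    obtain rfl : j = i := hl
    by_cases h : j = q.1.tgt
    · subst h
      refine Or.inr ⟨q, ?_, ?_, rfl, rfl, by simp, fun _ => rfl⟩
      · classical
        have := idem_mul_cls K (T := T) q.1.tgt q.1
        rwa [if_pos rfl] at this
      · simp [Path.degree]
    · exact Or.inl (T.cls_mul_ne K _ _ h)
  | cons a l ih =>
    have e : Bp.cls K (T := T) ⟨⟨j, a :: l, i, hl⟩, hc⟩ =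
        T.arr K a * Bp.cls K (T := T) ⟨⟨T.s a, l, i, hl.2⟩, hc.tail⟩ := cls_cons K hl
    rw [e, mul_assoc]
    rcases ih (T.s a) hl.2 hc.tail with h | ⟨r, hr, hd, hs, ht, hn, hg⟩
    · rw [h]; exact Or.inl (mul_zero _)
    · rw [hr]
      rcases arr_mul_cls_cases K a r with h' | ⟨r', hr', hd', hs', ht', hn', hg'⟩
      · exact Or.inl h'
      · refine Or.inr ⟨r', hr', ?_, hs'.trans hs, ht'.trans hl.1, fun _ => hn', fun h => ?_⟩
        · rw [hd', hd]; simp [Path.degree, add_assoc]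
        · rw [← hg h]
          exact hg' (hn (Or.inr h))

theorem cls_cases (p : T.Q.Path) :
    T.cls K p = 0 ∨ ∃ r : T.Bp, T.cls K p = r.cls K ∧ r.1.degree = p.degree := by
  obtain ⟨j, l, i, hl⟩ := p
  induction l generalizing j with
  | nil => exact Or.inr ⟨⟨⟨j, [], i, hl⟩, List.isChain_nil⟩, rfl, rfl⟩
  | cons a l ih =>
    rw [cls_cons]
    rcases ih (T.s a) hl.2 with h | ⟨r, hr, hd⟩
    · rw [h]; exact Or.inl (mul_zero _)
    · rw [hr]
      rcases arr_mul_cls_cases K a r with h' | ⟨r', hr', hd', -⟩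
      · exact Or.inl h'
      · exact Or.inr ⟨r', hr', by rw [hd', hd]; simp [Path.degree]⟩

/-- An arbitrary path reduces to zero or to one basis element of the same degree, so a statement
linear in a homogeneous element may be tested on `𝓑`. -/
theorem algDeg_eq_span (i : ℤ) :
    T.algDeg K i = Submodule.span K ((T.basis K) '' {p : T.Bp | p.1.degree = i}) := by
  apply le_antisymm
  · refine Submodule.span_le.2 ?_
    rintro _ ⟨p, hp, rfl⟩
    rcases cls_cases K p with h | ⟨r, hr, hd⟩
    · rw [h]; exact zero_mem _
    · rw [hr, ← basis_apply]
      exact Submodule.subset_span ⟨r, hd.trans hp, rfl⟩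
  · refine Submodule.span_mono ?_
    rintro _ ⟨p, hp, rfl⟩
    exact ⟨p.1, hp, (basis_apply K p).symm⟩

theorem cls_mem_algDeg (p : T.Q.Path) : T.cls K p ∈ T.algDeg K p.degree :=
  Submodule.subset_span ⟨p, rfl, rfl⟩

theorem Bp.cls_mem_algDeg (p : T.Bp) : p.cls K ∈ T.algDeg K p.1.degree :=
  SkewGentleTriple.cls_mem_algDeg K p.1

theorem arr_mem_algDeg (a : Ar) : T.arr K a ∈ T.algDeg K (T.deg a) :=
  Submodule.subset_span ⟨Path.single T.Q a, by simp [Path.degree, Path.single], rfl⟩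

theorem mul_mem_algDeg {a b : T.Alg K} {i j : ℤ} (ha : a ∈ T.algDeg K i) (hb : b ∈ T.algDeg K j) :
    a * b ∈ T.algDeg K (i + j) := by
  induction ha using Submodule.span_induction with
  | zero => rw [zero_mul]; exact zero_mem _
  | add x y _ _ h h' => rw [add_mul]; exact add_mem h h'
  | smul c x _ h => rw [smul_mul_assoc]; exact Submodule.smul_mem _ c h
  | mem x hx =>
    obtain ⟨p, rfl, rfl⟩ := hx
    induction hb using Submodule.span_induction with
    | zero => rw [mul_zero]; exact zero_mem _
    | add x y _ _ h h' => rw [mul_add]; exact add_mem h h'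
    | smul c x _ h => rw [mul_smul_comm]; exact Submodule.smul_mem _ c h
    | mem y hy =>
      obtain ⟨q, rfl, rfl⟩ := hy
      by_cases h : p.src = q.tgt
      · rw [T.cls_mul_eq K p q h]
        exact Submodule.subset_span ⟨_, by simp [Path.degree, Path.comp], rfl⟩
      · rw [T.cls_mul_ne K p q h]; exact zero_mem _

theorem one_mem_algDeg : (1 : T.Alg K) ∈ T.algDeg K 0 := by
  rw [← map_one (T.quot K), PathAlgebra.one_def, map_sum]
  exact Submodule.sum_mem _ fun i _ => Submodule.subset_span ⟨Path.triv T.Q i, rfl, rfl⟩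

theorem sum_idem : ∑ v, T.idem K v = 1 := by
  rw [← map_one (T.quot K), PathAlgebra.one_def, map_sum]
  rfl

/-! ### Classes of paths as products of arrows. -/

theorem listProd_append (l m : List Ar) :
    T.listProd K (l ++ m) = T.listProd K l * T.listProd K m := by
  simp [listProd]

theorem listProd_nil : T.listProd K [] = 1 := rfl

theorem listProd_singleton (a : Ar) : T.listProd K [a] = T.arr K a := by simp [listProd]

theorem listProd_cons (a : Ar) (l : List Ar) :
    T.listProd K (a :: l) = T.arr K a * T.listProd K l := by simp [listProd]

/-- The empty product is `1`, not an idempotent of a vertex, hence the correction on the right. For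
paths of positive length the last arrow absorbs it. -/
theorem cls_eq_listProd_mul (p : T.Q.Path) :
    T.cls K p = T.listProd K p.arrows * T.idem K p.src := by
  obtain ⟨j, l, i, hl⟩ := p
  induction l generalizing j with
  | nil => cases hl; rw [listProd_nil, one_mul]; rfl
  | cons a l ih => rw [cls_cons, ih _ hl.2, listProd_cons, mul_assoc]

theorem cls_eq_listProd {p : T.Q.Path} (h : p.arrows ≠ []) :
    T.cls K p = T.listProd K p.arrows := by
  obtain ⟨j, l, i, hl⟩ := p
  classical
  induction l generalizing j with
  | nil => exact absurd rfl h
  | cons a l ih =>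
    rw [cls_cons, listProd_cons]
    cases l with
    | nil =>
      obtain ⟨h1, h2⟩ := hl
      cases h2
      rw [listProd_nil, mul_one]
      have := cls_mul_idem K (T := T) (T.s a) (Path.single T.Q a)
      rw [if_pos (by rfl)] at this
      exact this
    | cons b l => rw [ih _ hl.2 (by simp)]

/-! ### Complexes of left modules with a contraction -/

/-- A complex over `K`, augmented over `A`, with a left action of `A` and a contracting homotopy
`contr`. It is spanned by words; every word is a product of its leading path and a generator, and
the contraction kills the generators. The differential satisfies
`d(a x) = (-1)^{parity |a|} a d(x)`. -/
structure ContractedComplex (T : SkewGentleTriple V Ar) (X : Type*) [AddCommGroup X]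
    [Module K X] where
  diff : X →ₗ[K] X
  contr : X →ₗ[K] X
  aug : X →ₗ[K] T.Alg K
  unit : T.Alg K →ₗ[K] X
  act : T.Alg K →ₗ[K] X →ₗ[K] X
  parity : ℤ
  Word : ℕ → Type*
  word : ∀ {n}, Word n → X
  gen : ∀ {n}, Word n → X
  lead : ∀ {n}, Word n → T.Bp
  act_mul : ∀ a b x, act (a * b) x = act a (act b x)
  word_eq : ∀ {n} (α : Word n), word α = act ((lead α).cls K) (gen α)
  change_lead : ∀ {n} (α : Word n) (p : T.Bp), p.1.src = (lead α).1.src →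
    ∃ β : Word n, lead β = p ∧ gen β = gen α
  gen_eq_word : ∀ {n} (α : Word n), ∃ β : Word n, word β = gen α ∧ gen β = gen α
  span_word : ⨆ n, Submodule.span K (Set.range (word (n := n))) = ⊤
  contr_gen : ∀ {n} (α : Word n), contr (gen α) = 0
  homotopy : ∀ x, diff (contr x) + contr (diff x) = x - unit (aug x)
  aug_contr : ∀ x, aug (contr x) = 0
  aug_unit : ∀ a, aug (unit a) = a
  aug_act : ∀ a x, aug (act a x) = a * aug x
  aug_gen : ∀ {n} (α : Word (n + 1)), aug (gen α) = 0
  diff_unit : ∀ a, diff (unit a) = 0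
  diff_zero : ∀ α : Word 0, diff (word α) = 0
  diff_succ : ∀ {n} (α : Word (n + 1)),
    diff (word α) ∈ Submodule.span K (Set.range (word (n := n)))
  diff_word : ∀ {n} (α : Word n), diff (word α) =
    (parity * (lead α).1.degree).negOnePow • act ((lead α).cls K) (diff (gen α))

namespace ContractedComplex

variable {K} {X Y : Type*} [AddCommGroup X] [Module K X] [AddCommGroup Y] [Module K Y]
  (C : ContractedComplex K T X) (D : ContractedComplex K T Y)

/-- The span of the words of length `n`. -/
def level (n : ℕ) : Submodule K X := Submodule.span K (Set.range (C.word (n := n)))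

theorem word_mem {n : ℕ} (α : C.Word n) : C.word α ∈ C.level n :=
  Submodule.subset_span ⟨α, rfl⟩

theorem gen_mem {n : ℕ} (α : C.Word n) : C.gen α ∈ C.level n := by
  obtain ⟨β, h, -⟩ := C.gen_eq_word α
  exact h ▸ C.word_mem β

theorem diff_gen_mem {n : ℕ} (α : C.Word (n + 1)) : C.diff (C.gen α) ∈ C.level n := by
  obtain ⟨β, h, -⟩ := C.gen_eq_word α
  exact h ▸ C.diff_succ β

theorem diff_gen_zero (α : C.Word 0) : C.diff (C.gen α) = 0 := by
  obtain ⟨β, h, -⟩ := C.gen_eq_word α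
  exact h ▸ C.diff_zero β

theorem hom_ext {f g : X →ₗ[K] Y} (h : ∀ n, ∀ x ∈ C.level n, f x = g x) : f = g := by
  refine LinearMap.ext fun x => ?_
  have hx : x ∈ ⨆ n, C.level n := by
    rw [show (⨆ n, C.level n) = ⊤ from C.span_word]; trivial
  induction hx using Submodule.iSup_induction' with
  | mem n x hx => exact h n x hx
  | zero => simp
  | add x y _ _ hx hy => rw [map_add, map_add, hx, hy]

theorem eqOn_level {f g : X →ₗ[K] Y} {n : ℕ} (h : ∀ α : C.Word n, f (C.word α) = g (C.word α))
    {x : X} (hx : x ∈ C.level n) : f x = g x := by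
  induction hx using Submodule.span_induction with
  | mem x hx => obtain ⟨α, rfl⟩ := hx; exact h α
  | zero => simp
  | add x y _ _ hx hy => rw [map_add, map_add, hx, hy]
  | smul c x _ hx => rw [map_smul, map_smul, hx]

/-- A map that is compatible up to sign with the factorization of words is compatible up to sign
with the action of homogeneous elements. -/
theorem map_act (f : X →ₗ[K] Y) {n : ℕ} (e : ℤ) (h : ∀ α : C.Word n, f (C.word α) =
      (e * (C.lead α).1.degree).negOnePow • D.act ((C.lead α).cls K) (f (C.gen α)))
    {i : ℤ} {a : T.Alg K} (ha : a ∈ T.algDeg K i) {x : X} (hx : x ∈ C.level n) :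
    f (C.act a x) = (e * i).negOnePow • D.act a (f x) := by
  rw [algDeg_eq_span] at ha
  induction ha using Submodule.span_induction with
  | zero => simp
  | add a b _ _ ha hb => simp only [map_add, LinearMap.add_apply, ha, hb, smul_add]
  | smul c a _ ha =>
    simp only [map_smul, LinearMap.smul_apply, ha]
    rw [smul_comm]
  | mem a ha =>
    obtain ⟨p, rfl, rfl⟩ := ha
    rw [basis_apply]
    have := C.eqOn_level (f := f ∘ₗ C.act (p.cls K))
      (g := (e * p.1.degree).negOnePow • D.act (p.cls K) ∘ₗ f) (fun α => ?_) hx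
    · simpa using this
    simp only [LinearMap.comp_apply, LinearMap.smul_apply]
    rw [h α, C.word_eq α, map_sign_smul, ← C.act_mul, ← D.act_mul, smul_smul]
    -- If the product of `p` and the leading path is nonzero, it is a basis element with the source
    -- of the old leading path. So it leads a word with the same generator, to which the hypothesis
    -- applies; degrees add, hence so do the sign exponents.
    rcases cls_mul_cls_cases K p (C.lead α) with h0 | ⟨r, hr, hd, hs, -⟩
    · simp [h0]
    · obtain ⟨β, rfl, hg⟩ := C.change_lead α r hs
      rw [hr, ← hg, ← C.word_eq, h β, hg, hd, mul_add, Int.negOnePow_add]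

/-- The sign of the differential does not depend on the length of the word, so the rule extends from
one level to the whole complex. -/
theorem diff_act {i : ℤ} {a : T.Alg K} (ha : a ∈ T.algDeg K i) (x : X) :
    C.diff (C.act a x) = (C.parity * i).negOnePow • C.act a (C.diff x) := by
  have := C.hom_ext (f := C.diff ∘ₗ C.act a)
    (g := (C.parity * i).negOnePow • C.act a ∘ₗ C.diff)
    (fun n x hx => C.map_act C C.diff C.parity C.diff_word ha hx)
  exact LinearMap.congr_fun this x

/-- The homotopy identity with the term `d s` removed, since the contraction kills generators. Every
recursion below rests on this: a generator is recovered from its differential and its augmentation.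
-/
theorem gen_eq {n : ℕ} (α : C.Word n) :
    C.gen α = C.contr (C.diff (C.gen α)) + C.unit (C.aug (C.gen α)) := by
  have := C.homotopy (C.gen α)
  rw [C.contr_gen, map_zero, zero_add] at this
  rw [this, sub_add_cancel]

/-- Let `x` be a generator. Then `d x = d s d x` because `d u = 0`, so the homotopy identity at `d
x` reduces to `s d d x = - u ε d x`. Applying `ε`, which vanishes on the image of `s` and splits
`u`, gives `ε d x = 0`. -/
theorem aug_diff : C.aug ∘ₗ C.diff = 0 := by
  refine C.hom_ext fun n x hx => C.eqOn_level (fun α => ?_) hx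
  rw [LinearMap.comp_apply, C.diff_word, map_sign_smul, C.aug_act, LinearMap.zero_apply]
  suffices C.aug (C.diff (C.gen α)) = 0 by rw [this, mul_zero, smul_zero]
  have h := C.homotopy (C.diff (C.gen α))
  have h2 := congrArg C.diff (C.gen_eq α)
  rw [map_add, C.diff_unit, add_zero] at h2
  rw [← h2] at h
  have h3 := congrArg C.aug h
  rw [map_add, C.aug_contr, add_zero, map_sub, C.aug_unit, sub_self] at h3
  exact h3

theorem aug_diff_apply (x : X) : C.aug (C.diff x) = 0 := LinearMap.congr_fun C.aug_diff x

/-- As before, `s d d x = 0` for a generator `x`, now that `ε d = 0`. In the homotopy identity at `d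
d x` the remaining term `s d d d x` vanishes by induction, because `d x` has smaller length. -/
theorem diff_diff : C.diff ∘ₗ C.diff = 0 := by
  refine C.hom_ext fun n => ?_
  induction n with
  | zero =>
    refine fun x hx => C.eqOn_level (fun α => ?_) hx
    rw [LinearMap.comp_apply, C.diff_zero, map_zero, LinearMap.zero_apply]
  | succ n ih =>
    refine fun x hx => C.eqOn_level (fun α => ?_) hx
    rw [LinearMap.comp_apply, C.diff_word, map_sign_smul, C.diff_act (Bp.cls_mem_algDeg K _),
      LinearMap.zero_apply]
    suffices C.diff (C.diff (C.gen α)) = 0 by rw [this, map_zero, smul_zero, smul_zero]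
    have h := C.homotopy (C.diff (C.gen α))
    have h2 := congrArg C.diff (C.gen_eq α)
    rw [map_add, C.diff_unit, add_zero] at h2
    rw [← h2, C.aug_diff_apply, map_zero, sub_zero, add_eq_left] at h
    have h3 := C.homotopy (C.diff (C.diff (C.gen α)))
    have h4 : C.diff (C.diff (C.diff (C.gen α))) = 0 := ih _ (C.diff_gen_mem α)
    rw [h, h4, C.aug_diff_apply] at h3
    simpa using h3.symm

theorem diff_diff_apply (x : X) : C.diff (C.diff x) = 0 := LinearMap.congr_fun C.diff_diff x

/-! #### Comparison maps -/

variable {C D}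

/-- A map of complexes built by recursion with the contraction of the target. -/
structure Comparison (C : ContractedComplex K T X) (D : ContractedComplex K T Y)
    (f : X →ₗ[K] Y) : Prop where
  parity_eq : Even (C.parity + D.parity + 1)
  map_level : ∀ n, ∀ x ∈ C.level n, f x ∈ D.level n
  map_word : ∀ {n : ℕ} (α : C.Word n), f (C.word α) =
    (n * (C.lead α).1.degree).negOnePow • D.act ((C.lead α).cls K) (f (C.gen α))
  map_gen : ∀ {n : ℕ} (α : C.Word n),
    f (C.gen α) = D.contr (f (C.diff (C.gen α))) + D.unit (C.aug (C.gen α))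

namespace Comparison

theorem map_act {f : X →ₗ[K] Y} (hf : Comparison C D f) {n : ℕ} {i : ℤ} {a : T.Alg K}
    (ha : a ∈ T.algDeg K i) {x : X} (hx : x ∈ C.level n) :
    f (C.act a x) = (n * i).negOnePow • D.act a (f x) :=
  C.map_act D f n hf.map_word ha hx

theorem aug_comp {f : X →ₗ[K] Y} (hf : Comparison C D f) : D.aug ∘ₗ f = C.aug := by
  refine C.hom_ext fun n x hx => C.eqOn_level (fun α => ?_) hx
  have h : D.aug (f (C.gen α)) = C.aug (C.gen α) := by
    rw [hf.map_gen, map_add, D.aug_contr, D.aug_unit, zero_add]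
  rw [LinearMap.comp_apply, hf.map_word, map_sign_smul, D.aug_act, h, C.word_eq, C.aug_act]
  -- The sign is trivial in length `0`; in positive length both sides are zero.
  cases n with
  | zero => simp
  | succ n => rw [C.aug_gen, mul_zero, smul_zero]

theorem aug_apply {f : X →ₗ[K] Y} (hf : Comparison C D f) (x : X) : D.aug (f x) = C.aug x :=
  LinearMap.congr_fun hf.aug_comp x

/-- By induction `f d x` is a cycle, and its augmentation is zero, so contracting and
differentiating returns it. The recursion for `f x` then says that `d f x = f d x`. -/
theorem diff_comp {f : X →ₗ[K] Y} (hf : Comparison C D f) : f ∘ₗ C.diff = D.diff ∘ₗ f := by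
  refine C.hom_ext fun n => ?_
  induction n with
  | zero =>
    refine fun x hx => C.eqOn_level (fun α => ?_) hx
    rw [LinearMap.comp_apply, LinearMap.comp_apply, C.diff_zero, map_zero, hf.map_word,
      map_sign_smul, D.diff_act (Bp.cls_mem_algDeg K _), hf.map_gen, C.diff_gen_zero, map_zero,
      map_zero, zero_add, D.diff_unit, map_zero, smul_zero, smul_zero]
  | succ n ih =>
    refine fun x hx => C.eqOn_level (fun α => ?_) hx
    have h : f (C.diff (C.gen α)) = D.diff (f (C.gen α)) := by
      have h1 := D.homotopy (f (C.diff (C.gen α)))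
      rw [← LinearMap.comp_apply D.diff f, ← ih _ (C.diff_gen_mem α), LinearMap.comp_apply,
        C.diff_diff_apply, map_zero, map_zero, add_zero, hf.aug_apply, C.aug_diff_apply,
        map_zero, sub_zero] at h1
      rw [hf.map_gen, map_add, D.diff_unit, add_zero, h1]
    rw [LinearMap.comp_apply, LinearMap.comp_apply, C.diff_word, map_sign_smul,
      hf.map_act (Bp.cls_mem_algDeg K _) (C.diff_gen_mem α), h, hf.map_word, map_sign_smul,
      D.diff_act (Bp.cls_mem_algDeg K _), smul_smul, smul_smul, ← Int.negOnePow_add,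
      ← Int.negOnePow_add]
    congr 1
    -- For a word of length `n + 1` with leading path `p`, the exponents are `(parity C + n) |p|`
    -- and `(n + 1 + parity D) |p|`. They have the same parity by `parity_eq`.
    rw [Int.negOnePow_eq_iff]
    obtain ⟨k, hk⟩ := hf.parity_eq
    refine ⟨(C.lead α).1.degree * (k - D.parity - 1), ?_⟩
    push_cast
    linear_combination (C.lead α).1.degree * hk

theorem diff_apply {f : X →ₗ[K] Y} (hf : Comparison C D f) (x : X) :
    f (C.diff x) = D.diff (f x) :=
  LinearMap.congr_fun hf.diff_comp x

end Comparison

/-! ### Generators, and the identity and homotopy for composites. -/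

variable (C D)

/-- The span of the generators of length `n`. -/
def genSpan (n : ℕ) : Submodule K X := Submodule.span K (Set.range (C.gen (n := n)))

variable {C D}

theorem eqOn_genSpan {f g : X →ₗ[K] Y} {n : ℕ} (h : ∀ α : C.Word n, f (C.gen α) = g (C.gen α))
    {x : X} (hx : x ∈ C.genSpan n) : f x = g x := by
  induction hx using Submodule.span_induction with
  | mem x hx => obtain ⟨α, rfl⟩ := hx; exact h α
  | zero => simp
  | add x y _ _ hx hy => rw [map_add, map_add, hx, hy]
  | smul c x _ hx => rw [map_smul, map_smul, hx]

theorem Comparison.map_genSpan {f : X →ₗ[K] Y} (hf : Comparison C D f) {n : ℕ} {x : X}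
    (hx : x ∈ C.genSpan n) : f x = D.contr (f (C.diff x)) + D.unit (C.aug x) :=
  eqOn_genSpan (g := D.contr ∘ₗ f ∘ₗ C.diff + D.unit ∘ₗ C.aug) (fun α => hf.map_gen α) hx

/-- For a generator `x`, the recursion for `g` applies to `f x`, which is a combination of
generators. With `f d x = d f x` and induction it gives `g f x = s d x + u ε x = x`. For a word, the
two signs `n |p|` cancel. -/
theorem Comparison.comp_eq_id {f : X →ₗ[K] Y} {g : Y →ₗ[K] X} (hf : Comparison C D f)
    (hg : Comparison D C g) (h : ∀ (n : ℕ) (α : C.Word n), f (C.gen α) ∈ D.genSpan n) :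
    g ∘ₗ f = LinearMap.id := by
  refine C.hom_ext fun n => ?_
  have key : ∀ (n : ℕ) (α : C.Word n), g (f (C.diff (C.gen α))) = C.diff (C.gen α) →
      g (f (C.word α)) = C.word α := by
    intro n α e
    have : g (f (C.gen α)) = C.gen α := by
      rw [hg.map_genSpan (h n α), ← hf.diff_apply, e, hf.aug_apply, ← C.gen_eq]
    rw [hf.map_word, map_sign_smul, hg.map_act (Bp.cls_mem_algDeg K _)
      (hf.map_level n _ (C.gen_mem α)), this, smul_smul, ← Int.negOnePow_add, ← C.word_eq,
      Int.negOnePow_even _ ⟨_, rfl⟩, one_smul]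
  induction n with
  | zero =>
    refine fun x hx => C.eqOn_level (fun α => key 0 α ?_) hx
    rw [C.diff_gen_zero, map_zero, map_zero]
  | succ n ih =>
    exact fun x hx => C.eqOn_level (fun α => key (n + 1) α (ih _ (C.diff_gen_mem α))) hx

/-- A map built by recursion with the contraction is a homotopy from `f g` to the identity. -/
theorem Comparison.homotopy {f : X →ₗ[K] Y} {g : Y →ₗ[K] X} (hf : Comparison C D f)
    (hg : Comparison D C g) {h : Y →ₗ[K] Y} (hp : D.parity = 1)
    (hw : ∀ {n : ℕ} (α : D.Word n), h (D.word α) =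
      (1 * (D.lead α).1.degree).negOnePow • D.act ((D.lead α).cls K) (h (D.gen α)))
    (hgen : ∀ {n : ℕ} (α : D.Word n), h (D.gen α) =
      D.contr (D.gen α - f (g (D.gen α)) - h (D.diff (D.gen α)))) :
    LinearMap.id - f ∘ₗ g = D.diff ∘ₗ h + h ∘ₗ D.diff := by
  have haug : ∀ y, D.aug (h y) = 0 := by
    refine LinearMap.congr_fun (f := D.aug ∘ₗ h) (g := 0) ?_
    refine D.hom_ext fun n x hx => D.eqOn_level (fun α => ?_) hx
    rw [LinearMap.comp_apply, hw, map_sign_smul, D.aug_act, hgen, D.aug_contr, mul_zero,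
      smul_zero, LinearMap.zero_apply]
  -- The element `x - f g x - h d x` is a cycle of augmentation zero, so it is the differential of
  -- its contraction, which by the recursion is `h x`.
  have key : ∀ (n : ℕ) (α : D.Word n), D.diff (h (D.diff (D.gen α))) =
      D.diff (D.gen α) - f (g (D.diff (D.gen α))) →
      D.gen α - f (g (D.gen α)) = D.diff (h (D.gen α)) + h (D.diff (D.gen α)) := by
    intro n α e
    have h1 := D.homotopy (D.gen α - f (g (D.gen α)) - h (D.diff (D.gen α)))
    have h2 : D.diff (D.gen α - f (g (D.gen α)) - h (D.diff (D.gen α))) = 0 := by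
      rw [map_sub, map_sub, e, ← hf.diff_apply, ← hg.diff_apply, sub_self]
    have h3 : D.aug (D.gen α - f (g (D.gen α)) - h (D.diff (D.gen α))) = 0 := by
      rw [map_sub, map_sub, haug, hf.aug_apply, hg.aug_apply, sub_self, sub_zero]
    rw [h2, h3, map_zero, map_zero, ← hgen, sub_zero, add_zero] at h1
    rw [h1, sub_add_cancel]
  -- From a generator to a word: `f g` passes the leading path without sign, since each factor
  -- contributes `n |p|`. The maps `d` and `h` each contribute `|p|`, as the parity of the target is
  -- `1`.
  have hlead : ∀ (n : ℕ) (α : D.Word n),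
      D.gen α - f (g (D.gen α)) = D.diff (h (D.gen α)) + h (D.diff (D.gen α)) →
      D.word α - f (g (D.word α)) = D.diff (h (D.word α)) + h (D.diff (D.word α)) := by
    intro n α e
    have hact : ∀ y, h (D.act ((D.lead α).cls K) y) =
        (1 * (D.lead α).1.degree).negOnePow • D.act ((D.lead α).cls K) (h y) := by
      refine LinearMap.congr_fun (f := h ∘ₗ D.act ((D.lead α).cls K))
        (g := (1 * (D.lead α).1.degree).negOnePow • D.act ((D.lead α).cls K) ∘ₗ h) ?_
      exact D.hom_ext fun n y hy => D.map_act D h 1 hw (Bp.cls_mem_algDeg K _) hy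
    have h1 : f (g (D.word α)) = D.act ((D.lead α).cls K) (f (g (D.gen α))) := by
      rw [hg.map_word, map_sign_smul, hf.map_act (Bp.cls_mem_algDeg K _)
        (hg.map_level n _ (D.gen_mem α)), smul_smul, ← Int.negOnePow_add,
        Int.negOnePow_even _ ⟨_, rfl⟩, one_smul]
    rw [h1, hw, D.diff_word, map_sign_smul, map_sign_smul, hact, D.diff_act (Bp.cls_mem_algDeg K _),
      hp, smul_smul, smul_smul, ← Int.negOnePow_add, Int.negOnePow_even _ ⟨_, rfl⟩, one_smul,
      one_smul, ← map_add, ← e, map_sub, ← D.word_eq]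
  refine D.hom_ext fun n => ?_
  induction n with
  | zero =>
    refine fun x hx => D.eqOn_level (fun α => hlead 0 α (key 0 α ?_)) hx
    rw [D.diff_gen_zero]
    simp
  | succ n ih =>
    refine fun x hx => D.eqOn_level (fun α => hlead _ α (key _ α ?_)) hx
    -- The homotopy equation one level below, at `d x`; there the term `h d d x` is zero.
    have := ih _ (D.diff_gen_mem α)
    simp only [LinearMap.sub_apply, LinearMap.id_apply, LinearMap.comp_apply,
      LinearMap.add_apply, D.diff_diff_apply, map_zero, add_zero] at this
    exact this.symm

/-! #### Right multiplications -/

/-- A map that behaves like the right multiplication by an element of `A`. -/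
structure IsRightMul (C : ContractedComplex K T X) (r : X →ₗ[K] X)
    (rA : T.Alg K →ₗ[K] T.Alg K) : Prop where
  act : ∀ a x, r (C.act a x) = C.act a (r x)
  contr : ∀ x, r (C.contr x) = C.contr (r x)
  unit : ∀ a, r (C.unit a) = C.unit (rA a)
  aug : ∀ x, C.aug (r x) = rA (C.aug x)
  gen : ∀ (n : ℕ) (α : C.Word n), r (C.gen α) ∈ C.genSpan n

theorem genSpan_le {n : ℕ} : C.genSpan n ≤ C.level n :=
  Submodule.span_le.2 (by rintro _ ⟨α, rfl⟩; exact C.gen_mem α)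

theorem act_mem {n : ℕ} (a : T.Alg K) {x : X} (hx : x ∈ C.level n) : C.act a x ∈ C.level n := by
  rw [← (T.basis K).linearCombination_repr a]
  induction (T.basis K).repr a using Finsupp.induction_linear with
  | zero => simp
  | add a b ha hb => rw [map_add, map_add]; exact add_mem ha hb
  | single p c =>
    rw [Finsupp.linearCombination_single, map_smul]
    refine Submodule.smul_mem _ c ?_
    rw [basis_apply]
    induction hx using Submodule.span_induction with
    | zero => simp
    | add x y _ _ hx hy => rw [map_add]; exact add_mem hx hy
    | smul c x _ hx => rw [map_smul]; exact Submodule.smul_mem _ c hx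
    | mem x hx =>
      obtain ⟨α, rfl⟩ := hx
      rw [C.word_eq, ← C.act_mul]
      rcases cls_mul_cls_cases K p (C.lead α) with h0 | ⟨r, hr, -, hs, -⟩
      · simp [h0]
      · obtain ⟨β, rfl, hg⟩ := C.change_lead α r hs
        rw [hr, ← hg, ← C.word_eq]
        exact C.word_mem β

namespace IsRightMul

variable {r : X →ₗ[K] X} {rA : T.Alg K →ₗ[K] T.Alg K}

theorem mem_level (hr : IsRightMul C r rA) {n : ℕ} {x : X} (hx : x ∈ C.level n) :
    r x ∈ C.level n := by
  induction hx using Submodule.span_induction with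
  | zero => simp
  | add x y _ _ hx hy => rw [map_add]; exact add_mem hx hy
  | smul c x _ hx => rw [map_smul]; exact Submodule.smul_mem _ c hx
  | mem x hx =>
    obtain ⟨α, rfl⟩ := hx
    rw [C.word_eq, hr.act]
    exact act_mem _ (genSpan_le (hr.gen n α))

/-- Applying `r` to `x = s d x + u ε x` and then `d` gives `d r x = d s (r d x)`. By induction `r d
x` is a cycle, and its augmentation is zero, so the right side is `r d x`. -/
theorem diff_comp (hr : IsRightMul C r rA) : r ∘ₗ C.diff = C.diff ∘ₗ r := by
  have hlead : ∀ (n : ℕ) (α : C.Word n), r (C.diff (C.gen α)) = C.diff (r (C.gen α)) →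
      r (C.diff (C.word α)) = C.diff (r (C.word α)) := by
    intro n α e
    rw [C.diff_word, map_sign_smul, hr.act, e, C.word_eq, hr.act, C.diff_act (Bp.cls_mem_algDeg K _)]
  have key : ∀ (n : ℕ) (α : C.Word n), C.diff (r (C.diff (C.gen α))) = 0 →
      r (C.diff (C.gen α)) = C.diff (r (C.gen α)) := by
    intro n α e
    conv_rhs => rw [C.gen_eq α, map_add, hr.contr, hr.unit, map_add, C.diff_unit, add_zero]
    have h := C.homotopy (r (C.diff (C.gen α)))
    rw [e, map_zero, add_zero, hr.aug, C.aug_diff_apply, map_zero, map_zero, sub_zero] at h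
    exact h.symm
  refine C.hom_ext fun n => ?_
  induction n with
  | zero =>
    refine fun x hx => C.eqOn_level (fun α => hlead 0 α (key 0 α ?_)) hx
    rw [C.diff_gen_zero, map_zero, map_zero]
  | succ n ih =>
    refine fun x hx => C.eqOn_level (fun α => hlead _ α (key _ α ?_)) hx
    have := ih _ (C.diff_gen_mem α)
    rw [LinearMap.comp_apply, LinearMap.comp_apply, C.diff_diff_apply, map_zero] at this
    exact this.symm

theorem diff_apply (hr : IsRightMul C r rA) (x : X) : r (C.diff x) = C.diff (r x) :=
  LinearMap.congr_fun hr.diff_comp x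

/-- Since `r` preserves the span of the generators, the recursion computes `f r x` for a generator
`x`. As `r'` commutes with the contraction and the unit of the target, the recursion for `r' f x` is
the same. -/
theorem comparison (hr : IsRightMul C r rA) {r' : Y →ₗ[K] Y} (hr' : IsRightMul D r' rA)
    {f : X →ₗ[K] Y} (hf : Comparison C D f) : f ∘ₗ r = r' ∘ₗ f := by
  have hlead : ∀ (n : ℕ) (α : C.Word n), f (r (C.diff (C.gen α))) = r' (f (C.diff (C.gen α))) →
      f (r (C.word α)) = r' (f (C.word α)) := by
    intro n α e
    have : f (r (C.gen α)) = r' (f (C.gen α)) := by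
      rw [hf.map_genSpan (hr.gen n α), ← hr.diff_apply, e, hr.aug, hf.map_gen, map_add, hr'.contr,
        hr'.unit]
    rw [C.word_eq, hr.act, hf.map_act (Bp.cls_mem_algDeg K _) (hr.mem_level (C.gen_mem α)), this,
      hf.map_act (Bp.cls_mem_algDeg K _) (C.gen_mem α), map_sign_smul, hr'.act]
  refine C.hom_ext fun n => ?_
  induction n with
  | zero =>
    refine fun x hx => C.eqOn_level (fun α => hlead 0 α ?_) hx
    rw [C.diff_gen_zero, map_zero, map_zero, map_zero]
  | succ n ih =>
    exact fun x hx => C.eqOn_level (fun α => hlead _ α (ih _ (C.diff_gen_mem α))) hx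

/-- The recursion for `h` involves only maps that commute with `r`, and it holds on the whole span
of the generators, so `h r` and `r h` agree by induction on the length. In the application `k` is `F
G`. -/
theorem homotopy (hr : IsRightMul C r rA) {k h : X →ₗ[K] X} (hk : ∀ x, k (r x) = r (k x))
    (hw : ∀ {n : ℕ} (α : C.Word n), h (C.word α) =
      (1 * (C.lead α).1.degree).negOnePow • C.act ((C.lead α).cls K) (h (C.gen α)))
    (hgen : ∀ {n : ℕ} (α : C.Word n), h (C.gen α) =
      C.contr (C.gen α - k (C.gen α) - h (C.diff (C.gen α)))) :
    h ∘ₗ r = r ∘ₗ h := by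
  have hlead : ∀ (n : ℕ) (α : C.Word n), h (r (C.diff (C.gen α))) = r (h (C.diff (C.gen α))) →
      h (r (C.word α)) = r (h (C.word α)) := by
    intro n α e
    have : h (r (C.gen α)) = r (h (C.gen α)) := by
      have h1 := eqOn_genSpan (f := h) (g := C.contr ∘ₗ (LinearMap.id - k - h ∘ₗ C.diff))
        (fun α => hgen α) (hr.gen n α)
      simp only [LinearMap.comp_apply, LinearMap.sub_apply, LinearMap.id_apply] at h1
      rw [h1, ← hr.diff_apply, e, hk, hgen, hr.contr, map_sub r, map_sub r]
    rw [C.word_eq, hr.act, C.map_act C h 1 hw (Bp.cls_mem_algDeg K _)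
      (hr.mem_level (C.gen_mem α)), this,
      C.map_act C h 1 hw (Bp.cls_mem_algDeg K _) (C.gen_mem α), map_sign_smul, hr.act]
  refine C.hom_ext fun n => ?_
  induction n with
  | zero =>
    refine fun x hx => C.eqOn_level (fun α => hlead 0 α ?_) hx
    rw [C.diff_gen_zero, map_zero, map_zero, map_zero]
  | succ n ih =>
    exact fun x hx => C.eqOn_level (fun α => hlead _ α (ih _ (C.diff_gen_mem α))) hx

end IsRightMul

end ContractedComplex

/-! ### Tensors in the bar resolution -/

variable (T) in
open Classical in
/-- The projection of `A` onto a factor of the bar resolution: the identity on the outer factors,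
the projection onto `Ā` along `E` on the inner ones. -/
def slotProj (n : ℕ) (i : Fin (n + 2)) : T.Alg K →ₗ[K] T.Slot K n i :=
  (T.basis K).constr K fun p =>
    if h : ¬(i = 0 ∨ i = Fin.last (n + 1)) → p.1.arrows ≠ [] then T.slotBasis K n i ⟨p, h⟩ else 0

theorem slotProj_cls {n : ℕ} {i : Fin (n + 2)} (p : T.Bp)
    (h : ¬(i = 0 ∨ i = Fin.last (n + 1)) → p.1.arrows ≠ []) :
    T.slotProj K n i (p.cls K) = T.slotBasis K n i ⟨p, h⟩ := by
  rw [slotProj, ← basis_apply, Module.Basis.constr_basis, dif_pos h]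

theorem slotProj_cls_eq_zero {n : ℕ} {i : Fin (n + 2)} (p : T.Bp)
    (hi : ¬(i = 0 ∨ i = Fin.last (n + 1))) (hp : p.1.arrows = []) :
    T.slotProj K n i (p.cls K) = 0 := by
  rw [slotProj, ← basis_apply, Module.Basis.constr_basis, dif_neg fun h => h hi hp]

theorem slotProj_of_mem {n : ℕ} {i : Fin (n + 2)} {x : T.Alg K} (hx : x ∈ T.Slot K n i) :
    T.slotProj K n i x = ⟨x, hx⟩ := by
  refine Subtype.ext ?_
  have hx' := hx
  rw [Slot_eq_span] at hx'
  induction hx' using Submodule.span_induction with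
  | zero => simp
  | add x y hx1 hy1 h h' =>
    rw [← Slot_eq_span] at hx1 hy1
    rw [map_add, Submodule.coe_add, h hx1, h' hy1]
  | smul c x hx1 h =>
    rw [← Slot_eq_span] at hx1
    rw [map_smul, Submodule.coe_smul, h hx1]
  | mem x h =>
    obtain ⟨p, rfl⟩ := h
    simp only [basis_apply]
    rw [slotProj_cls K p.1 p.2, slotBasis_apply]
    rfl

/-- The decomposition of `A` into `E` and `Ā` is one of `E`-bimodules, so the projection respects
vertex idempotents. Hence it descends to the tensor product over `E`. -/
theorem slotProj_mul_idem {n : ℕ} {i : Fin (n + 2)} (x : T.Alg K) (v : V) :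
    T.slotProj K n i (x * T.idem K v) = T.slotRight K n v i (T.slotProj K n i x) := by
  classical
  refine LinearMap.congr_fun (f := T.slotProj K n i ∘ₗ LinearMap.mulRight K (T.idem K v))
    (g := T.slotRight K n v i ∘ₗ T.slotProj K n i) ((T.basis K).ext fun p => ?_) x
  simp only [LinearMap.comp_apply, LinearMap.mulRight_apply, basis_apply]
  by_cases h : ¬(i = 0 ∨ i = Fin.last (n + 1)) → p.1.arrows ≠ []
  · refine Subtype.ext ?_
    rw [slotProj_cls K p h, slotRight_coe, slotBasis_apply, Bp.cls, cls_mul_idem]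
    split_ifs with hv
    · exact congrArg Subtype.val (slotProj_cls K p h) |>.trans (slotBasis_apply K n i _)
    · simp
  · push Not at h
    rw [slotProj_cls_eq_zero K p (not_or.2 h.1) h.2, map_zero, Bp.cls, cls_mul_idem]
    split_ifs with hv
    · exact slotProj_cls_eq_zero K p (not_or.2 h.1) h.2
    · simp

theorem slotProj_idem_mul {n : ℕ} {i : Fin (n + 2)} (x : T.Alg K) (v : V) :
    T.slotProj K n i (T.idem K v * x) = T.slotLeft K n v i (T.slotProj K n i x) := by
  classical
  refine LinearMap.congr_fun (f := T.slotProj K n i ∘ₗ LinearMap.mulLeft K (T.idem K v))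
    (g := T.slotLeft K n v i ∘ₗ T.slotProj K n i) ((T.basis K).ext fun p => ?_) x
  simp only [LinearMap.comp_apply, LinearMap.mulLeft_apply, basis_apply]
  by_cases h : ¬(i = 0 ∨ i = Fin.last (n + 1)) → p.1.arrows ≠ []
  · refine Subtype.ext ?_
    rw [slotProj_cls K p h, slotLeft_coe, slotBasis_apply, Bp.cls, idem_mul_cls]
    split_ifs with hv
    · exact congrArg Subtype.val (slotProj_cls K p h) |>.trans (slotBasis_apply K n i _)
    · simp
  · push Not at h
    rw [slotProj_cls_eq_zero K p (not_or.2 h.1) h.2, map_zero, Bp.cls, idem_mul_cls]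
    split_ifs with hv
    · exact slotProj_cls_eq_zero K p (not_or.2 h.1) h.2
    · simp

variable (T) in
/-- The tensor `x_{n+1} ⊗ s x_n ⊗ ⋯ ⊗ s x_1 ⊗ x_0`, as a multilinear function of arbitrary
elements of `A`, the inner ones being projected onto `Ā`. -/
def barLin (n : ℕ) : MultilinearMap K (fun _ : Fin (n + 2) => T.Alg K) (T.Bar K n) :=
  ((Submodule.mkQ (⨆ k, LinearMap.range (T.barRel K n k))).compMultilinearMap
    (PiTensorProduct.tprod K)).compLinearMap (T.slotProj K n)

/-- This frees tensors of their membership proofs: factors can be updated and expanded by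
multilinearity. -/
theorem bar_eq_barLin {n : ℕ} (x : Fin (n + 2) → T.Alg K) (hx : ∀ i, x i ∈ T.Slot K n i) :
    T.bar K n x hx = T.barLin K n x := by
  have : (fun i => (⟨x i, hx i⟩ : T.Slot K n i)) = fun i => T.slotProj K n i (x i) :=
    funext fun i => (slotProj_of_mem K (hx i)).symm
  rw [bar, this]
  rfl

theorem barLin_balance {n : ℕ} (x : Fin (n + 2) → T.Alg K) (j : Fin (n + 1)) (v : V) :
    T.barLin K n (Function.update x j.succ (x j.succ * T.idem K v)) =
      T.barLin K n (Function.update x j.castSucc (T.idem K v * x j.castSucc)) := by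
  refine (Submodule.Quotient.eq _).2 (Submodule.mem_iSup_of_mem (j, v) ?_)
  refine ⟨T.preBar K n fun i => T.slotProj K n i (x i), ?_⟩
  rw [barRel, LinearMap.sub_apply]
  congr 1
  · refine (PiTensorProduct.map_tprod _ _).trans (congrArg _ (funext fun i => ?_))
    by_cases hi : i = j.succ
    · subst hi; simp [slotProj_mul_idem]
    · simp [hi]
  · refine (PiTensorProduct.map_tprod _ _).trans (congrArg _ (funext fun i => ?_))
    by_cases hi : i = j.castSucc
    · subst hi; simp [slotProj_idem_mul]
    · simp [hi]

/-- An idempotent that fixes one factor moves across the tensor sign and kills the next one: tensors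
of paths that do not compose vanish. -/
theorem barLin_eq_zero {n : ℕ} {x : Fin (n + 2) → T.Alg K} (j : Fin (n + 1)) (v : V)
    (h1 : x j.succ * T.idem K v = x j.succ) (h2 : T.idem K v * x j.castSucc = 0) :
    T.barLin K n x = 0 := by
  have := barLin_balance K x j v
  rw [h1, h2, Function.update_eq_self] at this
  rw [this]
  exact (T.barLin K n).map_coord_zero j.castSucc (by simp)

/-- The bar resolution is normalized: the projection to `Ā` kills a trivial path in an inner
position. -/
theorem barLin_eq_zero_of_inner {n : ℕ} {x : Fin (n + 2) → T.Alg K} (i : Fin (n + 2))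
    (hi : ¬(i = 0 ∨ i = Fin.last (n + 1))) (p : T.Bp) (hp : p.1.arrows = [])
    (hx : x i = p.cls K) : T.barLin K n x = 0 := by
  change Submodule.mkQ (⨆ k, LinearMap.range (T.barRel K n k))
    (PiTensorProduct.tprod K fun i => T.slotProj K n i (x i)) = 0
  rw [MultilinearMap.map_coord_zero _ i (by rw [hx]; exact slotProj_cls_eq_zero K p hi hp)]
  exact LinearMap.map_zero _

/-- An idempotent moves from the leading factor to the next one, which it fixes. So a leading `1`
and a leading idempotent give the same tensor; the contraction is defined with the first, words use
the second. -/
theorem barLin_idem_last {n : ℕ} (x : Fin (n + 2) → T.Alg K) (v : V)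
    (hx : T.idem K v * x (Fin.last n).castSucc = x (Fin.last n).castSucc) :
    T.barLin K n (Function.update x (Fin.last (n + 1)) (T.idem K v)) =
      T.barLin K n (Function.update x (Fin.last (n + 1)) 1) := by
  have := barLin_balance K (Function.update x (Fin.last (n + 1)) 1) (Fin.last n) v
  rw [Fin.succ_last, Function.update_self, one_mul, Function.update_idem] at this
  rw [this, Function.update_of_ne (Fin.castSucc_ne_last _), hx]
  congr 1
  refine Function.update_eq_self_iff.2 ?_
  rw [Function.update_of_ne (Fin.castSucc_ne_last _)]

/-! ### Vertex idempotents and trivial paths. -/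

theorem Bp.cls_mul_idem_src (p : T.Bp) : p.cls K * T.idem K p.1.src = p.cls K := by
  classical rw [Bp.cls, cls_mul_idem, if_pos rfl]

theorem Bp.idem_tgt_mul_cls (p : T.Bp) : T.idem K p.1.tgt * p.cls K = p.cls K := by
  classical rw [Bp.cls, idem_mul_cls, if_pos rfl]

theorem Bp.idem_mul_cls_ne (p : T.Bp) {v : V} (h : p.1.tgt ≠ v) : T.idem K v * p.cls K = 0 := by
  classical rw [Bp.cls, idem_mul_cls, if_neg h]

theorem Bp.cls_mul_idem_ne (p : T.Bp) {v : V} (h : p.1.src ≠ v) : p.cls K * T.idem K v = 0 := by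
  classical rw [Bp.cls, cls_mul_idem, if_neg h]

theorem Bp.triv_src (v : V) : (Bp.triv T v).1.src = v := rfl

theorem Bp.triv_degree (v : V) : (Bp.triv T v).1.degree = 0 := by
  simp [Bp.triv, Path.triv, Path.degree]

theorem Bp.eq_triv {p : T.Bp} (h : p.1.arrows = []) : p = Bp.triv T p.1.src := by
  obtain ⟨⟨j, l, i, hl⟩, hc⟩ := p
  cases h
  cases hl
  rfl

theorem Bp.cls_triv (v : V) : (Bp.triv T v).cls K = T.idem K v := rfl

/-! ### Words of the bar resolution -/

namespace BarWord

/-- The factors of a word, as elements of `𝓑`. -/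
def tuple {n : ℕ} (α : T.BarWord n) (j : Fin (n + 2)) : T.Bp := (α.1 j).1

/-- The word with given factors. -/
def mk {n : ℕ} (b : Fin (n + 2) → T.Bp)
    (hi : ∀ i, ¬(i = 0 ∨ i = Fin.last (n + 1)) → (b i).1.arrows ≠ [])
    (hc : ∀ j : Fin (n + 1), (b j.castSucc).1.tgt = (b j.succ).1.src) : T.BarWord n :=
  ⟨fun i => ⟨b i, hi i⟩, hc⟩

theorem tuple_ne_nil {n : ℕ} (α : T.BarWord n) (i : Fin (n + 2))
    (hi : ¬(i = 0 ∨ i = Fin.last (n + 1))) : (α.tuple i).1.arrows ≠ [] := (α.1 i).2 hi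

theorem tuple_comp {n : ℕ} (α : T.BarWord n) (j : Fin (n + 1)) :
    (α.tuple j.castSucc).1.tgt = (α.tuple j.succ).1.src := α.2 j

/-- The leading factor. -/
def lead {n : ℕ} (α : T.BarWord n) : T.Bp := α.tuple (Fin.last (n + 1))

/-- Replace the leading factor. -/
def setLead {n : ℕ} (α : T.BarWord n) (p : T.Bp) (hp : p.1.src = α.lead.1.src) : T.BarWord n :=
  mk (Function.update α.tuple (Fin.last (n + 1)) p)
    (fun i hi => by
      rw [Function.update_of_ne (fun h => hi (Or.inr h))]
      exact α.tuple_ne_nil i hi)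
    (fun j => by
      rw [Function.update_of_ne (Fin.castSucc_ne_last j), α.tuple_comp]
      by_cases h : j.succ = Fin.last (n + 1)
      · rw [h, Function.update_self, hp]; rfl
      · rw [Function.update_of_ne h])

theorem setLead_tuple {n : ℕ} (α : T.BarWord n) (p : T.Bp) (hp : p.1.src = α.lead.1.src) :
    (α.setLead p hp).tuple = Function.update α.tuple (Fin.last (n + 1)) p := rfl

theorem setLead_lead {n : ℕ} (α : T.BarWord n) (p : T.Bp) (hp : p.1.src = α.lead.1.src) :
    (α.setLead p hp).lead = p := by
  rw [lead, setLead_tuple, Function.update_self]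

theorem ext_tuple {n : ℕ} {α β : T.BarWord n} (h : α.tuple = β.tuple) : α = β :=
  Subtype.ext (funext fun i => Subtype.ext (congrFun h i))

/-- The word with trivial leading factor. -/
def gen {n : ℕ} (α : T.BarWord n) : T.BarWord n :=
  α.setLead (Bp.triv T α.lead.1.src) (Bp.triv_src _)

theorem gen_tuple {n : ℕ} (α : T.BarWord n) : α.gen.tuple =
    Function.update α.tuple (Fin.last (n + 1)) (Bp.triv T α.lead.1.src) := rfl

theorem gen_lead {n : ℕ} (α : T.BarWord n) : α.gen.lead = Bp.triv T α.lead.1.src :=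
  setLead_lead _ _ _

theorem gen_setLead {n : ℕ} (α : T.BarWord n) (p : T.Bp) (hp : p.1.src = α.lead.1.src) :
    (α.setLead p hp).gen = α.gen := by
  refine ext_tuple ?_
  rw [gen_tuple, gen_tuple, setLead_tuple, Function.update_idem, setLead_lead, hp]

theorem gen_gen {n : ℕ} (α : T.BarWord n) : α.gen.gen = α.gen := gen_setLead _ _ _

theorem gen_of_lead {n : ℕ} {α : T.BarWord n} (h : α.lead.1.arrows = []) : α.gen = α := by
  refine ext_tuple ?_
  rw [gen_tuple, ← Bp.eq_triv h]
  exact Function.update_eq_self _ _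

/-- `α ↦ e ⊗ sα_{n+1} ⊗ ⋯ ⊗ sα_1 ⊗ α_0`. -/
def shift {n : ℕ} (α : T.BarWord n) (h : α.lead.1.arrows ≠ []) : T.BarWord (n + 1) :=
  mk (Fin.snoc (α := fun _ => T.Bp) α.tuple (Bp.triv T α.lead.1.tgt))
    (fun i => by
      refine Fin.lastCases (fun hi => absurd (Or.inr rfl) hi) (fun i hi => ?_) i
      rw [Fin.snoc_castSucc]
      by_cases hl : i = Fin.last (n + 1)
      · subst hl; exact h
      · exact α.tuple_ne_nil i (by
          rintro (rfl | h')
          · exact hi (Or.inl rfl)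
          · exact hl h'))
    (fun j => by
      refine Fin.lastCases ?_ (fun j => ?_) j
      · rw [Fin.snoc_castSucc, Fin.succ_last, Fin.snoc_last]; rfl
      · rw [Fin.snoc_castSucc, Fin.succ_castSucc, Fin.snoc_castSucc, α.tuple_comp])

theorem shift_tuple {n : ℕ} (α : T.BarWord n) (h : α.lead.1.arrows ≠ []) :
    (α.shift h).tuple = Fin.snoc (α := fun _ => T.Bp) α.tuple (Bp.triv T α.lead.1.tgt) := rfl

theorem shift_lead {n : ℕ} (α : T.BarWord n) (h : α.lead.1.arrows ≠ []) :
    (α.shift h).lead = Bp.triv T α.lead.1.tgt := by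
  rw [lead, shift_tuple, Fin.snoc_last]

/-- The word without its leading factor. -/
def unshift {n : ℕ} (α : T.BarWord (n + 1)) : T.BarWord n :=
  mk (fun i => α.tuple i.castSucc)
    (fun i hi => α.tuple_ne_nil _ (by
      rintro (h | h)
      · exact hi (Or.inl (by simpa using h))
      · exact Fin.castSucc_ne_last i h))
    (fun j => by rw [α.tuple_comp, Fin.succ_castSucc])

theorem unshift_tuple {n : ℕ} (α : T.BarWord (n + 1)) :
    α.unshift.tuple = fun i => α.tuple i.castSucc := rfl

theorem unshift_lead_ne_nil {n : ℕ} (α : T.BarWord (n + 1)) : α.unshift.lead.1.arrows ≠ [] := by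
  refine α.tuple_ne_nil (Fin.last (n + 1)).castSucc ?_
  rintro (h | h)
  · simp [Fin.ext_iff] at h
  · exact Fin.castSucc_ne_last _ h

/-- Every generator of positive length is the contraction of a word that is one shorter and has
leading factor of positive length. This reduces statements on generators to the compatibility with
contractions. -/
theorem gen_eq_shift {n : ℕ} (α : T.BarWord (n + 1)) :
    α.gen = α.unshift.shift α.unshift_lead_ne_nil := by
  refine ext_tuple (funext fun i => ?_)
  refine Fin.lastCases ?_ (fun i => ?_) i
  · rw [gen_tuple, Function.update_self, shift_tuple, Fin.snoc_last]
    congr 1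
    rw [lead, lead, unshift_tuple, α.tuple_comp, Fin.succ_last]
  · rw [gen_tuple, Function.update_of_ne (Fin.castSucc_ne_last _), shift_tuple,
      Fin.snoc_castSucc, unshift_tuple]

theorem path_eq {n : ℕ} (α : T.BarWord n) (j : Fin (n + 2)) : α.path j = (α.tuple j).1 := rfl

end BarWord

theorem barBasis_eq {n : ℕ} (α : T.BarWord n) :
    T.barBasis K n α = T.barLin K n fun j => (α.tuple j).cls K := by
  rw [barBasis_apply, bar_eq_barLin]
  rfl

/-- A linear map on the bar resolution agrees with a multilinear map if it does so on words and
the multilinear map vanishes on the tuples that are not words. -/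
theorem apply_barLin {n : ℕ} {M : Type*} [AddCommGroup M] [Module K M] (φ : T.Bar K n →ₗ[K] M)
    (f : MultilinearMap K (fun _ : Fin (n + 2) => T.Alg K) M)
    (hw : ∀ α : T.BarWord n, φ (T.barBasis K n α) = f fun j => (α.tuple j).cls K)
    (hi : ∀ (b : Fin (n + 2) → T.Bp) (i : Fin (n + 2)), ¬(i = 0 ∨ i = Fin.last (n + 1)) →
      (b i).1.arrows = [] → f (fun j => (b j).cls K) = 0)
    (hc : ∀ (b : Fin (n + 2) → T.Bp) (j : Fin (n + 1)),
      (b j.castSucc).1.tgt ≠ (b j.succ).1.src → f (fun j => (b j).cls K) = 0)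
    (x : Fin (n + 2) → T.Alg K) : φ (T.barLin K n x) = f x := by
  suffices φ.compMultilinearMap (T.barLin K n) = f from
    DFunLike.congr_fun this x
  refine Module.Basis.ext_multilinear (fun _ => T.basis K) fun b => ?_
  simp only [basis_apply, LinearMap.compMultilinearMap_apply]
  by_cases h1 : ∀ i, ¬(i = 0 ∨ i = Fin.last (n + 1)) → (b i).1.arrows ≠ []
  · by_cases h2 : ∀ j : Fin (n + 1), (b j.castSucc).1.tgt = (b j.succ).1.src
    · have := hw (BarWord.mk b h1 h2)
      rw [barBasis_eq] at this
      exact this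
    · push Not at h2
      obtain ⟨j, hj⟩ := h2
      rw [hc b j hj, barLin_eq_zero K j (b j.succ).1.src (Bp.cls_mul_idem_src K _)
        (Bp.idem_mul_cls_ne K _ hj), map_zero]
  · push Not at h1
    obtain ⟨i, h1, h2⟩ := h1
    rw [hi b i (not_or.2 h1) h2, barLin_eq_zero_of_inner K i (not_or.2 h1) _ h2 rfl, map_zero]

/-- The action is defined on words only. The updated tensor is multilinear and vanishes on tuples of
paths that are not words, so the formula extends to all tensors. -/
theorem barLeft_barLin (n : ℕ) (c : T.Alg K) (x : Fin (n + 2) → T.Alg K) :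
    T.barLeft K n c (T.barLin K n x) =
      T.barLin K n (Function.update x (Fin.last (n + 1)) (c * x (Fin.last (n + 1)))) := by
  have hf : ∀ x : Fin (n + 2) → T.Alg K, (fun i => (if i = Fin.last (n + 1) then
      LinearMap.mulLeft K c else LinearMap.id : T.Alg K →ₗ[K] T.Alg K) (x i)) =
      Function.update x (Fin.last (n + 1)) (c * x (Fin.last (n + 1))) := by
    intro x
    funext i
    by_cases h : i = Fin.last (n + 1)
    · subst h; simp
    · simp [h]
  have := apply_barLin K (T.barLeft K n c) ((T.barLin K n).compLinearMap fun i =>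
    if i = Fin.last (n + 1) then LinearMap.mulLeft K c else LinearMap.id) ?_ ?_ ?_ x
  · rw [this, MultilinearMap.compLinearMap_apply, hf]
  · intro α
    rw [MultilinearMap.compLinearMap_apply, hf, barLeft, Module.Basis.constr_basis, bar_eq_barLin]
    rfl
  · intro b i hi hb
    rw [MultilinearMap.compLinearMap_apply, hf]
    refine barLin_eq_zero_of_inner K i hi (b i) hb ?_
    rw [Function.update_of_ne (fun h => hi (Or.inr h))]
  · intro b j hj
    rw [MultilinearMap.compLinearMap_apply, hf]
    refine barLin_eq_zero K j (b j.succ).1.src ?_ ?_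
    · by_cases h : j.succ = Fin.last (n + 1)
      · rw [h, Function.update_self, mul_assoc, Bp.cls_mul_idem_src]
      · rw [Function.update_of_ne h, Bp.cls_mul_idem_src]
    · rw [Function.update_of_ne (Fin.castSucc_ne_last j), Bp.idem_mul_cls_ne K _ hj]

theorem barRight_barLin (n : ℕ) (c : T.Alg K) (x : Fin (n + 2) → T.Alg K) :
    T.barRight K n c (T.barLin K n x) = T.barLin K n (Function.update x 0 (x 0 * c)) := by
  have hf : ∀ x : Fin (n + 2) → T.Alg K, (fun i => (if i = 0 then
      LinearMap.mulRight K c else LinearMap.id : T.Alg K →ₗ[K] T.Alg K) (x i)) =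
      Function.update x 0 (x 0 * c) := by
    intro x
    funext i
    by_cases h : i = 0
    · subst h; simp
    · simp [h]
  have := apply_barLin K (T.barRight K n c) ((T.barLin K n).compLinearMap fun i =>
    if i = 0 then LinearMap.mulRight K c else LinearMap.id) ?_ ?_ ?_ x
  · rw [this, MultilinearMap.compLinearMap_apply, hf]
  · intro α
    rw [MultilinearMap.compLinearMap_apply, hf, barRight, Module.Basis.constr_basis,
      bar_eq_barLin]
    rfl
  · intro b i hi hb
    rw [MultilinearMap.compLinearMap_apply, hf]
    refine barLin_eq_zero_of_inner K i hi (b i) hb ?_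
    rw [Function.update_of_ne (fun h => hi (Or.inl h))]
  · intro b j hj
    rw [MultilinearMap.compLinearMap_apply, hf]
    refine barLin_eq_zero K j (b j.succ).1.src ?_ ?_
    · rw [Function.update_of_ne (Fin.succ_ne_zero j), Bp.cls_mul_idem_src]
    · by_cases h : j.castSucc = 0
      · rw [h, Function.update_self, ← mul_assoc, ← h, Bp.idem_mul_cls_ne K _ hj, zero_mul]
      · rw [Function.update_of_ne h, Bp.idem_mul_cls_ne K _ hj]

/-! ### The contraction of the bar resolution -/

variable (T) in
/-- `x_{n+1} ⊗ ⋯ ⊗ x_0 ↦ 1 ⊗ x_{n+1} ⊗ ⋯ ⊗ x_0` as a multilinear map. -/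
def barShift (n : ℕ) :
    MultilinearMap K (fun _ : Fin (n + 2) => T.Alg K) (T.Bar K (n + 1)) :=
  (LinearMap.applyₗ (R := K) (1 : T.Alg K)).compMultilinearMap (T.barLin K (n + 1)).curryRight

theorem barShift_apply (n : ℕ) (x : Fin (n + 2) → T.Alg K) :
    T.barShift K n x = T.barLin K (n + 1) (Fin.snoc (α := fun _ => T.Alg K) x 1) := rfl

variable (T) in
/-- The contraction `x_{n+1} ⊗ s x_n ⊗ ⋯ ⊗ x_0 ↦ 1 ⊗ s x_{n+1} ⊗ s x_n ⊗ ⋯ ⊗ x_0` of the bar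
resolution. -/
def barContr (n : ℕ) : T.Bar K n →ₗ[K] T.Bar K (n + 1) :=
  (T.barBasis K n).constr K fun α => T.barShift K n fun j => (α.tuple j).cls K

theorem barContr_barLin (n : ℕ) (x : Fin (n + 2) → T.Alg K) :
    T.barContr K n (T.barLin K n x) =
      T.barLin K (n + 1) (Fin.snoc (α := fun _ => T.Alg K) x 1) := by
  rw [← barShift_apply]
  refine apply_barLin K (T.barContr K n) (T.barShift K n) ?_ ?_ ?_ x
  · intro α
    rw [barContr, Module.Basis.constr_basis]
  · intro b i hi hb
    rw [barShift_apply]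
    refine barLin_eq_zero_of_inner K i.castSucc ?_ (b i) hb (by rw [Fin.snoc_castSucc])
    rintro (h | h)
    · exact hi (Or.inl (by simpa using h))
    · exact Fin.castSucc_ne_last i h
  · intro b j hj
    rw [barShift_apply]
    refine barLin_eq_zero K j.castSucc (b j.succ).1.src ?_ ?_
    · rw [Fin.succ_castSucc, Fin.snoc_castSucc, Bp.cls_mul_idem_src]
    · rw [Fin.snoc_castSucc, Bp.idem_mul_cls_ne K _ hj]

theorem barLin_snoc (n : ℕ) (x : Fin (n + 2) → T.Alg K) (a : T.Alg K) :
    T.barLin K (n + 1) (Fin.snoc (α := fun _ => T.Alg K) x a) =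
      T.barLeft K (n + 1) a (T.barContr K n (T.barLin K n x)) := by
  rw [barContr_barLin, barLeft_barLin, Fin.snoc_last, mul_one, Fin.update_snoc_last]

/-- The contraction moves the leading idempotent to an inner position, where normalization kills it.
-/
theorem barContr_eq_zero {n : ℕ} {x : Fin (n + 2) → T.Alg K} (v : V)
    (hx : x (Fin.last (n + 1)) = T.idem K v) : T.barContr K n (T.barLin K n x) = 0 := by
  rw [barContr_barLin]
  refine barLin_eq_zero_of_inner K (Fin.last (n + 1)).castSucc ?_ (Bp.triv T v) rfl
    (by rw [Fin.snoc_castSucc, hx]; rfl)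
  rintro (h | h)
  · simp [Fin.ext_iff] at h
  · exact Fin.castSucc_ne_last _ h

theorem barRight_barContr (n : ℕ) (c : T.Alg K) (x : T.Bar K n) :
    T.barRight K (n + 1) c (T.barContr K n x) = T.barContr K n (T.barRight K n c x) := by
  refine LinearMap.congr_fun (f := T.barRight K (n + 1) c ∘ₗ T.barContr K n)
    (g := T.barContr K n ∘ₗ T.barRight K n c) ((T.barBasis K n).ext fun α => ?_) x
  rw [LinearMap.comp_apply, LinearMap.comp_apply, barBasis_eq, barContr_barLin, barRight_barLin,
    barRight_barLin, barContr_barLin, Fin.snoc_update]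
  rfl

theorem barRight_barLeft (n : ℕ) (a c : T.Alg K) (x : T.Bar K n) :
    T.barRight K n c (T.barLeft K n a x) = T.barLeft K n a (T.barRight K n c x) := by
  refine LinearMap.congr_fun (f := T.barRight K n c ∘ₗ T.barLeft K n a)
    (g := T.barLeft K n a ∘ₗ T.barRight K n c) ((T.barBasis K n).ext fun α => ?_) x
  have h0 : (0 : Fin (n + 2)) ≠ Fin.last (n + 1) := by simp [Fin.ext_iff]
  rw [LinearMap.comp_apply, LinearMap.comp_apply, barBasis_eq, barLeft_barLin, barRight_barLin,
    barRight_barLin, barLeft_barLin, Function.update_of_ne h0, Function.update_of_ne h0.symm,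
    Function.update_comm h0]

theorem barLeft_mul (n : ℕ) (a b : T.Alg K) (x : T.Bar K n) :
    T.barLeft K n (a * b) x = T.barLeft K n a (T.barLeft K n b x) := by
  refine LinearMap.congr_fun (f := T.barLeft K n (a * b))
    (g := T.barLeft K n a ∘ₗ T.barLeft K n b) ((T.barBasis K n).ext fun α => ?_) x
  rw [LinearMap.comp_apply, barBasis_eq, barLeft_barLin, barLeft_barLin, barLeft_barLin,
    Function.update_self, Function.update_idem, mul_assoc]

variable (T) in
/-- The left action on the bar resolution as a bilinear map. -/
def barLeftLin (n : ℕ) : T.Alg K →ₗ[K] T.Bar K n →ₗ[K] T.Bar K n where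
  toFun := T.barLeft K n
  map_add' a b := (T.barBasis K n).ext fun α => by
    simp only [barBasis_eq, LinearMap.add_apply, barLeft_barLin, add_mul,
      MultilinearMap.map_update_add]
  map_smul' c a := (T.barBasis K n).ext fun α => by
    simp only [barBasis_eq, LinearMap.smul_apply, barLeft_barLin, smul_mul_assoc,
      MultilinearMap.map_update_smul, RingHom.id_apply]

/-! ### The differential of the bar resolution -/

theorem contract_update {n : ℕ} (j : Fin (n + 2)) (x : Fin (n + 3) → T.Alg K) (a : T.Alg K) :
    contract K j (Function.update x (Fin.last (n + 2)) (a * x (Fin.last (n + 2)))) =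
      Function.update (contract K j x) (Fin.last (n + 1))
        (a * contract K j x (Fin.last (n + 1))) := by
  funext k
  refine Fin.lastCases ?_ (fun k => ?_) k
  · rw [Function.update_self]
    have h0 : ¬ Fin.last (n + 1) < j := not_lt.2 (Fin.le_last j)
    simp only [contract, if_neg h0, Fin.succ_last, Function.update_self]
    rw [Function.update_of_ne (Fin.castSucc_ne_last _)]
    split_ifs
    · rw [mul_assoc]
    · rfl
  · rw [Function.update_of_ne (Fin.castSucc_ne_last _)]
    have h1 : k.castSucc.succ ≠ Fin.last (n + 2) := by
      rw [Fin.succ_castSucc]; exact Fin.castSucc_ne_last _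
    simp only [contract, Function.update_of_ne (Fin.castSucc_ne_last _),
      Function.update_of_ne h1]

/-- The exponent of the sign of the summand `j` of the differential. -/
def barSign {n : ℕ} (α : T.BarWord (n + 1)) (j : Fin (n + 2)) : ℤ :=
  α.lead.1.degree + if j = 0 then eps α 2 - 1 else eps α (j.val + 1)

theorem barDiff_word {n : ℕ} (α : T.BarWord (n + 1)) :
    T.barDiff K n (T.barBasis K (n + 1) α) = ∑ j : Fin (n + 2), (barSign α j).negOnePow •
      T.barLin K n (contract K j fun i => (α.tuple i).cls K) := by
  rw [barDiff, Module.Basis.constr_basis]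
  refine Finset.sum_congr rfl fun j _ => ?_
  rw [bar_eq_barLin]
  rfl

/-- The sums defining the signs stop at the factor `n`, so the leading factor, which has number `n +
1`, does not enter. -/
theorem eps_congr {n : ℕ} {α β : T.BarWord n} (h : ∀ j : Fin (n + 1),
    α.tuple j.castSucc = β.tuple j.castSucc) (i : ℕ) : eps α i = eps β i := by
  refine Finset.sum_congr rfl fun j hj => ?_
  rw [BarWord.path_eq, BarWord.path_eq]
  revert hj
  refine Fin.lastCases (fun hj => ?_) (fun j _ => by rw [h j]) j
  simp at hj

/-- The leading factor enters each summand only as a left multiplication and through its degree in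
the sign, the same for all summands. -/
theorem barDiff_gen {n : ℕ} (α : T.BarWord (n + 1)) :
    T.barDiff K n (T.barBasis K (n + 1) α) = α.lead.1.degree.negOnePow •
      T.barLeft K n (α.lead.cls K) (T.barDiff K n (T.barBasis K (n + 1) α.gen)) := by
  rw [barDiff_word, barDiff_word, map_sum, Finset.smul_sum]
  refine Finset.sum_congr rfl fun j _ => ?_
  rw [map_sign_smul, barLeft_barLin, ← contract_update, smul_smul, ← Int.negOnePow_add]
  congr 2
  · rw [barSign, barSign, eps_congr (β := α) (α := α.gen), eps_congr (β := α) (α := α.gen)]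
    · rw [BarWord.gen_lead, Bp.triv_degree, zero_add]
    all_goals
      intro k
      rw [BarWord.gen_tuple, Function.update_of_ne (Fin.castSucc_ne_last _)]
  · congr 1
    funext i
    refine Fin.lastCases ?_ (fun i => ?_) i
    · rw [Function.update_self, BarWord.gen_tuple, Function.update_self,
        Bp.cls_triv, Bp.cls_mul_idem_src]
      rfl
    · rw [Function.update_of_ne (Fin.castSucc_ne_last _), BarWord.gen_tuple,
        Function.update_of_ne (Fin.castSucc_ne_last _)]

theorem shift_cls {n : ℕ} (α : T.BarWord n) (h : α.lead.1.arrows ≠ []) :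
    (fun i => ((α.shift h).tuple i).cls K) = Fin.snoc (α := fun _ => T.Alg K)
      (fun j => (α.tuple j).cls K) (T.idem K α.lead.1.tgt) := by
  funext i
  refine Fin.lastCases ?_ (fun i => ?_) i
  · rw [BarWord.shift_tuple, Fin.snoc_last, Fin.snoc_last]; rfl
  · rw [BarWord.shift_tuple, Fin.snoc_castSucc, Fin.snoc_castSucc]

theorem barLin_snoc_idem {n : ℕ} (x : Fin (n + 2) → T.Alg K) (v : V)
    (hx : T.idem K v * x (Fin.last (n + 1)) = x (Fin.last (n + 1))) :
    T.barLin K (n + 1) (Fin.snoc (α := fun _ => T.Alg K) x (T.idem K v)) =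
      T.barLin K (n + 1) (Fin.snoc (α := fun _ => T.Alg K) x 1) := by
  have := barLin_idem_last K (Fin.snoc (α := fun _ => T.Alg K) x 1) v
    (by rw [Fin.snoc_castSucc, hx])
  rwa [Fin.update_snoc_last, Fin.update_snoc_last] at this

theorem barLin_zero_idem (a : T.Alg K) (v : V) (ha : T.idem K v * a = a) :
    T.barLin K 0 ![a, T.idem K v] = T.barLin K 0 ![a, 1] := by
  convert barLin_idem_last K ![a, 1] v ha using 2 <;>
  · funext j
    fin_cases j <;> simp [Function.update]

theorem barContr_word {n : ℕ} (α : T.BarWord n) (h : α.lead.1.arrows ≠ []) :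
    T.barContr K n (T.barBasis K n α) = T.barBasis K (n + 1) (α.shift h) := by
  rw [barBasis_eq, barBasis_eq, shift_cls, barContr_barLin]
  exact (barLin_snoc_idem K _ _ (Bp.idem_tgt_mul_cls K _)).symm

theorem contract_last_snoc {n : ℕ} (x : Fin (n + 2) → T.Alg K) (e : T.Alg K)
    (he : e * x (Fin.last (n + 1)) = x (Fin.last (n + 1))) :
    contract K (Fin.last (n + 1)) (Fin.snoc (α := fun _ => T.Alg K) x e) = x := by
  funext k
  refine Fin.lastCases ?_ (fun k => ?_) k
  · simp only [contract, lt_irrefl, if_false, if_true]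
    rw [Fin.succ_last, Fin.snoc_last, Fin.snoc_castSucc, he]
  · rw [contract, if_pos (Fin.castSucc_lt_last k), Fin.snoc_castSucc]

theorem contract_castSucc_snoc {n : ℕ} (j : Fin (n + 2)) (x : Fin (n + 3) → T.Alg K)
    (e : T.Alg K) :
    contract K j.castSucc (Fin.snoc (α := fun _ => T.Alg K) x e) =
      Fin.snoc (α := fun _ => T.Alg K) (contract K j x) e := by
  funext k
  refine Fin.lastCases ?_ (fun k => ?_) k
  · rw [contract, if_neg (not_lt.2 (Fin.le_last _)), if_neg (Fin.castSucc_ne_last j).symm,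
      Fin.succ_last, Fin.snoc_last, Fin.snoc_last]
  · simp only [contract, Fin.snoc_castSucc, Fin.succ_castSucc, Fin.castSucc_lt_castSucc_iff,
      Fin.castSucc_inj]

/-- After the contraction the old leading factor is an inner factor and contributes its degree minus
one. -/
theorem eps_shift {n : ℕ} (α : T.BarWord n) (h : α.lead.1.arrows ≠ []) {i : ℕ}
    (hi : i ≤ n + 1) : eps (α.shift h) i = eps α i + (α.lead.1.degree - 1) := by
  have hlast : ¬(i ≤ n + 1 + 1 ∧ n + 1 + 1 ≤ n + 1) := by omega
  have hlast' : ¬(i ≤ n + 1 ∧ n + 1 ≤ n) := by omega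
  have hlast'' : i ≤ n + 1 ∧ n + 1 ≤ n + 1 := by omega
  simp only [eps, Finset.sum_filter]
  rw [Fin.sum_univ_castSucc, Fin.sum_univ_castSucc]
  conv_rhs => rw [Fin.sum_univ_castSucc]
  simp only [Fin.val_last, Fin.val_castSucc, if_neg hlast, if_neg hlast', if_pos hlast'',
    BarWord.path_eq, BarWord.shift_tuple, Fin.snoc_castSucc, add_zero]
  congr 1
  refine Finset.sum_congr rfl fun j _ => ?_
  have := j.isLt
  exact if_congr (by omega) rfl rfl

/-- The new leading factor has degree `0` and the old one contributes its degree minus one instead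
of its degree. The exponent thus drops by one, and this is what makes `d s` and `s d` cancel. -/
theorem barSign_shift {n : ℕ} (α : T.BarWord (n + 1)) (h : α.lead.1.arrows ≠ [])
    (j : Fin (n + 2)) :
    (barSign (α.shift h) j.castSucc).negOnePow = -(barSign α j).negOnePow := by
  rw [← Int.negOnePow_succ, Int.negOnePow_eq_iff]
  have hd : (α.shift h).lead.1.degree = 0 := by rw [BarWord.shift_lead, Bp.triv_degree]
  rw [barSign, barSign, hd, eps_shift α h (by omega),
    eps_shift α h (by simp only [Fin.val_castSucc]; omega)]
  refine ⟨-1, ?_⟩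
  by_cases hj : j = 0
  · subst hj; simp; ring
  · have : j.castSucc ≠ 0 := fun h => hj (by simpa using h)
    rw [if_neg this, if_neg hj, Fin.val_castSucc]
    ring

theorem barSign_last {n : ℕ} (α : T.BarWord n) (h : α.lead.1.arrows ≠ []) :
    (barSign (α.shift h) (Fin.last (n + 1))).negOnePow = 1 := by
  have hd : (α.shift h).lead.1.degree = 0 := by rw [BarWord.shift_lead, Bp.triv_degree]
  have h0 : Fin.last (n + 1) ≠ 0 := by simp [Fin.ext_iff]
  rw [barSign, hd, if_neg h0, eps, Finset.sum_eq_zero]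
  · rfl
  · intro j hj
    have := (Finset.mem_filter.1 hj).2
    simp at this
    omega

theorem barDiff_barContr_zero (α : T.BarWord 0) :
    T.barDiff K 0 (T.barContr K 0 (T.barBasis K 0 α)) = T.barBasis K 0 α -
      T.barLin K 0 ![(α.tuple 1).cls K * (α.tuple 0).cls K, 1] := by
  -- For a trivial leading factor the contraction vanishes, and so does the right side because `e ⊗
  -- a = 1 ⊗ a` when `e a = a`. Otherwise there are two summands: one returns the word, the other is
  -- the unit term.
  by_cases h : α.lead.1.arrows = []
  · have e : (α.tuple 1).cls K = T.idem K (α.tuple 1).1.src := by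
      have := cls_eq_listProd_mul K (α.tuple 1).1
      rw [show (α.tuple 1).1.arrows = [] from h, listProd_nil, one_mul] at this
      exact this
    have ha : T.idem K (α.tuple 1).1.src * (α.tuple 0).cls K = (α.tuple 0).cls K := by
      rw [show (α.tuple 1).1.src = (α.tuple 0).1.tgt from (α.tuple_comp 0).symm]
      exact Bp.idem_tgt_mul_cls K _
    rw [barBasis_eq, barContr_eq_zero K (α.tuple 1).1.src e, map_zero, eq_comm, sub_eq_zero, e, ha,
      ← barLin_zero_idem K _ _ ha]
    congr 1
    funext j
    fin_cases j
    · rfl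
    · exact e
  · rw [barContr_word K α h, barDiff_word, Fin.sum_univ_castSucc, Fin.sum_univ_one, barSign_last,
      one_smul, add_comm, sub_eq_add_neg, shift_cls, contract_last_snoc K _ _
      (Bp.idem_tgt_mul_cls K _), ← barBasis_eq]
    congr 1
    -- The summand `j = 0` has exponent `ε_{2,1} - 1` with an empty sum.
    have hs : barSign (α.shift h) (0 : Fin 1).castSucc = -1 := by
      rw [barSign, BarWord.shift_lead, Bp.triv_degree, if_pos (by rfl), eps, Finset.sum_eq_zero]
      · rfl
      · intro j hj
        have := (Finset.mem_filter.1 hj).2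
        omega
    rw [hs, Int.negOnePow_neg, Int.negOnePow_one, Units.neg_smul, one_smul, neg_inj,
      ← barLin_zero_idem K _ α.lead.1.tgt]
    · congr 1
      funext j
      fin_cases j <;> rfl
    · rw [← mul_assoc]
      congr 1
      exact Bp.idem_tgt_mul_cls K _

/-- All summands of the differential but the last keep an idempotent as leading factor and are
killed; the last one removes the idempotent, and the contraction puts it back. -/
theorem barContr_barDiff_shift {n : ℕ} (α : T.BarWord n) (h : α.lead.1.arrows ≠ []) :
    T.barContr K n (T.barDiff K n (T.barBasis K (n + 1) (α.shift h))) =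
      T.barBasis K (n + 1) (α.shift h) := by
  rw [barDiff_word, Fin.sum_univ_castSucc, map_add, map_sum, shift_cls, barSign_last, one_smul,
    contract_last_snoc K _ _ (Bp.idem_tgt_mul_cls K _), ← barBasis_eq, barContr_word K α h,
    add_eq_right]
  refine Finset.sum_eq_zero fun j _ => ?_
  rw [map_sign_smul, barContr_eq_zero K α.lead.1.tgt, smul_zero]
  rw [contract, if_neg (not_lt.2 (Fin.le_last _)), if_neg (Fin.castSucc_ne_last j).symm,
      Fin.succ_last, Fin.snoc_last]

theorem barDiff_barContr_succ {n : ℕ} (α : T.BarWord (n + 1)) :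
    T.barDiff K (n + 1) (T.barContr K (n + 1) (T.barBasis K (n + 1) α)) +
      T.barContr K n (T.barDiff K n (T.barBasis K (n + 1) α)) = T.barBasis K (n + 1) α := by
  -- If the leading factor is trivial, then `s` kills the word, which is itself a contraction, so
  -- that `s d` fixes it. Otherwise the last summand of `d s` is the word, and the others cancel one
  -- by one against `s d`.
  by_cases h : α.lead.1.arrows = []
  · rw [← BarWord.gen_of_lead h, BarWord.gen_eq_shift, barContr_barDiff_shift, add_eq_right,
      barBasis_eq, shift_cls, barContr_eq_zero K _ (Fin.snoc_last _ _), map_zero]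
  · rw [barContr_word K α h, barDiff_word, Fin.sum_univ_castSucc, barSign_last, one_smul,
      shift_cls, contract_last_snoc K _ _ (Bp.idem_tgt_mul_cls K _), ← barBasis_eq, barDiff_word,
      map_sum, add_right_comm, ← Finset.sum_add_distrib, add_eq_right]
    refine Finset.sum_eq_zero fun j _ => ?_
    rw [barSign_shift, contract_castSucc_snoc, map_sign_smul, barContr_barLin, Units.neg_smul,
      barLin_snoc_idem, neg_add_cancel]
    simp only [contract, if_neg (not_lt.2 (Fin.le_last j)), Fin.succ_last]
    split_ifs
    · rw [← mul_assoc]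
      congr 1
      exact Bp.idem_tgt_mul_cls K _
    · exact Bp.idem_tgt_mul_cls K _

/-! ### The bar resolution as a contracted complex -/

variable (T) in
/-- `(x_1, x_0) ↦ x_1 x_0`. -/
def mulPair : MultilinearMap K (fun _ : Fin 2 => T.Alg K) (T.Alg K) where
  toFun x := x 1 * x 0
  map_update_add' x i a b := by
    fin_cases i <;> simp [add_mul, mul_add]
  map_update_smul' x i c a := by
    fin_cases i <;> simp

theorem barAug_barLin (x : Fin 2 → T.Alg K) : T.barAug K (T.barLin K 0 x) = x 1 * x 0 := by
  refine apply_barLin K (T.barAug K) (T.mulPair K) ?_ ?_ ?_ x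
  · intro α
    rw [barAug, Module.Basis.constr_basis]
    rfl
  · intro b i hi
    exact absurd (by fin_cases i; exacts [Or.inl rfl, Or.inr rfl]) hi
  · intro b j hj
    obtain rfl : j = 0 := Subsingleton.elim (α := Fin 1) _ _
    exact T.cls_mul_ne K _ _ hj.symm

theorem barAug_word (α : T.BarWord 0) :
    T.barAug K (T.barBasis K 0 α) = (α.tuple 1).cls K * (α.tuple 0).cls K := by
  rw [barBasis_eq, barAug_barLin]

theorem barAug_barLeft (a : T.Alg K) (x : T.Bar K 0) :
    T.barAug K (T.barLeft K 0 a x) = a * T.barAug K x := by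
  refine LinearMap.congr_fun (f := T.barAug K ∘ₗ T.barLeft K 0 a)
    (g := LinearMap.mulLeft K a ∘ₗ T.barAug K) ((T.barBasis K 0).ext fun α => ?_) x
  rw [LinearMap.comp_apply, LinearMap.comp_apply, LinearMap.mulLeft_apply, barBasis_eq,
    barLeft_barLin, barAug_barLin, barAug_barLin, ← mul_assoc]
  rfl

theorem barAug_barRight (a : T.Alg K) (x : T.Bar K 0) :
    T.barAug K (T.barRight K 0 a x) = T.barAug K x * a := by
  refine LinearMap.congr_fun (f := T.barAug K ∘ₗ T.barRight K 0 a)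
    (g := LinearMap.mulRight K a ∘ₗ T.barAug K) ((T.barBasis K 0).ext fun α => ?_) x
  rw [LinearMap.comp_apply, LinearMap.comp_apply, LinearMap.mulRight_apply, barBasis_eq,
    barRight_barLin, barAug_barLin, barAug_barLin, mul_assoc]
  rfl

variable (T) in
/-- `a ↦ 1 ⊗ a`. -/
def barUnit : T.Alg K →ₗ[K] T.Bar K 0 := (T.barLin K 0).toLinearMap ![0, 1] 0

theorem barUnit_apply (a : T.Alg K) : T.barUnit K a = T.barLin K 0 ![a, 1] := by
  refine congrArg (T.barLin K 0) ?_
  funext j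
  fin_cases j <;> simp

variable (T) in
/-- The contraction of `B(A, A, A)`. -/
def totBarContr : T.TotBar K →ₗ[K] T.TotBar K :=
  DirectSum.toModule K ℕ _ fun n => DirectSum.lof K ℕ (T.Bar K) (n + 1) ∘ₗ T.barContr K n

variable (T) in
/-- The left action of `A` on `B(A, A, A)`. -/
def totBarLeft : T.Alg K →ₗ[K] T.TotBar K →ₗ[K] T.TotBar K where
  toFun a := DirectSum.lmap fun n => T.barLeft K n a
  map_add' a b := DirectSum.linearMap_ext _ fun n => LinearMap.ext fun x => by
    have : T.barLeft K n (a + b) = T.barLeft K n a + T.barLeft K n b :=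
      map_add (T.barLeftLin K n) a b
    simp [DirectSum.lmap_lof, this]
  map_smul' c a := DirectSum.linearMap_ext _ fun n => LinearMap.ext fun x => by
    have : T.barLeft K n (c • a) = c • T.barLeft K n a := map_smul (T.barLeftLin K n) c a
    simp [DirectSum.lmap_lof, this]

variable (T) in
/-- The right multiplications on `B(A, A, A)`. -/
def totBarRight (b : T.Alg K) : T.TotBar K →ₗ[K] T.TotBar K :=
  DirectSum.lmap fun n => T.barRight K n b

theorem totBarContr_lof (n : ℕ) (x : T.Bar K n) :
    T.totBarContr K (DirectSum.lof K ℕ (T.Bar K) n x) =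
      DirectSum.lof K ℕ (T.Bar K) (n + 1) (T.barContr K n x) := by
  rw [totBarContr, DirectSum.toModule_lof, LinearMap.comp_apply]

theorem totBarLeft_lof (a : T.Alg K) (n : ℕ) (x : T.Bar K n) :
    T.totBarLeft K a (DirectSum.lof K ℕ (T.Bar K) n x) =
      DirectSum.lof K ℕ (T.Bar K) n (T.barLeft K n a x) := DirectSum.lmap_lof _ _ _

theorem totBarRight_lof (a : T.Alg K) (n : ℕ) (x : T.Bar K n) :
    T.totBarRight K a (DirectSum.lof K ℕ (T.Bar K) n x) =
      DirectSum.lof K ℕ (T.Bar K) n (T.barRight K n a x) := DirectSum.lmap_lof _ _ _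

theorem totBarDiff_lof_zero (x : T.Bar K 0) :
    T.totBarDiff K (DirectSum.lof K ℕ (T.Bar K) 0 x) = 0 := by
  rw [totBarDiff, DirectSum.toModule_lof, LinearMap.zero_apply]

theorem totBarDiff_lof_succ (n : ℕ) (x : T.Bar K (n + 1)) :
    T.totBarDiff K (DirectSum.lof K ℕ (T.Bar K) (n + 1) x) =
      DirectSum.lof K ℕ (T.Bar K) n (T.barDiff K n x) := by
  rw [totBarDiff, DirectSum.toModule_lof, LinearMap.comp_apply]

theorem totBarAug_lof_zero (x : T.Bar K 0) :
    T.totBarAug K (DirectSum.lof K ℕ (T.Bar K) 0 x) = T.barAug K x := by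
  rw [totBarAug, DirectSum.toModule_lof]

theorem totBarAug_lof_succ (n : ℕ) (x : T.Bar K (n + 1)) :
    T.totBarAug K (DirectSum.lof K ℕ (T.Bar K) (n + 1) x) = 0 := by
  rw [totBarAug, DirectSum.toModule_lof, LinearMap.zero_apply]

theorem totBarAct_eq (a b : T.Alg K) (x : T.TotBar K) :
    T.totBarAct K a b x = T.totBarLeft K a (T.totBarRight K b x) := by
  refine LinearMap.congr_fun (f := T.totBarAct K a b)
    (g := T.totBarLeft K a ∘ₗ T.totBarRight K b) ?_ x
  refine DirectSum.linearMap_ext _ fun n => LinearMap.ext fun x => ?_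
  simp only [LinearMap.comp_apply, totBarRight_lof, totBarLeft_lof]
  exact DirectSum.lmap_lof _ _ _

theorem totBar_ext {M : Type*} [AddCommGroup M] [Module K M] {f g : T.TotBar K →ₗ[K] M}
    (h : ∀ (n : ℕ) (α : T.BarWord n), f (DirectSum.lof K ℕ (T.Bar K) n (T.barBasis K n α)) =
      g (DirectSum.lof K ℕ (T.Bar K) n (T.barBasis K n α))) : f = g :=
  DirectSum.linearMap_ext K fun n => (T.barBasis K n).ext (h n)

theorem span_lof_basis {X : ℕ → Type*} [∀ n, AddCommGroup (X n)] [∀ n, Module K (X n)]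
    {W : ℕ → Type*} (b : ∀ n, Module.Basis (W n) K (X n)) (n : ℕ) :
    Submodule.span K (Set.range fun α : W n => DirectSum.lof K ℕ X n (b n α)) =
      LinearMap.range (DirectSum.lof K ℕ X n) := by
  rw [LinearMap.range_eq_map, ← (b n).span_eq, Submodule.map_span, ← Set.range_comp]
  rfl

theorem iSup_range_lof {X : ℕ → Type*} [∀ n, AddCommGroup (X n)] [∀ n, Module K (X n)] :
    ⨆ n, LinearMap.range (DirectSum.lof K ℕ X n) = ⊤ := by
  refine eq_top_iff.2 fun x _ => ?_
  induction x using DirectSum.induction_on with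
  | zero => exact zero_mem _
  | of n x => exact Submodule.mem_iSup_of_mem n ⟨x, rfl⟩
  | add x y hx hy => exact add_mem (hx trivial) (hy trivial)

variable (T) in
/-- The bar resolution as a contracted complex. -/
def barComplex : ContractedComplex K T (T.TotBar K) where
  diff := T.totBarDiff K
  contr := T.totBarContr K
  aug := T.totBarAug K
  unit := DirectSum.lof K ℕ (T.Bar K) 0 ∘ₗ T.barUnit K
  act := T.totBarLeft K
  parity := 1
  Word := T.BarWord
  word {n} α := DirectSum.lof K ℕ (T.Bar K) n (T.barBasis K n α)
  gen {n} α := DirectSum.lof K ℕ (T.Bar K) n (T.barBasis K n α.gen)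
  lead α := α.lead
  act_mul a b x := by
    refine LinearMap.congr_fun (f := T.totBarLeft K (a * b))
      (g := T.totBarLeft K a ∘ₗ T.totBarLeft K b) (totBar_ext K fun n α => ?_) x
    simp only [LinearMap.comp_apply, totBarLeft_lof, barLeft_mul]
  word_eq {n} α := by
    rw [totBarLeft_lof, barBasis_eq, barBasis_eq, barLeft_barLin]
    congr 2
    funext i
    refine Fin.lastCases ?_ (fun i => ?_) i
    · rw [Function.update_self, BarWord.gen_tuple, Function.update_self, Bp.cls_triv,
        Bp.cls_mul_idem_src]
      rfl
    · rw [Function.update_of_ne (Fin.castSucc_ne_last _), BarWord.gen_tuple,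
        Function.update_of_ne (Fin.castSucc_ne_last _)]
  change_lead α p hp := ⟨α.setLead p hp, α.setLead_lead p hp, by rw [BarWord.gen_setLead]⟩
  gen_eq_word α := ⟨α.gen, rfl, by rw [BarWord.gen_gen]⟩
  span_word := by
    rw [← iSup_range_lof K]
    exact iSup_congr fun n => span_lof_basis K (T.barBasis K) n
  contr_gen {n} α := by
    rw [totBarContr_lof, barBasis_eq, barContr_eq_zero K α.lead.1.src, map_zero]
    rw [BarWord.gen_tuple, Function.update_self]
    rfl
  homotopy x := by
    refine LinearMap.congr_fun (f := T.totBarDiff K ∘ₗ T.totBarContr K +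
      T.totBarContr K ∘ₗ T.totBarDiff K) (g := LinearMap.id -
        (DirectSum.lof K ℕ (T.Bar K) 0 ∘ₗ T.barUnit K) ∘ₗ T.totBarAug K)
      (totBar_ext K fun n α => ?_) x
    simp only [LinearMap.add_apply, LinearMap.sub_apply, LinearMap.comp_apply,
      LinearMap.id_apply, totBarContr_lof, totBarDiff_lof_succ]
    cases n with
    | zero =>
      rw [totBarDiff_lof_zero, totBarAug_lof_zero, map_zero, add_zero, barAug_word,
        barDiff_barContr_zero, map_sub, barUnit_apply]
    | succ n =>
      rw [totBarDiff_lof_succ, totBarAug_lof_succ, totBarContr_lof, ← map_add,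
        barDiff_barContr_succ, map_zero, map_zero, sub_zero]
  aug_contr x := by
    refine LinearMap.congr_fun (f := T.totBarAug K ∘ₗ T.totBarContr K) (g := 0)
      (totBar_ext K fun n α => ?_) x
    rw [LinearMap.comp_apply, totBarContr_lof, totBarAug_lof_succ, LinearMap.zero_apply]
  aug_unit a := by
    rw [LinearMap.comp_apply, totBarAug_lof_zero, barUnit_apply, barAug_barLin]
    exact one_mul a
  aug_act a x := by
    refine LinearMap.congr_fun (f := T.totBarAug K ∘ₗ T.totBarLeft K a)
      (g := LinearMap.mulLeft K a ∘ₗ T.totBarAug K) (totBar_ext K fun n α => ?_) x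
    simp only [LinearMap.comp_apply, totBarLeft_lof, LinearMap.mulLeft_apply]
    cases n with
    | zero => rw [totBarAug_lof_zero, totBarAug_lof_zero, barAug_barLeft]
    | succ n => rw [totBarAug_lof_succ, totBarAug_lof_succ, mul_zero]
  aug_gen α := totBarAug_lof_succ K _ _
  diff_unit a := totBarDiff_lof_zero K _
  diff_zero α := totBarDiff_lof_zero K _
  diff_succ {n} α := by
    rw [totBarDiff_lof_succ, span_lof_basis K (T.barBasis K) n]
    exact ⟨_, rfl⟩
  diff_word {n} α := by
    cases n with
    | zero => rw [totBarDiff_lof_zero, totBarDiff_lof_zero, map_zero, smul_zero]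
    | succ n =>
      rw [totBarDiff_lof_succ, totBarDiff_lof_succ, totBarLeft_lof, ← map_sign_smul, one_mul,
        ← barDiff_gen]

theorem barComplex_level (n : ℕ) :
    (T.barComplex K).level n = LinearMap.range (DirectSum.lof K ℕ (T.Bar K) n) :=
  span_lof_basis K (T.barBasis K) n

theorem word_mem_genSpan {n : ℕ} (α : T.BarWord n) (h : α.lead.1.arrows = []) :
    DirectSum.lof K ℕ (T.Bar K) n (T.barBasis K n α) ∈ (T.barComplex K).genSpan n := by
  have : DirectSum.lof K ℕ (T.Bar K) n (T.barBasis K n α.gen) ∈ (T.barComplex K).genSpan n :=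
    Submodule.subset_span ⟨α, rfl⟩
  rwa [BarWord.gen_of_lead h] at this

/-- The contraction of a word is zero or a word with idempotent leading factor, which the idempotent
of a vertex fixes or kills. -/
theorem idem_mul_barContr_mem_genSpan {n : ℕ} (x : T.Bar K n) (v : V) :
    DirectSum.lof K ℕ (T.Bar K) (n + 1) (T.barLeft K (n + 1) (T.idem K v) (T.barContr K n x)) ∈
      (T.barComplex K).genSpan (n + 1) := by
  rw [← (T.barBasis K n).linearCombination_repr x]
  induction (T.barBasis K n).repr x using Finsupp.induction_linear with
  | zero => simp
  | add a b ha hb => simp only [map_add]; exact add_mem ha hb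
  | single α c =>
    simp only [Finsupp.linearCombination_single, map_smul]
    refine Submodule.smul_mem _ c ?_
    by_cases h : α.lead.1.arrows = []
    · have : T.barContr K n (T.barBasis K n α) = 0 := by
        rw [barBasis_eq]
        refine barContr_eq_zero K α.lead.1.src ?_
        exact congrArg (Bp.cls K) (Bp.eq_triv h)
      rw [this, map_zero, map_zero]
      exact zero_mem _
    · by_cases hv : α.lead.1.tgt = v
      · have : T.barLeft K (n + 1) (T.idem K v) (T.barBasis K (n + 1) (α.shift h)) =
            T.barBasis K (n + 1) (α.shift h) := by
          rw [barBasis_eq, barLeft_barLin]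
          congr 1
          refine Function.update_eq_self_iff.2 ?_
          have := Bp.idem_tgt_mul_cls K (α.shift h).lead
          rw [BarWord.shift_lead] at this
          rw [← hv]
          change _ * (α.shift h).lead.cls K = (α.shift h).lead.cls K
          rw [BarWord.shift_lead]
          exact this
        rw [barContr_word K α h, this]
        refine word_mem_genSpan K _ ?_
        rw [BarWord.shift_lead]
        rfl
      · rw [barContr_word K α h, barBasis_eq, barLeft_barLin, MultilinearMap.map_coord_zero _
          (Fin.last (n + 2)), map_zero]
        · exact zero_mem _
        · rw [Function.update_self]
          change _ * (α.shift h).lead.cls K = 0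
          rw [BarWord.shift_lead]
          exact Bp.idem_mul_cls_ne K _ hv

/-- A tensor with trivial leading factor is in the span of the generators. -/
theorem barLin_mem_genSpan {n : ℕ} (x : Fin (n + 2) → T.Alg K) (v : V)
    (hx : x (Fin.last (n + 1)) = T.idem K v) :
    DirectSum.lof K ℕ (T.Bar K) n (T.barLin K n x) ∈ (T.barComplex K).genSpan n := by
  cases n with
  | succ n =>
    -- A tensor with leading factor `e_v` is `e_v` times the contraction of the remaining factors.
    -- In length `0` the remainder is not a bar tensor, and the right factor is expanded in `𝓑`
    -- instead.
    rw [← Fin.snoc_init_self x, hx, barLin_snoc]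
    exact idem_mul_barContr_mem_genSpan K _ v
  | zero =>
    have e : ∀ a, (T.barLin K 0).toLinearMap ![0, T.idem K v] 0 a =
        T.barLin K 0 ![a, T.idem K v] := by
      intro a
      refine congrArg (T.barLin K 0) ?_
      funext j
      fin_cases j <;> simp
    have e' : x = ![x 0, T.idem K v] := by
      funext j
      fin_cases j
      · rfl
      · exact hx
    rw [e', ← e, ← (T.basis K).linearCombination_repr (x 0)]
    induction (T.basis K).repr (x 0) using Finsupp.induction_linear with
    | zero => simp
    | add a b ha hb => simp only [map_add]; exact add_mem ha hb
    | single p c =>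
      simp only [Finsupp.linearCombination_single, map_smul]
      refine Submodule.smul_mem _ c ?_
      rw [e, basis_apply]
      by_cases hv : p.1.tgt = v
      · have := word_mem_genSpan K (BarWord.mk (n := 0) ![p, Bp.triv T v]
          (fun i hi => absurd (by fin_cases i; exacts [Or.inl rfl, Or.inr rfl]) hi)
          (fun j => by
            obtain rfl : j = 0 := Subsingleton.elim (α := Fin 1) _ _
            exact hv)) rfl
        rw [barBasis_eq] at this
        convert this using 3
        funext j
        fin_cases j <;> rfl
      · rw [barLin_eq_zero K 0 v, map_zero]
        · exact zero_mem _
        · exact Bp.cls_mul_idem_src K (Bp.triv T v)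
        · exact Bp.idem_mul_cls_ne K p hv

theorem isRightMul_totBarRight (b : T.Alg K) : (T.barComplex K).IsRightMul (T.totBarRight K b)
    (LinearMap.mulRight K b) where
  act a x := by
    refine LinearMap.congr_fun (f := T.totBarRight K b ∘ₗ T.totBarLeft K a)
      (g := T.totBarLeft K a ∘ₗ T.totBarRight K b) (totBar_ext K fun n α => ?_) x
    simp only [LinearMap.comp_apply, totBarLeft_lof, totBarRight_lof, barRight_barLeft]
  contr x := by
    refine LinearMap.congr_fun (f := T.totBarRight K b ∘ₗ T.totBarContr K)
      (g := T.totBarContr K ∘ₗ T.totBarRight K b) (totBar_ext K fun n α => ?_) x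
    simp only [LinearMap.comp_apply, totBarContr_lof, totBarRight_lof, barRight_barContr]
  unit a := by
    refine (totBarRight_lof K b 0 _).trans (congrArg _ ?_)
    rw [barUnit_apply, barRight_barLin, LinearMap.mulRight_apply, barUnit_apply]
    congr 1
    funext j
    fin_cases j <;> simp
  aug x := by
    refine LinearMap.congr_fun (f := T.totBarAug K ∘ₗ T.totBarRight K b)
      (g := LinearMap.mulRight K b ∘ₗ T.totBarAug K) (totBar_ext K fun n α => ?_) x
    simp only [LinearMap.comp_apply, totBarRight_lof, LinearMap.mulRight_apply]
    cases n with
    | zero => rw [totBarAug_lof_zero, totBarAug_lof_zero, barAug_barRight]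
    | succ n => rw [totBarAug_lof_succ, totBarAug_lof_succ, zero_mul]
  gen n α := by
    refine (congrArg (· ∈ (T.barComplex K).genSpan n) (totBarRight_lof K b n _)).mpr ?_
    rw [barBasis_eq, barRight_barLin]
    refine barLin_mem_genSpan K _ (BarWord.lead α).1.src ?_
    -- The factors `0` and `n + 1` are distinct, so right multiplication leaves the leading
    -- idempotent in place.
    rw [Function.update_of_ne (by simp [Fin.ext_iff])]
    exact congrArg (Bp.cls K) (BarWord.gen_lead (T := T) α)

/-! ### Tensors in the CS-resolution -/

variable (T) in
/-- `a ⊗ q ⊗ b` as a bilinear function of `a` and `b`. -/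
def csLin (n : ℕ) (q : T.Gam n) : T.Alg K →ₗ[K] T.Alg K →ₗ[K] T.CS K n :=
  ((TensorProduct.mk K _ _) ∘ₗ
    ((TensorProduct.mk K (T.Alg K) (T.Gam n →₀ K)).flip (Finsupp.single q 1))).compr₂
    (Submodule.mkQ (⨆ k, LinearMap.range (T.csRel K n k)))

theorem csLin_apply (n : ℕ) (q : T.Gam n) (a b : T.Alg K) :
    T.csLin K n q a b = T.cs K n a q b := rfl

theorem cs_balance_left (n : ℕ) (q : T.Gam n) (a b : T.Alg K) (v : V) [Decidable (q.1.tgt = v)] :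
    T.cs K n (a * T.idem K v) q b = if q.1.tgt = v then T.cs K n a q b else 0 := by
  have h : T.cs K n (a * T.idem K v) q b = Submodule.Quotient.mk
      (p := ⨆ k, LinearMap.range (T.csRel K n k))
      (T.preCSMap K n LinearMap.id (T.gamLeft K n v) LinearMap.id (T.preCS K n a q b)) := by
    refine (Submodule.Quotient.eq _).2 (Submodule.mem_iSup_of_mem (Sum.inl v) ?_)
    refine ⟨T.preCS K n a q b, ?_⟩
    rw [csRel, LinearMap.sub_apply]
    rfl
  rw [h, preCSMap_smul K n _ _ _ _ _ _ 1 (if q.1.tgt = v then 1 else 0) 1 (by simp)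
    (by simp [gamLeft]) (by simp)]
  split_ifs
  · simp only [mul_one, one_smul]; rfl
  · simp only [mul_zero, zero_mul, zero_smul]; rfl

theorem cs_balance_right (n : ℕ) (q : T.Gam n) (a b : T.Alg K) (v : V) [Decidable (q.1.src = v)] :
    T.cs K n a q (T.idem K v * b) = if q.1.src = v then T.cs K n a q b else 0 := by
  have h : T.cs K n a q (T.idem K v * b) = Submodule.Quotient.mk
      (p := ⨆ k, LinearMap.range (T.csRel K n k))
      (T.preCSMap K n LinearMap.id (T.gamRight K n v) LinearMap.id (T.preCS K n a q b)) := by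
    refine ((Submodule.Quotient.eq _).2 (Submodule.mem_iSup_of_mem (Sum.inr v) ?_)).symm
    refine ⟨T.preCS K n a q b, ?_⟩
    rw [csRel, LinearMap.sub_apply]
    rfl
  rw [h, preCSMap_smul K n _ _ _ _ _ _ 1 (if q.1.src = v then 1 else 0) 1 (by simp)
    (by simp [gamRight]) (by simp)]
  split_ifs
  · simp only [mul_one, one_smul]; rfl
  · simp only [mul_zero, zero_mul, zero_smul]; rfl

theorem cs_mul_idem_tgt {n : ℕ} (q : T.Gam n) (a b : T.Alg K) :
    T.cs K n (a * T.idem K q.1.tgt) q b = T.cs K n a q b := by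
  classical rw [cs_balance_left, if_pos rfl]

theorem cs_eq_zero_left {n : ℕ} {q : T.Gam n} (p : T.Bp) (h : p.1.src ≠ q.1.tgt) (b : T.Alg K) :
    T.cs K n (p.cls K) q b = 0 := by
  classical
  rw [← Bp.cls_mul_idem_src, cs_balance_left, if_neg h.symm]

theorem cs_eq_zero_right {n : ℕ} {q : T.Gam n} (r : T.Bp) (h : q.1.src ≠ r.1.tgt) (a : T.Alg K) :
    T.cs K n a q (r.cls K) = 0 := by
  classical
  rw [← Bp.idem_tgt_mul_cls, cs_balance_right, if_neg h]

theorem cs_cls_eq {n : ℕ} {q : T.Gam n} {p : T.Bp} (h : p.1.src = q.1.tgt) (b : T.Alg K) :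
    T.cs K n (p.cls K) q b = T.cs K n (T.listProd K p.1.arrows) q b := by
  rw [Bp.cls, cls_eq_listProd_mul, h, cs_mul_idem_tgt]

@[simp] theorem cs_zero_left {n : ℕ} (q : T.Gam n) (b : T.Alg K) : T.cs K n 0 q b = 0 := by
  rw [← csLin_apply, map_zero, LinearMap.zero_apply]

/-- A linear map on `A ⊗_E K Γ_n ⊗_E A` agrees with a family of bilinear maps if it does so on
words and the bilinear maps vanish on the triples that are not words. -/
theorem apply_cs {n : ℕ} {M : Type*} [AddCommGroup M] [Module K M] (φ : T.CS K n →ₗ[K] M)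
    (f : T.Gam n → T.Alg K →ₗ[K] T.Alg K →ₗ[K] M)
    (hw : ∀ (p : T.Bp) (q : T.Gam n) (r : T.Bp) (hl : p.1.src = q.1.tgt) (hr : q.1.src = r.1.tgt),
      φ (T.csBasis K n ⟨((p, q), r), hl, hr⟩) = f q (p.cls K) (r.cls K))
    (hl : ∀ (p : T.Bp) (q : T.Gam n) (r : T.Bp), p.1.src ≠ q.1.tgt →
      f q (p.cls K) (r.cls K) = 0)
    (hr : ∀ (p : T.Bp) (q : T.Gam n) (r : T.Bp), q.1.src ≠ r.1.tgt →
      f q (p.cls K) (r.cls K) = 0)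
    (a : T.Alg K) (q : T.Gam n) (b : T.Alg K) : φ (T.cs K n a q b) = f q a b := by
  have : (T.csLin K n q).compr₂ φ = f q := by
    refine LinearMap.ext_basis (T.basis K) (T.basis K) fun p r => ?_
    rw [LinearMap.compr₂_apply, csLin_apply, basis_apply, basis_apply]
    by_cases h1 : p.1.src = q.1.tgt
    · by_cases h2 : q.1.src = r.1.tgt
      · rw [← hw p q r h1 h2, csBasis_apply]
      · rw [cs_eq_zero_right K r h2, map_zero, hr p q r h2]
    · rw [cs_eq_zero_left K p h1, map_zero, hl p q r h1]
  exact LinearMap.congr_fun₂ this a b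

theorem csLeft_cs {n : ℕ} (c a : T.Alg K) (q : T.Gam n) (b : T.Alg K) :
    T.csLeft K n c (T.cs K n a q b) = T.cs K n (c * a) q b := by
  refine apply_cs K (T.csLeft K n c) (fun q => T.csLin K n q ∘ₗ LinearMap.mulLeft K c)
    ?_ ?_ ?_ a q b
  · intro p q r hl hr
    rw [csLeft, Module.Basis.constr_basis]
    rfl
  · intro p q r h
    rw [LinearMap.comp_apply, LinearMap.mulLeft_apply, csLin_apply, ← csLin_apply,
      ← Bp.cls_mul_idem_src, ← mul_assoc, csLin_apply]
    classical rw [cs_balance_left, if_neg h.symm]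
  · intro p q r h
    exact cs_eq_zero_right K r h _

theorem csRight_cs {n : ℕ} (c a : T.Alg K) (q : T.Gam n) (b : T.Alg K) :
    T.csRight K n c (T.cs K n a q b) = T.cs K n a q (b * c) := by
  refine apply_cs K (T.csRight K n c)
    (fun q => (T.csLin K n q).compl₂ (LinearMap.mulRight K c)) ?_ ?_ ?_ a q b
  · intro p q r hl hr
    rw [csRight, Module.Basis.constr_basis]
    rfl
  · intro p q r h
    exact cs_eq_zero_left K p h _
  · intro p q r h
    rw [LinearMap.compl₂_apply, LinearMap.mulRight_apply, csLin_apply, ← Bp.idem_tgt_mul_cls K r,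
      mul_assoc]
    classical rw [cs_balance_right, if_neg h]

theorem csAug_cs (a : T.Alg K) (q : T.Gam 0) (b : T.Alg K) :
    T.csAug K (T.cs K 0 a q b) = a * T.cls K q.1 * b := by
  refine apply_cs K (T.csAug K) (fun q => (LinearMap.mul K (T.Alg K)) ∘ₗ
    LinearMap.mulRight K (T.cls K q.1)) ?_ ?_ ?_ a q b
  · intro p q r hl hr
    rw [csAug, Module.Basis.constr_basis]
    rfl
  · intro p q r h
    change p.cls K * T.cls K q.1 * r.cls K = 0
    rw [Bp.cls, T.cls_mul_ne K _ _ h, zero_mul]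
  · intro p q r h
    change p.cls K * T.cls K q.1 * r.cls K = 0
    rw [mul_assoc, Bp.cls, Bp.cls, T.cls_mul_ne K _ _ h, mul_zero]

theorem cs_ext {n : ℕ} {M : Type*} [AddCommGroup M] [Module K M] {f g : T.CS K n →ₗ[K] M}
    (h : ∀ (p : T.Bp) (q : T.Gam n) (r : T.Bp), p.1.src = q.1.tgt → q.1.src = r.1.tgt →
      f (T.cs K n (p.cls K) q (r.cls K)) = g (T.cs K n (p.cls K) q (r.cls K))) : f = g := by
  refine (T.csBasis K n).ext fun x => ?_
  rw [csBasis_apply]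
  exact h _ _ _ x.2.1 x.2.2

theorem csLeft_mul {n : ℕ} (a b : T.Alg K) (x : T.CS K n) :
    T.csLeft K n (a * b) x = T.csLeft K n a (T.csLeft K n b x) := by
  refine LinearMap.congr_fun (f := T.csLeft K n (a * b))
    (g := T.csLeft K n a ∘ₗ T.csLeft K n b) (cs_ext K fun p q r _ _ => ?_) x
  rw [LinearMap.comp_apply, csLeft_cs, csLeft_cs, csLeft_cs, mul_assoc]

theorem csRight_csLeft {n : ℕ} (a b : T.Alg K) (x : T.CS K n) :
    T.csRight K n b (T.csLeft K n a x) = T.csLeft K n a (T.csRight K n b x) := by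
  refine LinearMap.congr_fun (f := T.csRight K n b ∘ₗ T.csLeft K n a)
    (g := T.csLeft K n a ∘ₗ T.csRight K n b) (cs_ext K fun p q r _ _ => ?_) x
  rw [LinearMap.comp_apply, LinearMap.comp_apply, csLeft_cs, csRight_cs, csRight_cs, csLeft_cs]

/-! ### Paths in `Γ_n` -/

namespace Gam

theorem arrows_eq {n : ℕ} (q : T.Gam (n + 1)) : q.1.arrows = q.first :: q.tail.1.arrows :=
  (List.cons_head_tail q.ne_nil).symm

theorem arrows_eq' {n : ℕ} (q : T.Gam (n + 1)) : q.1.arrows = q.init.1.arrows ++ [q.last] :=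
  (List.dropLast_append_getLast q.ne_nil).symm

theorem tgt_eq {n : ℕ} (q : T.Gam (n + 1)) : q.1.tgt = T.t q.first := by
  have := q.1.isPath
  rw [q.arrows_eq] at this
  exact this.1.symm

theorem src_of_append {j i : V} {l : List Ar} {a : Ar} (h : T.Q.IsPath j (l ++ [a]) i) :
    i = T.s a := by
  induction l generalizing j with
  | nil => exact h.2.symm
  | cons b l ih => exact ih h.2

theorem src_eq {n : ℕ} (q : T.Gam (n + 1)) : q.1.src = T.s q.last := by
  have := q.1.isPath
  rw [q.arrows_eq'] at this
  exact src_of_append this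

theorem tail_tgt {n : ℕ} (q : T.Gam (n + 1)) : q.tail.1.tgt = T.s q.first := rfl

theorem tail_src {n : ℕ} (q : T.Gam (n + 1)) : q.tail.1.src = q.1.src := rfl

theorem init_tgt {n : ℕ} (q : T.Gam (n + 1)) : q.init.1.tgt = q.1.tgt := rfl

theorem init_src {n : ℕ} (q : T.Gam (n + 1)) : q.init.1.src = T.t q.last := rfl

/-- In positive length the arrows determine both end points; in length `0` the vertex would be extra
data. -/
theorem ext_arrows {n : ℕ} {q q' : T.Gam (n + 1)} (h : q.1.arrows = q'.1.arrows) : q = q' := by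
  have h1 : q.first = q'.first := by simp only [first, h]
  have h2 : q.last = q'.last := by simp only [last, h]
  exact Subtype.ext (GradedQuiver.Path.ext (by rw [tgt_eq, tgt_eq, h1]) h (by rw [src_eq, src_eq, h2]))

theorem ext_first_tail {n : ℕ} {q q' : T.Gam (n + 1)} (h : q.first = q'.first)
    (h' : q.tail = q'.tail) : q = q' :=
  ext_arrows (by rw [arrows_eq, arrows_eq, h, h'])

theorem eq_vertex (q : T.Gam 0) : q = vertex T q.1.tgt := by
  obtain ⟨⟨j, l, i, hl⟩, h0, hc⟩ := q
  obtain rfl : l = [] := List.length_eq_zero_iff.1 h0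
  cases hl
  rfl

theorem eq_arrow (q : T.Gam 1) : q = arrow T q.first := by
  refine ext_arrows ?_
  rw [q.arrows_eq, List.length_eq_zero_iff.1 q.tail.2.1]
  rfl

theorem last_eq_first (q : T.Gam 1) : q.last = q.first := by
  rw [q.eq_arrow]; rfl

theorem init_first {n : ℕ} (q : T.Gam (n + 2)) : q.init.first = q.first := by
  have h1 := q.arrows_eq
  rw [q.tail.arrows_eq] at h1
  have h2 : q.init.1.arrows = q.1.arrows.dropLast := rfl
  simp only [first, h2, List.head_dropLast]

theorem tail_last {n : ℕ} (q : T.Gam (n + 2)) : q.tail.last = q.last := by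
  have h2 : q.tail.1.arrows = q.1.arrows.tail := rfl
  simp only [last, h2, List.getLast_tail]

theorem tail_init {n : ℕ} (q : T.Gam (n + 2)) : q.tail.init = q.init.tail := by
  refine Subtype.ext (GradedQuiver.Path.ext ?_ ?_ ?_)
  · rw [init_tgt, tail_tgt, tail_tgt, init_first]
  · exact List.tail_dropLast.symm
  · rw [init_src, tail_src, init_src, tail_last]

theorem first_mem {n : ℕ} (q : T.Gam (n + 2)) : (q.first, q.tail.first) ∈ T.S := by
  have := q.2.2
  rw [q.arrows_eq, q.tail.arrows_eq] at this
  exact (List.isChain_cons_cons.1 this).1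

theorem exists_cons {n : ℕ} (a : Ar) (q : T.Gam (n + 1)) (h : (a, q.first) ∈ T.S) :
    ∃ γ : T.Gam (n + 2), γ.first = a ∧ γ.tail = q := by
  have hs : T.s a = T.t q.first := T.gentle.composable _ _ h
  have hp : T.Q.IsPath (T.s a) q.1.arrows q.1.src := by
    rw [hs, ← q.tgt_eq]; exact q.1.isPath
  refine ⟨⟨⟨T.t a, a :: q.1.arrows, q.1.src, rfl, hp⟩, by simp [q.2.1], ?_⟩, rfl, ?_⟩
  · change (a :: q.1.arrows).IsChain _
    have := q.2.2
    rw [q.arrows_eq] at this ⊢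
    exact List.isChain_cons_cons.2 ⟨h, this⟩
  · exact ext_arrows rfl

/-- Since `ε²` is in `S`, the gentle condition leaves `ε` as the only arrow that can follow `ε` in
an element of `Γ`. The path is therefore a power of `ε`. -/
theorem isSpecial_of_first {n : ℕ} (q : T.Gam (n + 1)) (h : q.first ∈ T.Sp) : q.IsSpecial := by
  refine ⟨q.first, h, ?_⟩
  have key : ∀ (l : List Ar) (e : Ar), e ∈ T.Sp →
      (e :: l).IsChain (fun b a => (b, a) ∈ T.S) → l = List.replicate l.length e := by
    intro l e he
    induction l with
    | nil => intro _; rfl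
    | cons b l ih =>
      intro hc
      obtain ⟨h1, h2⟩ := List.isChain_cons_cons.1 hc
      obtain rfl : b = e := T.gentle.rel_right e h1 (Or.inr ⟨e, he, rfl⟩)
      rw [List.length_cons, List.replicate_succ, ← ih h2]
  have hc := q.2.2
  have hl := q.2.1
  rw [q.arrows_eq] at hc hl ⊢
  rw [key _ _ h hc]
  simp only [List.length_cons, Nat.add_right_cancel_iff] at hl
  rw [hl, List.replicate_succ]

theorem IsSpecial.first_mem {n : ℕ} {q : T.Gam (n + 1)} (h : q.IsSpecial) : q.first ∈ T.Sp := by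
  obtain ⟨e, he, h⟩ := h
  have : q.first = e := by simp [first, h]
  rwa [this]

theorem IsSpecial.tail_eq_init {n : ℕ} {q : T.Gam (n + 1)} (h : q.IsSpecial) :
    q.tail = q.init := by
  obtain ⟨e, he, h⟩ := h
  have h1 : q.first = e := by simp [first, h]
  have h2 : q.last = e := by simp [last, h]
  refine Subtype.ext (GradedQuiver.Path.ext ?_ ?_ ?_)
  · rw [tail_tgt, init_tgt, tgt_eq, h1, T.loop e he]
  · change q.1.arrows.tail = q.1.arrows.dropLast
    rw [h, List.tail_replicate, List.dropLast_replicate]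
  · rw [tail_src, init_src, src_eq, h2, T.loop e he]

theorem IsSpecial.last_eq_first {n : ℕ} {q : T.Gam (n + 1)} (h : q.IsSpecial) :
    q.last = q.first := by
  obtain ⟨e, he, h⟩ := h
  simp [last, first, h]

end Gam

theorem mem_S_cases {b a : Ar} (h : (b, a) ∈ T.S) : (b, a) ∈ T.R ∨ (b = a ∧ a ∈ T.Sp) := by
  rcases h with h | ⟨e, he, h⟩
  · exact Or.inl h
  · obtain ⟨rfl, rfl⟩ := Prod.mk.inj h
    exact Or.inr ⟨rfl, he⟩

theorem arr_eq_mul_idem (a : Ar) : T.arr K a * T.idem K (T.s a) = T.arr K a := by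
  classical
  have := cls_mul_idem K (T := T) (T.s a) (Path.single T.Q a)
  rwa [if_pos (by rfl)] at this

theorem idem_mul_arr (a : Ar) : T.idem K (T.t a) * T.arr K a = T.arr K a := by
  classical
  have := idem_mul_cls K (T := T) (T.t a) (Path.single T.Q a)
  rwa [if_pos (by rfl)] at this

open Classical in
theorem csDiff_cs {n : ℕ} (a : T.Alg K) (q : T.Gam (n + 1)) (b : T.Alg K) :
    T.csDiff K n (T.cs K (n + 1) a q b) = T.cs K n (a * T.arr K q.first) q.tail b +
      (-1 : K) ^ (n + 1) • T.cs K n a q.init (T.arr K q.last * b) -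
      if q.IsSpecial ∧ Even (n + 1) then T.cs K n a q.tail b else 0 := by
  have := apply_cs K (T.csDiff K n) (fun q => T.csLin K n q.tail ∘ₗ
      LinearMap.mulRight K (T.arr K q.first) + (-1 : K) ^ (n + 1) •
      (T.csLin K n q.init).compl₂ (LinearMap.mulLeft K (T.arr K q.last)) -
      if q.IsSpecial ∧ Even (n + 1) then T.csLin K n q.tail else 0) ?_ ?_ ?_ a q b
  · rw [this, LinearMap.sub_apply, LinearMap.sub_apply]
    split_ifs <;> rfl
  · intro p q r hl hr
    rw [csDiff, Module.Basis.constr_basis, LinearMap.sub_apply, LinearMap.sub_apply]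
    dsimp only
    split_ifs <;> rfl
  · intro p q r h
    have h1 : p.cls K * T.arr K q.first = 0 := by
      rw [← idem_mul_arr, ← mul_assoc, Bp.cls_mul_idem_ne K p (by rwa [← q.tgt_eq]), zero_mul]
    -- The extra summand keeps `p` next to `q.tail`, whose target is the target of `q` because the
    -- special arrow is a loop.
    have h2 : q.IsSpecial → p.1.src ≠ q.tail.1.tgt := by
      intro hq
      rwa [hq.tail_eq_init, Gam.init_tgt]
    rw [LinearMap.sub_apply, LinearMap.sub_apply, LinearMap.add_apply, LinearMap.add_apply,
      LinearMap.comp_apply, LinearMap.mulRight_apply, h1, map_zero, LinearMap.zero_apply, zero_add,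
      LinearMap.smul_apply, LinearMap.smul_apply, LinearMap.compl₂_apply, csLin_apply,
      cs_eq_zero_left K p (by rwa [Gam.init_tgt]), smul_zero, zero_sub, neg_eq_zero]
    split_ifs with hs
    · exact cs_eq_zero_left K p (h2 hs.1) _
    · rfl
  · intro p q r h
    have h1 : T.arr K q.last * r.cls K = 0 := by
      rw [← arr_eq_mul_idem, mul_assoc, Bp.idem_mul_cls_ne K r (by rw [← q.src_eq]; exact h.symm),
        mul_zero]
    rw [LinearMap.sub_apply, LinearMap.sub_apply, LinearMap.add_apply, LinearMap.add_apply,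
      LinearMap.comp_apply, csLin_apply, cs_eq_zero_right K r (by rwa [Gam.tail_src]), zero_add,
      LinearMap.smul_apply, LinearMap.smul_apply, LinearMap.compl₂_apply, LinearMap.mulLeft_apply,
      h1, map_zero, smul_zero, zero_sub, neg_eq_zero]
    split_ifs with hs
    · exact cs_eq_zero_right K r (by rwa [Gam.tail_src]) _
    · rfl

/-! ### The contraction of the CS-resolution -/

variable (T) in
/-- The left action on the CS-resolution as a bilinear map. -/
def csLeftLin (n : ℕ) : T.Alg K →ₗ[K] T.CS K n →ₗ[K] T.CS K n where
  toFun := T.csLeft K n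
  map_add' a b := cs_ext K fun p q r _ _ => by
    simp only [LinearMap.add_apply, csLeft_cs, add_mul]
    simp only [← csLin_apply, map_add, LinearMap.add_apply]
  map_smul' c a := cs_ext K fun p q r _ _ => by
    simp only [LinearMap.smul_apply, csLeft_cs, smul_mul_assoc, RingHom.id_apply]
    simp only [← csLin_apply, map_smul, LinearMap.smul_apply]

variable (T) in
/-- `b ↦ ∑_i a_l ⋯ a_{i+1} ⊗ a_i ⊗ a_{i-1} ⋯ a_1 b`, for a list of arrows `a_l, …, a_1`. -/
def csDer (l : List Ar) : T.Alg K →ₗ[K] T.CS K 1 :=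
  ∑ i : Fin l.length, T.csLin K 1 (Gam.arrow T l[i]) (T.listProd K (l.take i)) ∘ₗ
    LinearMap.mulLeft K (T.listProd K (l.drop (i + 1)))

theorem csDer_apply (l : List Ar) (b : T.Alg K) : T.csDer K l b = ∑ i : Fin l.length,
    T.cs K 1 (T.listProd K (l.take i)) (Gam.arrow T l[i])
      (T.listProd K (l.drop (i + 1)) * b) := by
  rw [csDer, LinearMap.sum_apply]
  rfl

theorem csDer_nil (b : T.Alg K) : T.csDer K [] b = 0 := by
  rw [csDer_apply]; rfl

theorem csDer_cons (a : Ar) (l : List Ar) (b : T.Alg K) : T.csDer K (a :: l) b =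
    T.cs K 1 1 (Gam.arrow T a) (T.listProd K l * b) +
      T.csLeft K 1 (T.arr K a) (T.csDer K l b) := by
  rw [csDer_apply, csDer_apply, map_sum]
  refine (Fin.sum_univ_succ (n := l.length) _).trans ?_
  congr 1
  refine Finset.sum_congr rfl fun i _ => ?_
  rw [csLeft_cs, ← listProd_cons]
  rfl

/-- The Leibniz rule: `csDer` is the derivation that sends each arrow `a` to `1 ⊗ a ⊗ 1`, followed
by right multiplication by `b`. -/
theorem csDer_append (l m : List Ar) (b : T.Alg K) : T.csDer K (l ++ m) b =
    T.csDer K l (T.listProd K m * b) + T.csLeft K 1 (T.listProd K l) (T.csDer K m b) := by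
  induction l with
  | nil =>
    rw [List.nil_append, csDer_nil, zero_add, listProd_nil]
    refine LinearMap.congr_fun (f := LinearMap.id) (g := T.csLeft K 1 1)
      (cs_ext K fun p q r _ _ => ?_) _
    rw [csLeft_cs, one_mul, LinearMap.id_apply]
  | cons a l ih =>
    rw [List.cons_append, csDer_cons, ih, csDer_cons, listProd_append, mul_assoc, map_add,
      add_assoc, listProd_cons, csLeft_mul]

theorem csDer_snoc (l : List Ar) (a : Ar) (b : T.Alg K) : T.csDer K (l ++ [a]) b =
    T.csDer K l (T.arr K a * b) + T.cs K 1 (T.listProd K l) (Gam.arrow T a) b := by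
  rw [csDer_append, csDer_cons, csDer_nil, map_zero, add_zero, listProd_nil, one_mul, csLeft_cs,
    mul_one, listProd_singleton]

theorem csDer_eq_zero (p : T.Q.Path) (r : T.Bp) (h : p.src ≠ r.1.tgt) :
    T.csDer K p.arrows (r.cls K) = 0 := by
  rcases List.eq_nil_or_concat p.arrows with h0 | ⟨l, a, ha⟩
  · rw [h0, csDer_nil]
  · rw [List.concat_eq_append] at ha
    have hs : p.src = T.s a := by
      have := p.isPath
      rw [ha] at this
      exact Gam.src_of_append this
    rw [hs] at h
    have h1 : T.arr K a * r.cls K = 0 := by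
      rw [← arr_eq_mul_idem, mul_assoc, Bp.idem_mul_cls_ne K r h.symm, mul_zero]
    rw [ha, csDer_snoc, h1, map_zero, zero_add]
    exact cs_eq_zero_right K r h _

variable (T) in
open Classical in
/-- The contraction of the CS-resolution: `p ⊗ e ⊗ r ↦ ∑ p' ⊗ a ⊗ p'' r`, the sum over all
factorizations `p = p' a p''`, and `p' a ⊗ q ⊗ r ↦ p' ⊗ a q ⊗ r` for `n ≥ 1`, if `a q` is in
`Γ_{n+1}`. -/
def csContr : ∀ n : ℕ, T.CS K n →ₗ[K] T.CS K (n + 1)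
  | 0 => (T.csBasis K 0).constr K fun x => T.csDer K x.1.1.1.1.arrows (x.1.2.cls K)
  | n + 1 => (T.csBasis K (n + 1)).constr K fun x =>
      if h : ∃ γ : T.Gam (n + 2), γ.tail = x.1.1.2 ∧
          x.1.1.1.1.arrows.getLast? = some γ.first then
        T.cs K (n + 2) (T.listProd K x.1.1.1.1.arrows.dropLast) h.choose (x.1.2.cls K)
      else 0

variable (T) in
/-- The part of the contraction that is present only for `n = 0`. -/
def csExtra : ∀ n : ℕ, List Ar → T.Alg K →ₗ[K] T.CS K (n + 1)
  | 0, l => T.csDer K l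
  | _ + 1, _ => 0

theorem apply_cs_right {n : ℕ} {M : Type*} [AddCommGroup M] [Module K M]
    (φ : T.CS K n →ₗ[K] M) (f : T.Alg K →ₗ[K] M) (a : T.Alg K) (q : T.Gam n)
    (hw : ∀ r : T.Bp, q.1.src = r.1.tgt → φ (T.cs K n a q (r.cls K)) = f (r.cls K))
    (hr : ∀ r : T.Bp, q.1.src ≠ r.1.tgt → f (r.cls K) = 0)
    (b : T.Alg K) : φ (T.cs K n a q b) = f b := by
  refine LinearMap.congr_fun (f := φ ∘ₗ T.csLin K n q a) (g := f)
    ((T.basis K).ext fun r => ?_) b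
  rw [LinearMap.comp_apply, csLin_apply, basis_apply]
  by_cases h : q.1.src = r.1.tgt
  · exact hw r h
  · rw [cs_eq_zero_right K r h, map_zero, hr r h]

theorem csContr_zero (p : T.Bp) (q : T.Gam 0) (h : p.1.src = q.1.tgt) (b : T.Alg K) :
    T.csContr K 0 (T.cs K 0 (p.cls K) q b) = T.csDer K p.1.arrows b := by
  refine apply_cs_right K (T.csContr K 0) (T.csDer K p.1.arrows) _ q (fun r hr => ?_)
    (fun r hr => ?_) b
  · rw [← csBasis_apply K 0 ⟨((p, q), r), h, hr⟩, csContr, Module.Basis.constr_basis]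
  · refine csDer_eq_zero K p.1 r ?_
    have : q.1.src = q.1.tgt := by rw [q.eq_vertex]; rfl
    rwa [h, ← this]

theorem csContr_succ_pos {n : ℕ} (p : T.Bp) (γ : T.Gam (n + 2))
    (h : p.1.arrows.getLast? = some γ.first) (b : T.Alg K) :
    T.csContr K (n + 1) (T.cs K (n + 1) (p.cls K) γ.tail b) =
      T.cs K (n + 2) (T.listProd K p.1.arrows.dropLast) γ b := by
  have hs : p.1.src = γ.tail.1.tgt := by
    obtain ⟨l, hl⟩ := List.getLast?_eq_some_iff.1 h
    have := p.1.isPath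
    rw [hl] at this
    rw [Gam.tail_tgt]
    exact Gam.src_of_append this
  refine apply_cs_right K (T.csContr K (n + 1))
    (T.csLin K (n + 2) γ (T.listProd K p.1.arrows.dropLast)) _ γ.tail (fun r hr => ?_)
    (fun r hr => ?_) b
  · have hex : ∃ γ' : T.Gam (n + 2), γ'.tail = γ.tail ∧
        p.1.arrows.getLast? = some γ'.first := ⟨γ, rfl, h⟩
    rw [← csBasis_apply K (n + 1) ⟨((p, γ.tail), r), hs, hr⟩, csContr, Module.Basis.constr_basis]
    refine (dif_pos hex).trans ?_
    have h1 := hex.choose_spec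
    -- The element of `Γ` in the definition is unique: its first arrow is the last arrow of `p`, and
    -- its tail is given.
    rw [Gam.ext_first_tail (Option.some.inj (h1.2.symm.trans h)) h1.1]
    rfl
  · exact cs_eq_zero_right (q := γ) K r hr _

theorem csContr_succ_neg {n : ℕ} (p : T.Bp) (q : T.Gam (n + 1))
    (h : ∀ γ : T.Gam (n + 2), γ.tail = q → p.1.arrows.getLast? ≠ some γ.first) (b : T.Alg K) :
    T.csContr K (n + 1) (T.cs K (n + 1) (p.cls K) q b) = 0 := by
  by_cases hs : p.1.src = q.1.tgt
  · refine apply_cs_right K (T.csContr K (n + 1)) 0 _ q (fun r hr => ?_) (fun r hr => rfl) b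
    rw [← csBasis_apply K (n + 1) ⟨((p, q), r), hs, hr⟩, csContr, Module.Basis.constr_basis]
    exact dif_neg fun ⟨γ, h1, h2⟩ => h γ h1 h2
  · rw [cs_eq_zero_left K p hs, map_zero]

/-- A form that is uniform in `n`. In length `0`, the summand of the last arrow of `p` is the main
term and the earlier arrows give the extra one; in positive length there is only the main term. -/
theorem csContr_of_last {n : ℕ} (p : T.Bp) {l : List Ar} (γ : T.Gam (n + 1))
    (h : p.1.arrows = l ++ [γ.first]) (b : T.Alg K) :
    T.csContr K n (T.cs K n (p.cls K) γ.tail b) =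
      T.cs K (n + 1) (T.listProd K l) γ b + T.csExtra K n l (T.arr K γ.first * b) := by
  cases n with
  | zero =>
    rw [csContr_zero, h, csDer_snoc, add_comm (T.csDer K l _)]
    · exact congrArg (fun q => T.cs K 1 (T.listProd K l) q b + _) (Gam.eq_arrow γ).symm
    · have := p.1.isPath
      rw [h] at this
      rw [Gam.tail_tgt]
      exact Gam.src_of_append this
  | succ n =>
    rw [csContr_succ_pos K p γ (by simp [h]), h, List.dropLast_concat]
    exact (add_zero _).symm

/-- The companion for the case where no arrow can be moved. The hypothesis excludes an extension of
`q` only for `n > 0`, since in length `0` the contraction is `csDer` in any case. -/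
theorem csContr_of_not_mem {n : ℕ} (p : T.Bp) (q : T.Gam n) (hq : p.1.src = q.1.tgt)
    (h : ∀ γ : T.Gam (n + 1), γ.tail = q → p.1.arrows.getLast? = some γ.first → n = 0)
    (b : T.Alg K) :
    T.csContr K n (T.cs K n (p.cls K) q b) = T.csExtra K n p.1.arrows b := by
  cases n with
  | zero => exact csContr_zero K p q hq b
  | succ n => exact csContr_succ_neg K p q (fun γ h1 h2 => absurd (h γ h1 h2) (by omega)) b

/-- The path obtained by appending an arrow on the right. -/
theorem Bp.exists_snoc (p : T.Bp) (a : Ar) (hs : p.1.src = T.t a)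
    (h : ∀ b, p.1.arrows.getLast? = some b → (b, a) ∉ T.S) :
    ∃ r : T.Bp, r.1.arrows = p.1.arrows ++ [a] ∧ r.cls K = p.cls K * T.arr K a := by
  refine ⟨⟨p.1.comp (Path.single T.Q a) hs, ?_⟩, rfl, ?_⟩
  · change (p.1.arrows ++ [a]).IsChain _
    refine List.isChain_append.2 ⟨p.2, List.isChain_singleton _, fun b hb c hc => ?_⟩
    simp only [List.head?_cons, Option.mem_def, Option.some.injEq] at hc
    subst hc
    exact h b hb
  · exact (T.cls_mul_eq K p.1 (Path.single T.Q a) hs).symm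

/-- The word returns from exactly one side. If the last arrow of `p` can be moved into `q`, the
first summand of `d s` moves it back and everything else cancels. If not, then `p` times the first
arrow of `q` is in `𝓑`, and the contraction of that summand of `d` restores the word. -/
theorem csDiff_csContr_succ {n : ℕ} (p : T.Bp) (q : T.Gam (n + 1)) (b : T.Alg K)
    (hs : p.1.src = q.1.tgt) :
    T.csDiff K (n + 1) (T.csContr K (n + 1) (T.cs K (n + 1) (p.cls K) q b)) +
      T.csContr K n (T.csDiff K n (T.cs K (n + 1) (p.cls K) q b)) =
      T.cs K (n + 1) (p.cls K) q b := by
  classical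
  by_cases hγ : ∃ γ : T.Gam (n + 2), γ.tail = q ∧ p.1.arrows.getLast? = some γ.first
  · obtain ⟨γ, rfl, hlast⟩ := hγ
    obtain ⟨l, hl⟩ := List.getLast?_eq_some_iff.1 hlast
    have hcls : p.cls K = T.listProd K l * T.arr K γ.first := by
      rw [Bp.cls, cls_eq_listProd K (by rw [hl]; simp), hl, listProd_append, listProd_singleton]
    have hinit : ∀ b, T.csContr K n (T.cs K n (p.cls K) γ.tail.init b) =
        T.cs K (n + 1) (T.listProd K l) γ.init b +
          T.csExtra K n l (T.arr K γ.first * b) := by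
      intro b
      rw [Gam.tail_init, csContr_of_last K p γ.init (by rw [Gam.init_first, hl]), Gam.init_first]
    rw [csContr_succ_pos K p γ hlast, hl, List.dropLast_concat, csDiff_cs, csDiff_cs, ← hcls,
      map_sub, map_add, map_smul]
    -- The last arrow of `p` and the first arrow of `q` form a relation of `S`: either their product
    -- is zero, or they are the same special loop.
    rcases mem_S_cases γ.first_mem with hR | ⟨he, hsp⟩
    · have h1 : ¬ γ.IsSpecial := fun h => by
        have h2 := h.first_mem
        have h3 : γ.tail.first = γ.first :=
          T.gentle.rel_right γ.first γ.first_mem (Or.inr ⟨_, h2, rfl⟩)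
        rw [h3] at hR
        exact T.sq_notMem _ h2 hR
      have h2 : ¬ γ.tail.IsSpecial := fun h => by
        have h2 := h.first_mem
        have h3 : γ.first = γ.tail.first :=
          T.gentle.rel_left γ.tail.first γ.first_mem (Or.inr ⟨_, h2, rfl⟩)
        rw [h3] at hR
        exact T.sq_notMem _ h2 hR
      have h3 : p.cls K * T.arr K γ.tail.first = 0 := by
        rw [hcls, mul_assoc, arr_mul_zero T K hR, mul_zero]
      have h4 : T.csExtra K n l (T.arr K γ.first * (T.arr K γ.tail.last * b)) = 0 := by
        cases n with
        | zero => rw [Gam.last_eq_first, ← mul_assoc, arr_mul_zero T K hR, zero_mul, map_zero]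
        | succ n => rfl
      rw [if_neg (fun h => h1 h.1), if_neg (fun h => h2 h.1), h3, cs_zero_left, map_zero,
        hinit, h4, Gam.tail_last, pow_succ (-1 : K) (n + 1)]
      simp
    · have h1 : γ.IsSpecial := γ.isSpecial_of_first (he ▸ hsp)
      have h2 : γ.tail.IsSpecial := γ.tail.isSpecial_of_first hsp
      have h3 : p.cls K * T.arr K γ.tail.first = p.cls K := by
        rw [hcls, he, mul_assoc, arr_mul_idem T K hsp]
      rw [h3, h2.tail_eq_init, hinit, hinit, ← h1.tail_eq_init, h1.last_eq_first,
        h2.last_eq_first, ← he, ← mul_assoc, arr_mul_idem T K (he ▸ hsp)]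
      -- The paths have lengths `n + 2` and `n + 1`, so exactly one of the two differentials has the
      -- extra summand. It compensates for the fact that `p` times the loop is `p` and not zero.
      have h5 : (if γ.IsSpecial ∧ Even (n + 1 + 1) then
          T.cs K (n + 1) (T.listProd K l) γ.tail b else 0) = if Even (n + 1) then 0 else
          T.cs K (n + 1) (T.listProd K l) γ.tail b := by
        by_cases hn : Even (n + 1)
        · rw [if_neg fun h => Nat.even_add_one.1 h.2 hn, if_pos hn]
        · rw [if_pos ⟨h1, Nat.even_add_one.2 hn⟩, if_neg hn]
      have h6 : T.csContr K n (if γ.tail.IsSpecial ∧ Even (n + 1) then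
          T.cs K n (p.cls K) γ.tail.init b else 0) = if Even (n + 1) then
          T.cs K (n + 1) (T.listProd K l) γ.tail b +
            T.csExtra K n l (T.arr K γ.first * b) else 0 := by
        by_cases hn : Even (n + 1)
        · rw [if_pos ⟨h2, hn⟩, if_pos hn, hinit, ← h1.tail_eq_init]
        · rw [if_neg (fun h => hn h.2), if_neg hn, map_zero]
      rw [h5, h6, pow_succ (-1 : K) (n + 1)]
      by_cases hn : Even (n + 1)
      · have h7 : T.csExtra K n l (T.arr K γ.first * b) = 0 := by
          cases n with
          | zero => exact absurd hn (by decide)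
          | succ n => rfl
        rw [if_pos hn, if_pos hn, hn.neg_one_pow, h7]
        module
      · rw [if_neg hn, if_neg hn, (Nat.not_even_iff_odd.1 hn).neg_one_pow]
        module
  · push Not at hγ
    have hS : ∀ a, p.1.arrows.getLast? = some a → (a, q.first) ∉ T.S := by
      intro a ha h
      obtain ⟨γ, h1, h2⟩ := Gam.exists_cons a q h
      exact hγ γ h2 (h1 ▸ ha)
    obtain ⟨r, hr, hrc⟩ := Bp.exists_snoc K p q.first (hs.trans q.tgt_eq) hS
    have hinit : ∀ b, T.csContr K n (T.cs K n (p.cls K) q.init b) =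
        T.csExtra K n p.1.arrows b := by
      refine csContr_of_not_mem K p q.init (by rw [hs, Gam.init_tgt]) fun γ h1 h2 => ?_
      cases n with
      | zero => rfl
      | succ n =>
        have := γ.first_mem
        rw [h1, Gam.init_first] at this
        exact absurd this (hS _ h2)
    rw [csContr_succ_neg K p q hγ, map_zero, zero_add, csDiff_cs, map_sub, map_add, map_smul,
      ← hrc, csContr_of_last K r q hr, hinit, cs_cls_eq K hs]
    -- In length one, the extra terms of the two outer summands are equal, as first and last arrow
    -- coincide, and they have opposite signs. In greater length there are none.
    cases n with
    | zero =>
      rw [if_neg (fun h => absurd h.2 (by decide)), Gam.last_eq_first, map_zero]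
      simp
    | succ n =>
      have h6 : T.csContr K (n + 1) (if q.IsSpecial ∧ Even (n + 1 + 1) then
          T.cs K (n + 1) (p.cls K) q.tail b else 0) = 0 := by
        split_ifs with h
        · rw [h.1.tail_eq_init, hinit]; rfl
        · rw [map_zero]
      rw [h6]
      simp [csExtra]

variable (T) in
/-- `a ↦ 1 ⊗ a`. -/
def csUnit : T.Alg K →ₗ[K] T.CS K 0 := ∑ v, T.csLin K 0 (Gam.vertex T v) 1

theorem csUnit_apply (a : T.Alg K) :
    T.csUnit K a = ∑ v, T.cs K 0 1 (Gam.vertex T v) a := by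
  rw [csUnit, LinearMap.sum_apply]; rfl

theorem csLeft_csUnit (c : T.Alg K) (v : V) (hc : c * T.idem K v = c) (b : T.Alg K) :
    T.csLeft K 0 c (T.csUnit K b) = T.cs K 0 c (Gam.vertex T v) b := by
  classical
  rw [csUnit_apply, map_sum, Finset.sum_eq_single v]
  · rw [csLeft_cs, mul_one]
  · intro w _ hw
    rw [csLeft_cs, mul_one, ← hc, cs_balance_left, if_neg (show ¬ (Gam.vertex T w).1.tgt = v from hw)]
  · simp

theorem csUnit_eq (v : V) (b : T.Alg K) (hb : T.idem K v * b = b) :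
    T.csUnit K b = T.cs K 0 1 (Gam.vertex T v) b := by
  classical
  rw [csUnit_apply, Finset.sum_eq_single v]
  · intro w _ hw
    rw [← hb, cs_balance_right, if_neg (show ¬ (Gam.vertex T w).1.src = v from hw)]
  · simp

theorem csDiff_csLeft {n : ℕ} (c : T.Alg K) (x : T.CS K (n + 1)) :
    T.csDiff K n (T.csLeft K (n + 1) c x) = T.csLeft K n c (T.csDiff K n x) := by
  classical
  refine LinearMap.congr_fun (f := T.csDiff K n ∘ₗ T.csLeft K (n + 1) c)
    (g := T.csLeft K n c ∘ₗ T.csDiff K n) (cs_ext K fun p q r _ _ => ?_) x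
  rw [LinearMap.comp_apply, LinearMap.comp_apply, csLeft_cs, csDiff_cs, csDiff_cs, map_sub,
    map_add, map_smul, csLeft_cs, csLeft_cs, mul_assoc]
  split_ifs
  · rw [csLeft_cs]
  · rw [map_zero]

/-- The differential of each summand is the difference of two ways to place the tensor sign, before
and after the arrow; the sum telescopes. -/
theorem csDiff_csDer (l : List Ar) (b : T.Alg K) :
    T.csDiff K 0 (T.csDer K l b) = T.csLeft K 0 (T.listProd K l) (T.csUnit K b) -
      T.csUnit K (T.listProd K l * b) := by
  classical
  have h1 : ∀ x : T.CS K 0, T.csLeft K 0 1 x = x := fun x =>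
    LinearMap.congr_fun (f := T.csLeft K 0 1) (g := LinearMap.id)
      (cs_ext K fun p q r _ _ => by rw [csLeft_cs, one_mul, LinearMap.id_apply]) x
  induction l with
  | nil => rw [csDer_nil, map_zero, listProd_nil, h1, one_mul, sub_self]
  | cons a l ih =>
    have hd : ∀ c, T.csDiff K 0 (T.cs K 1 1 (Gam.arrow T a) c) =
        T.csLeft K 0 (T.arr K a) (T.csUnit K c) - T.csUnit K (T.arr K a * c) := by
      intro c
      rw [csDiff_cs, if_neg (fun h => absurd h.2 (by decide)), sub_zero, one_mul,
        csLeft_csUnit K _ (T.s a) (arr_eq_mul_idem K a), csUnit_eq K (T.t a)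
        (T.arr K a * c) (by rw [← mul_assoc, idem_mul_arr])]
      simp only [zero_add, pow_one, neg_smul, one_smul, ← sub_eq_add_neg]
      congr 2
    rw [csDer_cons, map_add, hd, csDiff_csLeft, ih, map_sub, ← csLeft_mul, listProd_cons, mul_assoc]
    abel

theorem csDiff_csContr_zero (p : T.Bp) (q : T.Gam 0) (r : T.Bp) (hs : p.1.src = q.1.tgt)
    (hr : q.1.src = r.1.tgt) :
    T.csDiff K 0 (T.csContr K 0 (T.cs K 0 (p.cls K) q (r.cls K))) =
      T.cs K 0 (p.cls K) q (r.cls K) - T.csUnit K (p.cls K * T.cls K q.1 * r.cls K) := by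
  have hq : q.1.src = q.1.tgt := by rw [q.eq_vertex]; rfl
  have hq' : T.cls K q.1 = T.idem K q.1.tgt := by rw [q.eq_vertex]; rfl
  have h1 : p.cls K * T.cls K q.1 * r.cls K = T.listProd K p.1.arrows * r.cls K := by
    rw [hq', ← hs, Bp.cls_mul_idem_src, Bp.cls, cls_eq_listProd_mul, mul_assoc, hs, ← hq, hr,
      Bp.idem_tgt_mul_cls]
  have h2 : T.csUnit K (r.cls K) = T.cs K 0 1 q (r.cls K) := by
    rw [csUnit_eq K q.1.tgt _ (by rw [← hq, hr, Bp.idem_tgt_mul_cls]), ← q.eq_vertex]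
  rw [csContr_zero K p q hs, csDiff_csDer, h1, h2, csLeft_cs, mul_one, cs_cls_eq K hs]

/-! ### The CS-resolution as a contracted complex -/

theorem cs_one {n : ℕ} (q : T.Gam n) (b : T.Alg K) :
    T.cs K n 1 q b = T.cs K n (T.idem K q.1.tgt) q b := by
  rw [← cs_mul_idem_tgt, one_mul]

/-- A trivial path has no last arrow that could be moved. -/
theorem csContr_idem {n : ℕ} (q : T.Gam n) (b : T.Alg K) :
    T.csContr K n (T.cs K n (T.idem K q.1.tgt) q b) = 0 := by
  rw [← Bp.cls_triv]
  cases n with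
  | zero => rw [csContr_zero K _ q rfl]; exact csDer_nil K b
  | succ n => exact csContr_succ_neg K _ q (fun γ _ h => by cases h) b

theorem csContr_one {n : ℕ} (q : T.Gam n) (b : T.Alg K) :
    T.csContr K n (T.cs K n 1 q b) = 0 := by
  rw [cs_one, csContr_idem]

/-! ### The square of the contraction of `T_*`, and right multiplication. -/

theorem isPath_of_append {j i : V} {l : List Ar} {a : Ar} {m : List Ar}
    (h : T.Q.IsPath j (l ++ a :: m) i) : T.Q.IsPath j l (T.t a) := by
  induction l generalizing j with
  | nil => exact h.1.symm
  | cons b l ih => exact ⟨h.1, ih h.2⟩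

/-- Cutting an element of `𝓑` before an arrow `a` leaves a prefix whose last arrow has no relation
with `a`. So the contraction cannot move that arrow in front of `a`. -/
theorem Bp.exists_prefix (p : T.Bp) {l : List Ar} {a : Ar} {m : List Ar}
    (h : p.1.arrows = l ++ a :: m) :
    ∃ r : T.Bp, r.1.arrows = l ∧ r.1.tgt = p.1.tgt ∧
      ∀ b, l.getLast? = some b → (b, a) ∉ T.S := by
  have h1 := p.1.isPath
  have h2 := p.2
  rw [h] at h1 h2
  refine ⟨⟨⟨p.1.tgt, l, T.t a, isPath_of_append h1⟩, (List.isChain_append.1 h2).1⟩, rfl, rfl, ?_⟩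
  intro b hb
  exact (List.isChain_append.1 h2).2.2 b hb a rfl

theorem csContr_eq_zero {n : ℕ} (r : T.Bp) (γ : T.Gam (n + 1)) (b : T.Alg K)
    (h : ∀ c, r.1.arrows.getLast? = some c → (c, γ.first) ∉ T.S) :
    T.csContr K (n + 1) (T.cs K (n + 1) (r.cls K) γ b) = 0 := by
  refine csContr_succ_neg K r γ (fun γ' h1 h2 => h _ h2 ?_) b
  have := γ'.first_mem
  rwa [h1] at this

/-- A nonzero product with the nonempty path `l` on the right still ends in the last arrow of `l`.
In `p` this arrow precedes the first arrow of `γ`, so the two are not in `S`. If `l` were empty, the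
last arrow could come from `c`. -/
theorem csContr_mul_eq_zero {n : ℕ} (c p : T.Bp) {l m : List Ar} (γ : T.Gam (n + 1))
    (h : p.1.arrows = l ++ γ.first :: m) (hl : l ≠ []) (b : T.Alg K) :
    T.csContr K (n + 1) (T.cs K (n + 1) (c.cls K * T.listProd K l) γ b) = 0 := by
  obtain ⟨r, hr, -, hb⟩ := p.exists_prefix h
  have hne : r.1.arrows ≠ [] := by rwa [hr]
  rw [← hr, ← cls_eq_listProd K hne]
  rcases cls_mul_cls_cases K c r with h0 | ⟨u, hu, -, -, -, -, hu'⟩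
  · rw [show T.cls K r.1 = r.cls K from rfl, h0, cs_zero_left, map_zero]
  · rw [show T.cls K r.1 = r.cls K from rfl, hu]
    refine csContr_eq_zero K u γ b fun y hy => hb y ?_
    rw [← hr, ← hu' hne, hy]

theorem csContr_listProd_eq_zero {n : ℕ} (p : T.Bp) {l m : List Ar} (γ : T.Gam (n + 1))
    (h : p.1.arrows = l ++ γ.first :: m) (b : T.Alg K) :
    T.csContr K (n + 1) (T.cs K (n + 1) (T.listProd K l) γ b) = 0 := by
  by_cases hl : l = []
  · rw [hl, listProd_nil, csContr_one]
  · obtain ⟨r, hr, ht, hb⟩ := p.exists_prefix h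
    have hne : r.1.arrows ≠ [] := by rwa [hr]
    rw [← hr, ← cls_eq_listProd K hne]
    exact csContr_eq_zero K r γ b fun y hy => hb y (by rw [← hr, hy])

/-- The contraction cuts `p` just before the arrow that it moves into the middle. The arrow left at
the end of the prefix has no relation with the moved one, as `p` is in `𝓑`, so nothing can be moved
a second time. -/
theorem csContr_csContr (n : ℕ) (x : T.CS K n) :
    T.csContr K (n + 1) (T.csContr K n x) = 0 := by
  refine LinearMap.congr_fun (f := T.csContr K (n + 1) ∘ₗ T.csContr K n) (g := 0)
    (cs_ext K fun p q r hs hr => ?_) x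
  rw [LinearMap.comp_apply, LinearMap.zero_apply]
  cases n with
  | zero =>
    rw [csContr_zero K p q hs, csDer_apply, map_sum]
    refine Finset.sum_eq_zero fun i _ => ?_
    refine csContr_listProd_eq_zero K p (m := p.1.arrows.drop (i + 1)) _ ?_ _
    conv_lhs => rw [← List.take_append_drop i p.1.arrows, List.drop_eq_getElem_cons i.2]
    rfl
  | succ n =>
    by_cases h : ∃ γ : T.Gam (n + 2), γ.tail = q ∧ p.1.arrows.getLast? = some γ.first
    · obtain ⟨γ, rfl, h⟩ := h
      rw [csContr_succ_pos K p γ h]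
      obtain ⟨l, hl⟩ := List.getLast?_eq_some_iff.1 h
      rw [hl, List.dropLast_concat]
      exact csContr_listProd_eq_zero K p γ hl _
    · push Not at h
      rw [csContr_succ_neg K p q h, map_zero]

theorem csRight_csDer (l : List Ar) (b c : T.Alg K) :
    T.csRight K 1 c (T.csDer K l b) = T.csDer K l (b * c) := by
  rw [csDer_apply, csDer_apply, map_sum]
  simp only [csRight_cs, mul_assoc]

theorem csRight_csContr {n : ℕ} (c : T.Alg K) (x : T.CS K n) :
    T.csRight K (n + 1) c (T.csContr K n x) = T.csContr K n (T.csRight K n c x) := by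
  refine LinearMap.congr_fun (f := T.csRight K (n + 1) c ∘ₗ T.csContr K n)
    (g := T.csContr K n ∘ₗ T.csRight K n c) (cs_ext K fun p q r hs hr => ?_) x
  rw [LinearMap.comp_apply, LinearMap.comp_apply, csRight_cs]
  cases n with
  | zero => rw [csContr_zero K p q hs, csContr_zero K p q hs, csRight_csDer]
  | succ n =>
    by_cases h : ∃ γ : T.Gam (n + 2), γ.tail = q ∧ p.1.arrows.getLast? = some γ.first
    · obtain ⟨γ, rfl, h⟩ := h
      rw [csContr_succ_pos K p γ h, csContr_succ_pos K p γ h, csRight_cs]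
    · push Not at h
      rw [csContr_succ_neg K p q h, csContr_succ_neg K p q h, map_zero]

variable (T) in
/-- The contraction of `T_*`. -/
def totCSContr : T.TotCS K →ₗ[K] T.TotCS K :=
  DirectSum.toModule K ℕ _ fun n => DirectSum.lof K ℕ (T.CS K) (n + 1) ∘ₗ T.csContr K n

variable (T) in
/-- The left action of `A` on `T_*`. -/
def totCSLeft : T.Alg K →ₗ[K] T.TotCS K →ₗ[K] T.TotCS K where
  toFun a := DirectSum.lmap fun n => T.csLeft K n a
  map_add' a b := DirectSum.linearMap_ext _ fun n => LinearMap.ext fun x => by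
    have : T.csLeft K n (a + b) = T.csLeft K n a + T.csLeft K n b :=
      map_add (T.csLeftLin K n) a b
    simp [DirectSum.lmap_lof, this]
  map_smul' c a := DirectSum.linearMap_ext _ fun n => LinearMap.ext fun x => by
    have : T.csLeft K n (c • a) = c • T.csLeft K n a := map_smul (T.csLeftLin K n) c a
    simp [DirectSum.lmap_lof, this]

variable (T) in
/-- The right multiplications on `T_*`. -/
def totCSRight (b : T.Alg K) : T.TotCS K →ₗ[K] T.TotCS K :=
  DirectSum.lmap fun n => T.csRight K n b

theorem totCSContr_lof (n : ℕ) (x : T.CS K n) :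
    T.totCSContr K (DirectSum.lof K ℕ (T.CS K) n x) =
      DirectSum.lof K ℕ (T.CS K) (n + 1) (T.csContr K n x) := by
  rw [totCSContr, DirectSum.toModule_lof, LinearMap.comp_apply]

theorem totCSLeft_lof (a : T.Alg K) (n : ℕ) (x : T.CS K n) :
    T.totCSLeft K a (DirectSum.lof K ℕ (T.CS K) n x) =
      DirectSum.lof K ℕ (T.CS K) n (T.csLeft K n a x) := DirectSum.lmap_lof _ _ _

theorem totCSRight_lof (a : T.Alg K) (n : ℕ) (x : T.CS K n) :
    T.totCSRight K a (DirectSum.lof K ℕ (T.CS K) n x) =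
      DirectSum.lof K ℕ (T.CS K) n (T.csRight K n a x) := DirectSum.lmap_lof _ _ _

theorem totCSDiff_lof_zero (x : T.CS K 0) :
    T.totCSDiff K (DirectSum.lof K ℕ (T.CS K) 0 x) = 0 := by
  rw [totCSDiff, DirectSum.toModule_lof, LinearMap.zero_apply]

theorem totCSDiff_lof_succ (n : ℕ) (x : T.CS K (n + 1)) :
    T.totCSDiff K (DirectSum.lof K ℕ (T.CS K) (n + 1) x) =
      DirectSum.lof K ℕ (T.CS K) n (T.csDiff K n x) := by
  rw [totCSDiff, DirectSum.toModule_lof, LinearMap.comp_apply]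

theorem totCSAug_lof_zero (x : T.CS K 0) :
    T.totCSAug K (DirectSum.lof K ℕ (T.CS K) 0 x) = T.csAug K x := by
  rw [totCSAug, DirectSum.toModule_lof]

theorem totCSAug_lof_succ (n : ℕ) (x : T.CS K (n + 1)) :
    T.totCSAug K (DirectSum.lof K ℕ (T.CS K) (n + 1) x) = 0 := by
  rw [totCSAug, DirectSum.toModule_lof, LinearMap.zero_apply]

theorem totCSAct_eq (a b : T.Alg K) (x : T.TotCS K) :
    T.totCSAct K a b x = T.totCSLeft K a (T.totCSRight K b x) := by
  refine LinearMap.congr_fun (f := T.totCSAct K a b)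
    (g := T.totCSLeft K a ∘ₗ T.totCSRight K b) ?_ x
  refine DirectSum.linearMap_ext _ fun n => LinearMap.ext fun x => ?_
  simp only [LinearMap.comp_apply, totCSRight_lof, totCSLeft_lof]
  exact DirectSum.lmap_lof _ _ _

theorem totCS_ext {M : Type*} [AddCommGroup M] [Module K M] {f g : T.TotCS K →ₗ[K] M}
    (h : ∀ (n : ℕ) (p : T.Bp) (q : T.Gam n) (r : T.Bp), p.1.src = q.1.tgt → q.1.src = r.1.tgt →
      f (DirectSum.lof K ℕ (T.CS K) n (T.cs K n (p.cls K) q (r.cls K))) =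
        g (DirectSum.lof K ℕ (T.CS K) n (T.cs K n (p.cls K) q (r.cls K)))) : f = g :=
  DirectSum.linearMap_ext K fun n => cs_ext K (h n)

variable (T) in
/-- The CS-resolution as a contracted complex. -/
def csComplex : ContractedComplex K T (T.TotCS K) where
  diff := T.totCSDiff K
  contr := T.totCSContr K
  aug := T.totCSAug K
  unit := DirectSum.lof K ℕ (T.CS K) 0 ∘ₗ T.csUnit K
  act := T.totCSLeft K
  parity := 0
  Word := T.CSWord
  word {n} x := DirectSum.lof K ℕ (T.CS K) n (T.csBasis K n x)
  gen {n} x := DirectSum.lof K ℕ (T.CS K) n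
    (T.cs K n (T.idem K x.1.1.2.1.tgt) x.1.1.2 (x.1.2.cls K))
  lead x := x.1.1.1
  act_mul a b x := by
    refine LinearMap.congr_fun (f := T.totCSLeft K (a * b))
      (g := T.totCSLeft K a ∘ₗ T.totCSLeft K b) (totCS_ext K fun n p q r _ _ => ?_) x
    simp only [LinearMap.comp_apply, totCSLeft_lof, csLeft_mul]
  word_eq {n} x := by
    rw [totCSLeft_lof, csBasis_apply, csLeft_cs, cs_mul_idem_tgt]
  change_lead x p hp := ⟨⟨((p, x.1.1.2), x.1.2), hp.trans x.2.1, x.2.2⟩, rfl, rfl⟩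
  gen_eq_word x := ⟨⟨((Bp.triv T x.1.1.2.1.tgt, x.1.1.2), x.1.2), rfl, x.2.2⟩,
    by rw [csBasis_apply, Bp.cls_triv], rfl⟩
  span_word := by
    rw [← iSup_range_lof K]
    exact iSup_congr fun n => span_lof_basis K (T.csBasis K) n
  contr_gen {n} x := by rw [totCSContr_lof, csContr_idem, map_zero]
  homotopy x := by
    refine LinearMap.congr_fun (f := T.totCSDiff K ∘ₗ T.totCSContr K +
      T.totCSContr K ∘ₗ T.totCSDiff K) (g := LinearMap.id -
        (DirectSum.lof K ℕ (T.CS K) 0 ∘ₗ T.csUnit K) ∘ₗ T.totCSAug K)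
      (totCS_ext K fun n p q r hs hr => ?_) x
    simp only [LinearMap.add_apply, LinearMap.sub_apply, LinearMap.comp_apply,
      LinearMap.id_apply, totCSContr_lof, totCSDiff_lof_succ]
    cases n with
    | zero =>
      rw [totCSDiff_lof_zero, totCSAug_lof_zero, map_zero, add_zero, csAug_cs,
        csDiff_csContr_zero K p q r hs hr, map_sub]
    | succ n =>
      rw [totCSDiff_lof_succ, totCSAug_lof_succ, totCSContr_lof, ← map_add,
        csDiff_csContr_succ K p q _ hs, map_zero, map_zero, sub_zero]
  aug_contr x := by
    refine LinearMap.congr_fun (f := T.totCSAug K ∘ₗ T.totCSContr K) (g := 0)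
      (totCS_ext K fun n p q r _ _ => ?_) x
    rw [LinearMap.comp_apply, totCSContr_lof, totCSAug_lof_succ, LinearMap.zero_apply]
  aug_unit a := by
    rw [LinearMap.comp_apply, totCSAug_lof_zero, csUnit_apply, map_sum]
    simp only [csAug_cs, one_mul]
    rw [← Finset.sum_mul]
    exact (congrArg (· * a) (sum_idem K)).trans (one_mul a)
  aug_act a x := by
    refine LinearMap.congr_fun (f := T.totCSAug K ∘ₗ T.totCSLeft K a)
      (g := LinearMap.mulLeft K a ∘ₗ T.totCSAug K) (totCS_ext K fun n p q r _ _ => ?_) x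
    simp only [LinearMap.comp_apply, totCSLeft_lof, LinearMap.mulLeft_apply]
    cases n with
    | zero => simp only [totCSAug_lof_zero, csLeft_cs, csAug_cs, mul_assoc]
    | succ n => rw [totCSAug_lof_succ, totCSAug_lof_succ, mul_zero]
  aug_gen x := totCSAug_lof_succ K _ _
  diff_unit a := totCSDiff_lof_zero K _
  diff_zero x := totCSDiff_lof_zero K _
  diff_succ {n} x := by
    rw [totCSDiff_lof_succ, span_lof_basis K (T.csBasis K) n]
    exact ⟨_, rfl⟩
  diff_word {n} x := by
    rw [zero_mul, Int.negOnePow_zero, one_smul]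
    cases n with
    | zero => rw [totCSDiff_lof_zero, totCSDiff_lof_zero, map_zero]
    | succ n =>
      rw [totCSDiff_lof_succ, totCSDiff_lof_succ, totCSLeft_lof, ← csDiff_csLeft, csLeft_cs,
        cs_mul_idem_tgt, csBasis_apply]

theorem csComplex_level (n : ℕ) :
    (T.csComplex K).level n = LinearMap.range (DirectSum.lof K ℕ (T.CS K) n) :=
  span_lof_basis K (T.csBasis K) n

theorem cs_idem_mem_genSpan {n : ℕ} (q : T.Gam n) (b : T.Alg K) :
    DirectSum.lof K ℕ (T.CS K) n (T.cs K n (T.idem K q.1.tgt) q b) ∈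
      (T.csComplex K).genSpan n := by
  rw [← csLin_apply, ← (T.basis K).linearCombination_repr b]
  induction (T.basis K).repr b using Finsupp.induction_linear with
  | zero => simp
  | add a b ha hb => simp only [map_add]; exact add_mem ha hb
  | single r c =>
    simp only [Finsupp.linearCombination_single, map_smul]
    refine Submodule.smul_mem _ c ?_
    rw [basis_apply, csLin_apply]
    by_cases h : q.1.src = r.1.tgt
    · exact Submodule.subset_span ⟨⟨((Bp.triv T q.1.tgt, q), r), rfl, h⟩, rfl⟩
    · rw [cs_eq_zero_right K r h, map_zero]
      exact zero_mem _

theorem isRightMul_totCSRight (b : T.Alg K) : (T.csComplex K).IsRightMul (T.totCSRight K b)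
    (LinearMap.mulRight K b) where
  act a x := by
    refine LinearMap.congr_fun (f := T.totCSRight K b ∘ₗ T.totCSLeft K a)
      (g := T.totCSLeft K a ∘ₗ T.totCSRight K b) (totCS_ext K fun n p q r _ _ => ?_) x
    simp only [LinearMap.comp_apply, totCSLeft_lof, totCSRight_lof, csRight_csLeft]
  contr x := by
    refine LinearMap.congr_fun (f := T.totCSRight K b ∘ₗ T.totCSContr K)
      (g := T.totCSContr K ∘ₗ T.totCSRight K b) (totCS_ext K fun n p q r _ _ => ?_) x
    simp only [LinearMap.comp_apply, totCSContr_lof, totCSRight_lof, csRight_csContr]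
  unit a := by
    refine (totCSRight_lof K b 0 _).trans (congrArg _ ?_)
    rw [csUnit_apply, map_sum, LinearMap.mulRight_apply, csUnit_apply]
    simp only [csRight_cs]
  aug x := by
    refine LinearMap.congr_fun (f := T.totCSAug K ∘ₗ T.totCSRight K b)
      (g := LinearMap.mulRight K b ∘ₗ T.totCSAug K) (totCS_ext K fun n p q r _ _ => ?_) x
    simp only [LinearMap.comp_apply, totCSRight_lof, LinearMap.mulRight_apply]
    cases n with
    | zero => simp only [totCSAug_lof_zero, csRight_cs, csAug_cs, mul_assoc]
    | succ n => rw [totCSAug_lof_succ, totCSAug_lof_succ, zero_mul]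
  gen n x := by
    refine (congrArg (· ∈ (T.csComplex K).genSpan n) (totCSRight_lof K b n _)).mpr ?_
    rw [csRight_cs]
    exact cs_idem_mem_genSpan K _ _

/-! ### The map `F` -/

theorem sigma_congr {n : ℕ} {d d' : ℕ → ℤ} (h : ∀ j, 2 ≤ j → j ≤ n → d j = d' j) :
    sigma n d = sigma n d' := by
  refine Finset.sum_congr rfl fun i hi => Finset.sum_congr rfl fun j hj => ?_
  rw [Finset.mem_Icc] at hi hj
  exact h j (hi.1.trans hj.1) hj.2

/-- The new degree occurs once in each of the `n` inner sums with `2 ≤ i ≤ n + 1`; without it, the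
sum for `i = n + 1` is empty. -/
theorem sigma_succ (n : ℕ) (d : ℕ → ℤ) : sigma (n + 1) d = sigma n d + n * d (n + 1) := by
  have h : ∀ i ∈ Finset.Icc 2 (n + 1), ∑ j ∈ Finset.Icc i (n + 1), d j =
      ∑ j ∈ Finset.Icc i n, d j + d (n + 1) := by
    intro i hi
    rw [Finset.sum_Icc_succ_top (Finset.mem_Icc.1 hi).2]
  rw [sigma, Finset.sum_congr rfl h, Finset.sum_add_distrib, Finset.sum_const, Nat.card_Icc,
    sigma]
  cases n with
  | zero => simp
  | succ n =>
    rw [Finset.sum_Icc_succ_top (by omega), Finset.Icc_eq_empty (show ¬ n + 1 + 1 ≤ n + 1 by omega)]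
    simp

variable (T) in
/-- An arrow as an element of `𝓑`. -/
def Bp.single (a : Ar) : T.Bp := ⟨Path.single T.Q a, List.isChain_singleton a⟩

theorem fTuple_zero {n : ℕ} (p : T.Bp) (q : T.Gam n) (r : T.Bp) :
    fTuple K p q r 0 = r.cls K := by
  simp [fTuple]

theorem fTuple_last {n : ℕ} (p : T.Bp) (q : T.Gam n) (r : T.Bp) :
    fTuple K p q r (Fin.last (n + 1)) = p.cls K := by
  simp [fTuple, Fin.ext_iff]

theorem update_fTuple {n : ℕ} (p p' : T.Bp) (q : T.Gam n) (r : T.Bp) :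
    Function.update (fTuple K p q r) (Fin.last (n + 1)) (p'.cls K) = fTuple K p' q r := by
  funext j
  by_cases h : j = Fin.last (n + 1)
  · rw [h, Function.update_self, fTuple_last]
  · rw [Function.update_of_ne h, fTuple, fTuple]
    by_cases h0 : j = 0
    · simp [h0]
    · rw [dif_neg (by tauto), dif_neg (by tauto)]

/-- The top inner factor becomes the leading factor of the tuple for `q.tail`. This matches the
contraction of the bar resolution. -/
theorem fTuple_succ {n : ℕ} (p : T.Bp) (q : T.Gam (n + 1)) (r : T.Bp) :
    fTuple K p q r = Fin.snoc (α := fun _ => T.Alg K)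
      (fTuple K (Bp.single T q.first) q.tail r) (p.cls K) := by
  funext j
  refine Fin.lastCases ?_ (fun j => ?_) j
  · rw [Fin.snoc_last, fTuple_last]
  · rw [Fin.snoc_castSucc]
    by_cases h0 : j = 0
    · subst h0
      rw [Fin.castSucc_zero, fTuple_zero, fTuple_zero]
    · have h1 : ¬ (j.castSucc = 0 ∨ j.castSucc = Fin.last (n + 1 + 1)) := by
        rintro (h | h)
        · exact h0 (by simpa using h)
        · exact Fin.castSucc_ne_last j h
      rw [fTuple, dif_neg h1]
      by_cases h : j = Fin.last (n + 1)
      · subst h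
        rw [fTuple_last]
        change T.arr K _ = T.arr K q.first
        congr 1
        simp [Gam.first, List.head_eq_getElem]
      · rw [fTuple, dif_neg (by tauto)]
        congr 1
        -- The arrow `a_j` has position `n + 1 - j` in the list of `q`, and one less in the list of
        -- its tail.
        have hj : n + 1 - j.val = (n - j.val) + 1 := by
          have : j.val ≠ n + 1 := fun h' => h (Fin.ext h')
          omega
        have ha := q.arrows_eq
        simp only [Fin.val_castSucc, hj, ha, List.getElem_cons_succ]

/-- The sign exponent `σ(a)` of `q = a_n ⋯ a_1`. -/
def Gam.sigma {n : ℕ} (q : T.Gam n) : ℤ :=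
  SkewGentleTriple.sigma n fun j => (q.1.arrows.map T.deg).getD (n - j) 0

/-- The increment `n |a_{n+1}|` is the sign that `F` puts on the left factor `a_{n+1}` in length
`n`, so the signs of the recursion agree. -/
theorem Gam.sigma_succ {n : ℕ} (q : T.Gam (n + 1)) :
    q.sigma = n * T.deg q.first + q.tail.sigma := by
  rw [Gam.sigma, SkewGentleTriple.sigma_succ, add_comm]
  congr 1
  · rw [q.arrows_eq]
    simp
  · refine sigma_congr fun j _ hj => ?_
    have hj : n + 1 - j = (n - j) + 1 := by omega
    rw [q.arrows_eq, hj]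
    simp

theorem compF_cs {n : ℕ} (p : T.Bp) (q : T.Gam n) (r : T.Bp) (hs : p.1.src = q.1.tgt)
    (hr : q.1.src = r.1.tgt) : T.compF K n (T.cs K n (p.cls K) q (r.cls K)) =
      (n * p.1.degree + q.sigma).negOnePow • T.barLin K n (fTuple K p q r) := by
  rw [← csBasis_apply K n ⟨((p, q), r), hs, hr⟩, compF, Module.Basis.constr_basis,
    ← bar_eq_barLin K _ (fTuple_mem K p q r)]
  rfl

theorem compF_idem {n : ℕ} (q : T.Gam n) (r : T.Bp)
    (hr : q.1.src = r.1.tgt) : T.compF K n (T.cs K n (T.idem K q.1.tgt) q (r.cls K)) =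
      q.sigma.negOnePow • T.barLin K n (fTuple K (Bp.triv T q.1.tgt) q r) := by
  rw [← Bp.cls_triv, compF_cs K _ _ _ rfl hr, Bp.triv_degree, mul_zero, zero_add]

theorem totF_lof (n : ℕ) (x : T.CS K n) : T.totF K (DirectSum.lof K ℕ (T.CS K) n x) =
    DirectSum.lof K ℕ (T.Bar K) n (T.compF K n x) := DirectSum.lmap_lof _ _ _

theorem totF_gen {n : ℕ} (α : T.CSWord n) :
    T.totF K ((T.csComplex K).gen α) ∈ (T.barComplex K).genSpan n := by
  refine (congrArg (· ∈ (T.barComplex K).genSpan n) (totF_lof K n _)).mpr ?_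
  rw [compF_idem K _ _ α.2.2, map_sign_smul, Units.smul_def]
  refine zsmul_mem (barLin_mem_genSpan K _ α.1.1.2.1.tgt ?_) _
  rw [fTuple_last, Bp.cls_triv]

theorem ContractedComplex.contr_genSpan {K : Type*} [Field K] {X : Type*} [AddCommGroup X]
    [Module K X] (C : ContractedComplex K T X) {n : ℕ} {x : X} (hx : x ∈ C.genSpan n) :
    C.contr x = 0 :=
  eqOn_genSpan (g := 0) (fun α => C.contr_gen α) hx

/-- `F` keeps the leading idempotent, hence takes generators to combinations of generators, which
the contraction kills. -/
theorem totBarContr_totF_idem {n : ℕ} (q : T.Gam n) (b : T.Alg K) :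
    T.totBarContr K (T.totF K (DirectSum.lof K ℕ (T.CS K) n (T.cs K n (T.idem K q.1.tgt) q b))) =
      0 := by
  have h : ∀ α : (T.csComplex K).Word n, ((T.barComplex K).contr ∘ₗ T.totF K)
      ((T.csComplex K).gen α) = (0 : T.TotCS K →ₗ[K] T.TotBar K) ((T.csComplex K).gen α) :=
    fun α => (T.barComplex K).contr_genSpan (totF_gen K α)
  exact ContractedComplex.eqOn_genSpan h (cs_idem_mem_genSpan K q b)

theorem compF_idem_succ {n : ℕ} (q : T.Gam (n + 1)) (r : T.Bp) (hr : q.1.src = r.1.tgt) :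
    T.compF K (n + 1) (T.cs K (n + 1) (T.idem K q.1.tgt) q (r.cls K)) =
      T.barContr K n (T.compF K n (T.cs K n (T.arr K q.first) q.tail (r.cls K))) := by
  rw [compF_idem K q r hr]
  have : T.arr K q.first = (Bp.single T q.first).cls K := rfl
  rw [this, compF_cs K (Bp.single T q.first) q.tail r rfl hr, map_sign_smul, barContr_barLin, fTuple_succ, Bp.cls_triv,
    Gam.sigma_succ]
  congr 1
  · congr 2
    simp [Bp.single, Path.single, Path.degree]
  · refine barLin_snoc_idem K _ _ ?_
    rw [fTuple_last, q.tgt_eq]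
    exact idem_mul_arr K q.first

theorem comparison_totF :
    ContractedComplex.Comparison (T.csComplex K) (T.barComplex K) (T.totF K) where
  parity_eq := ⟨1, rfl⟩
  map_level n x hx := by
    rw [csComplex_level] at hx
    obtain ⟨x, rfl⟩ := hx
    rw [barComplex_level, totF_lof]
    exact ⟨_, rfl⟩
  map_word {n} α := by
    obtain ⟨⟨⟨p, q⟩, r⟩, hs, hr⟩ := α
    dsimp only at hs hr
    change T.totF K (DirectSum.lof K ℕ (T.CS K) n (T.csBasis K n ⟨((p, q), r), hs, hr⟩)) =
      (n * p.1.degree).negOnePow • T.totBarLeft K (p.cls K) (T.totF K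
        (DirectSum.lof K ℕ (T.CS K) n (T.cs K n (T.idem K q.1.tgt) q (r.cls K))))
    rw [totF_lof, totF_lof, totBarLeft_lof, ← map_sign_smul, csBasis_apply,
      compF_cs K p q r hs hr, compF_idem K q r hr, map_sign_smul (T.barLeft K n _), barLeft_barLin, smul_smul,
      ← Int.negOnePow_add, fTuple_last, Bp.cls_triv, ← hs, Bp.cls_mul_idem_src, update_fTuple]
  map_gen {n} α := by
    obtain ⟨⟨⟨p, q⟩, r⟩, hs, hr⟩ := α
    dsimp only at hs hr
    change T.totF K (DirectSum.lof K ℕ (T.CS K) n (T.cs K n (T.idem K q.1.tgt) q (r.cls K))) =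
      T.totBarContr K (T.totF K (T.totCSDiff K (DirectSum.lof K ℕ (T.CS K) n
        (T.cs K n (T.idem K q.1.tgt) q (r.cls K))))) + DirectSum.lof K ℕ (T.Bar K) 0 (T.barUnit K
        (T.totCSAug K (DirectSum.lof K ℕ (T.CS K) n (T.cs K n (T.idem K q.1.tgt) q (r.cls K)))))
    cases n with
    | zero =>
      have hq : q.1.src = q.1.tgt := by rw [q.eq_vertex]; rfl
      have hq' : T.cls K q.1 = T.idem K q.1.tgt := by rw [q.eq_vertex]; rfl
      have h1 : T.idem K q.1.tgt * r.cls K = r.cls K := by rw [← hq, hr, Bp.idem_tgt_mul_cls]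
      rw [totCSDiff_lof_zero, map_zero, map_zero, zero_add, totCSAug_lof_zero, csAug_cs, hq',
        mul_assoc, h1, h1, totF_lof, compF_idem K q r hr, barUnit_apply,
        ← barLin_zero_idem K (r.cls K) q.1.tgt h1]
      have h2 : q.sigma = 0 := rfl
      rw [h2, Int.negOnePow_zero, one_smul]
      congr 2
      funext j
      fin_cases j
      · exact fTuple_zero K _ _ _
      · exact fTuple_last K _ _ _
    | succ n =>
      rw [totCSAug_lof_succ, map_zero, map_zero, add_zero, totF_lof, compF_idem_succ K q r hr,
        totCSDiff_lof_succ]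
      classical
      -- Of the differential of a generator only the first summand acquires a nontrivial left
      -- factor. The other summands keep the idempotent and vanish under the contraction after `F`.
      rw [csDiff_cs, q.tgt_eq, idem_mul_arr, ← q.tgt_eq]
      simp only [map_add, map_sub, map_smul]
      have h1 := totBarContr_totF_idem K q.init (T.arr K q.last * r.cls K)
      rw [Gam.init_tgt] at h1
      rw [h1, smul_zero, add_zero, totF_lof, totBarContr_lof]
      split_ifs with hsp
      · have h2 := totBarContr_totF_idem K q.tail (r.cls K)
        have h3 : q.tail.1.tgt = q.1.tgt := by rw [hsp.1.tail_eq_init, Gam.init_tgt]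
        rw [h3] at h2
        rw [h2, sub_zero]
      · simp only [map_zero, sub_zero]

/-! ### The map `G` -/

theorem compG_zero (α : T.BarWord 0) : T.compG K 0 (T.barBasis K 0 α) =
    T.cs K 0 (α.lead.cls K) (Gam.vertex T α.lead.1.src) ((α.tuple 0).cls K) := by
  rw [compG, Module.Basis.constr_basis]
  rfl

theorem compG_one (α : T.BarWord 1) : T.compG K 1 (T.barBasis K 1 α) =
    α.lead.1.degree.negOnePow • T.csLeft K 1 (α.lead.cls K)
      (T.csDer K (α.tuple 1).1.arrows ((α.tuple 0).cls K)) := by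
  rw [compG, Module.Basis.constr_basis, csDer_apply, map_sum]
  simp only [csLeft_cs]
  rfl

/-- The sign exponent `σ(α)`. -/
def BarWord.sigma {n : ℕ} (α : T.BarWord n) : ℤ :=
  SkewGentleTriple.sigma n fun j => if h : j < n + 2 then (α.path ⟨j, h⟩).degree else 0

theorem compG_pos {n : ℕ} (α : T.BarWord (n + 2)) (γ : T.Gam (n + 2))
    (h : γ.1.arrows = coreList α) : T.compG K (n + 2) (T.barBasis K (n + 2) α) =
      ((n + 2 : ℕ) * α.lead.1.degree + α.sigma).negOnePow • T.cs K (n + 2)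
        (α.lead.cls K * T.listProd K (α.path ⟨n + 2, by omega⟩).arrows.dropLast) γ
        (T.listProd K (α.path ⟨1, by omega⟩).arrows.tail * (α.tuple 0).cls K) := by
  have hex : ∃ γ : T.Gam (n + 2), γ.1.arrows = coreList α := ⟨γ, h⟩
  rw [compG, Module.Basis.constr_basis]
  refine (dif_pos hex).trans ?_
  rw [Gam.ext_arrows (hex.choose_spec.trans h.symm)]
  rfl

theorem compG_neg {n : ℕ} (α : T.BarWord (n + 2))
    (h : ∀ γ : T.Gam (n + 2), γ.1.arrows ≠ coreList α) :
    T.compG K (n + 2) (T.barBasis K (n + 2) α) = 0 := by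
  rw [compG, Module.Basis.constr_basis]
  exact dif_neg fun ⟨γ, hγ⟩ => h γ hγ

theorem totG_lof (n : ℕ) (x : T.Bar K n) : T.totG K (DirectSum.lof K ℕ (T.Bar K) n x) =
    DirectSum.lof K ℕ (T.CS K) n (T.compG K n x) := DirectSum.lmap_lof _ _ _

namespace BarWord

theorem gen_path {n : ℕ} (α : T.BarWord n) {j : ℕ} (hj : j < n + 2) (hn : j ≤ n) :
    α.gen.path ⟨j, hj⟩ = α.path ⟨j, hj⟩ := by
  rw [path_eq, path_eq, gen_tuple, Function.update_of_ne]
  intro h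
  have := congrArg Fin.val h
  simp only [Fin.val_last] at this
  omega

theorem shift_path {n : ℕ} (α : T.BarWord n) (h : α.lead.1.arrows ≠ []) {j : ℕ}
    (hj : j < n + 2) : (α.shift h).path ⟨j, hj.trans (Nat.lt_succ_self _)⟩ = α.path ⟨j, hj⟩ := by
  rw [path_eq, path_eq, shift_tuple]
  exact congrArg Subtype.val (Fin.snoc_castSucc (α := fun _ => T.Bp) _ _ ⟨j, hj⟩)

theorem sigma_gen {n : ℕ} (α : T.BarWord n) : α.gen.sigma = α.sigma := by
  refine sigma_congr fun j _ hj => ?_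
  have : j < n + 2 := by omega
  rw [dif_pos this, dif_pos this, gen_path α this hj]

/-- The old leading factor becomes the inner factor `n + 1`. Its contribution `n |α_{n+1}|` is the
sign of `G` for that factor as a left multiplier in length `n`. -/
theorem sigma_shift {n : ℕ} (α : T.BarWord n) (h : α.lead.1.arrows ≠ []) :
    (α.shift h).sigma = n * α.lead.1.degree + α.sigma := by
  rw [sigma, SkewGentleTriple.sigma_succ, add_comm]
  congr 1
  · rw [dif_pos (by omega), shift_path α h (show n + 1 < n + 2 by omega)]
    rfl
  · refine sigma_congr fun j _ hj => ?_
    have : j < n + 2 := by omega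
    rw [dif_pos (by omega), dif_pos this, shift_path α h this]

theorem coreList_gen {n : ℕ} (α : T.BarWord (n + 2)) : coreList α.gen = coreList α := by
  rw [coreList, coreList, gen_path α _ le_rfl, gen_path α _ (by omega)]
  congr 2
  refine List.flatMap_congr fun k _ => ?_
  rw [gen_path α _ (by omega)]

/-- The arrows of `α_{n-1} ⋯ α_2`, with `n + 2` in place of `n`. -/
def middle {n : ℕ} (α : T.BarWord (n + 2)) : List Ar :=
  (List.finRange n).reverse.flatMap fun k => (α.path ⟨k.val + 2, by omega⟩).arrows

theorem coreList_eq {n : ℕ} (α : T.BarWord (n + 2)) : coreList α =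
    (α.path ⟨n + 2, by omega⟩).arrows.getLast?.toList ++ α.middle ++
      (α.path ⟨1, by omega⟩).arrows.head?.toList := rfl

theorem coreList_shift {n : ℕ} (α : T.BarWord (n + 2)) (h : α.lead.1.arrows ≠ []) :
    coreList (α.shift h) = α.lead.1.arrows.getLast?.toList ++
      ((α.path ⟨n + 2, by omega⟩).arrows ++ α.middle) ++
        (α.path ⟨1, by omega⟩).arrows.head?.toList := by
  rw [coreList, shift_path α h (show n + 1 + 2 < n + 2 + 2 by omega),
    shift_path α h (show 1 < n + 2 + 2 by omega), List.finRange_succ_last, List.reverse_append,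
    List.reverse_singleton, List.singleton_append, List.flatMap_cons, ← List.map_reverse,
    List.flatMap_map]
  congr 3
  · exact congrArg Path.arrows (shift_path α h (show n + 2 < n + 2 + 2 by omega))
  · refine List.flatMap_congr fun k _ => ?_
    exact congrArg Path.arrows (shift_path α h (show k.val + 2 < n + 2 + 2 by omega))

theorem path_ne_nil {n : ℕ} (α : T.BarWord n) {j : ℕ} (hj : j < n + 2) (h0 : j ≠ 0)
    (hn : j ≠ n + 1) : (α.path ⟨j, hj⟩).arrows ≠ [] := by
  refine α.tuple_ne_nil ⟨j, hj⟩ ?_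
  rintro (h | h)
  · exact h0 (congrArg Fin.val h)
  · exact hn (congrArg Fin.val h)

/-- Each of the `n` middle factors has at least one arrow. Together with the length prescribed in
`Γ`, this forces factors to be single arrows. -/
theorem le_length_middle {n : ℕ} (α : T.BarWord (n + 2)) : n ≤ α.middle.length := by
  rw [middle, List.length_flatMap]
  have h : ∀ l : List (Fin n),
      l.length ≤ (l.map fun k => (α.path ⟨k.val + 2, by omega⟩).arrows.length).sum := by
    intro l
    induction l with
    | nil => simp
    | cons k l ih =>
      have := List.length_pos_of_ne_nil
        (α.path_ne_nil (j := k.val + 2) (by omega) (by omega) (by omega))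
      rw [List.map_cons, List.sum_cons, List.length_cons]
      omega
  refine le_trans ?_ (h _)
  simp

end BarWord

theorem csLeft_idem_csDer (p : T.Bp) (b : T.Alg K) :
    T.csLeft K 1 (T.idem K p.1.tgt) (T.csDer K p.1.arrows b) = T.csDer K p.1.arrows b := by
  obtain ⟨⟨j, l, i, hl⟩, hc⟩ := p
  cases l with
  | nil => rw [csDer_nil, map_zero]
  | cons a l =>
    obtain rfl : T.t a = j := hl.1
    dsimp only
    rw [csDer_cons, map_add, csLeft_cs, ← csLeft_mul, idem_mul_arr, mul_one, cs_one]
    rfl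

theorem cs_idem_mul_listProd {n : ℕ} (p : T.Bp) {l : List Ar} (γ : T.Gam (n + 1))
    (h : p.1.arrows = l ++ [γ.first]) (b : T.Alg K) :
    T.cs K (n + 1) (T.idem K p.1.tgt * T.listProd K l) γ b =
      T.cs K (n + 1) (T.listProd K l) γ b := by
  have hp := p.1.isPath
  rw [h] at hp
  cases l with
  | nil =>
    rw [listProd_nil, mul_one, cs_one, γ.tgt_eq]
    rw [show p.1.tgt = T.t γ.first from hp.1.symm]
  | cons a l =>
    rw [listProd_cons, ← mul_assoc, show p.1.tgt = T.t a from hp.1.symm, idem_mul_arr]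

theorem compG_shift_zero (β : T.BarWord 0) (h : β.lead.1.arrows ≠ []) :
    T.compG K 1 (T.barBasis K 1 (β.shift h)) = T.csContr K 0 (T.compG K 0 (T.barBasis K 0 β)) := by
  rw [compG_zero, csContr_zero K _ _ rfl, compG_one, BarWord.shift_lead, Bp.triv_degree,
    Int.negOnePow_zero, one_smul, Bp.cls_triv]
  exact csLeft_idem_csDer K β.lead _

theorem compG_shift_one (β : T.BarWord 1) (h : β.lead.1.arrows ≠ []) :
    T.compG K 2 (T.barBasis K 2 (β.shift h)) = T.csContr K 1 (T.compG K 1 (T.barBasis K 1 β)) := by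
  obtain ⟨l, x, hx⟩ : ∃ l x, β.lead.1.arrows = l ++ [x] :=
    ⟨_, _, (List.dropLast_append_getLast h).symm⟩
  obtain ⟨a, m, hm⟩ : ∃ a m, (β.tuple 1).1.arrows = a :: m :=
    List.exists_cons_of_ne_nil (β.tuple_ne_nil 1 (by simp [Fin.ext_iff]))
  have hpath : (β.shift h).path ⟨1, by omega⟩ = (β.tuple 1).1 :=
    β.shift_path h (show 1 < 1 + 2 by omega)
  have hpath' : (β.shift h).path ⟨0 + 2, by omega⟩ = β.lead.1 :=
    β.shift_path h (show 2 < 1 + 2 by omega)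
  have hcore : coreList (β.shift h) = [x, a] := by
    rw [coreList, hpath, hpath', hx, hm]
    simp
  -- `G` in length one is a sum over the arrows of `α_1`. Only the summand of its first arrow can
  -- survive the contraction, since in the others that arrow is preceded by one with which it has no
  -- relation.
  have hzero : T.csContr K 1 (T.csLeft K 1 (β.lead.cls K)
      (T.csLeft K 1 (T.arr K a) (T.csDer K m ((β.tuple 0).cls K)))) = 0 := by
    rw [← csLeft_mul, csDer_apply, map_sum, map_sum]
    refine Finset.sum_eq_zero fun i _ => ?_
    rw [csLeft_cs, mul_assoc, ← listProd_cons]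
    refine csContr_mul_eq_zero K β.lead (β.tuple 1) (m := m.drop (i + 1)) _ ?_ (by simp) _
    rw [hm, List.cons_append]
    congr 1
    conv_lhs => rw [← List.take_append_drop i m, List.drop_eq_getElem_cons i.2]
    rfl
  rw [compG_one, hm, csDer_cons, map_sign_smul, map_add, map_add, hzero, add_zero, csLeft_cs,
    mul_one]
  -- The surviving summand is extended by the last arrow `x` of the leading path exactly when `x a`
  -- lies in `Γ_2`, which is the condition in the definition of `G`.
  by_cases hγ : ∃ γ : T.Gam 2, γ.1.arrows = [x, a]
  · obtain ⟨γ, hγ⟩ := hγ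
    have h1 : γ.first = x := by simp [Gam.first, hγ]
    have h2 : γ.tail = Gam.arrow T a := Gam.ext_arrows (by
      change γ.1.arrows.tail = [a]
      rw [hγ]; rfl)
    rw [compG_pos K _ γ (hγ.trans hcore.symm), hpath, hpath', ← h2,
      csContr_succ_pos K β.lead γ (by rw [hx, h1]; simp), BarWord.shift_lead, Bp.triv_degree,
      Bp.cls_triv, mul_zero, zero_add (BarWord.sigma _), BarWord.sigma_shift, hm, hx,
      List.dropLast_concat, List.tail_cons]
    rw [cs_idem_mul_listProd K β.lead γ (by rw [hx, h1])]
    congr 2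
    simp [BarWord.sigma, sigma]
  · push Not at hγ
    rw [compG_neg K _ (by rw [hcore]; exact hγ), csContr_succ_neg, smul_zero]
    intro γ h1 h2
    refine absurd ?_ (hγ γ)
    rw [γ.arrows_eq, h1]
    rw [hx] at h2
    simp only [List.getLast?_append, List.getLast?_singleton, Option.some_or,
      Option.some.injEq] at h2
    rw [← h2]
    rfl

theorem compG_shift_add_two {n : ℕ} (β : T.BarWord (n + 2)) (h : β.lead.1.arrows ≠ []) :
    T.compG K (n + 3) (T.barBasis K (n + 3) (β.shift h)) =
      T.csContr K (n + 2) (T.compG K (n + 2) (T.barBasis K (n + 2) β)) := by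
  obtain ⟨l, x, hx⟩ : ∃ l x, β.lead.1.arrows = l ++ [x] :=
    ⟨_, _, (List.dropLast_append_getLast h).symm⟩
  have hlast : β.lead.1.arrows.getLast? = some x := by rw [hx]; simp
  obtain ⟨m, y, hy⟩ : ∃ m y, (β.path ⟨n + 2, by omega⟩).arrows = m ++ [y] :=
    ⟨_, _, (List.dropLast_append_getLast
      (β.path_ne_nil (j := n + 2) (by omega) (by omega) (by omega))).symm⟩
  have hpath : (β.shift h).path ⟨1, by omega⟩ = β.path ⟨1, by omega⟩ :=
    β.shift_path h (show 1 < n + 2 + 2 by omega)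
  have hpath' : (β.shift h).path ⟨n + 1 + 2, by omega⟩ = β.lead.1 :=
    β.shift_path h (show n + 3 < n + 2 + 2 by omega)
  have hzero : (β.shift h).tuple 0 = β.tuple 0 := by
    rw [BarWord.shift_tuple]
    exact Fin.snoc_castSucc (α := fun _ => T.Bp) _ _ 0
  have hcore := β.coreList_eq
  have hcore' := β.coreList_shift h
  rw [hy] at hcore hcore'
  rw [hlast] at hcore'
  simp only [List.getLast?_append, List.getLast?_singleton, Option.some_or,
    Option.toList_some, List.append_assoc, List.cons_append, List.nil_append] at hcore hcore'
  by_cases hγ' : ∃ γ' : T.Gam (n + 3), γ'.1.arrows = coreList (β.shift h)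
  · obtain ⟨γ, hγ⟩ := hγ'
    -- The core list has `n + 3` entries: one from the leading path, one from `α_1`, the arrow `y`,
    -- those of `m`, and at least `n` middle ones.
    have hm : m = [] := by
      have h1 := γ.2.1
      rw [hγ, hcore'] at h1
      have h2 := β.le_length_middle
      have h3 : (β.path ⟨1, by omega⟩).arrows.head?.toList.length = 1 := by
        obtain ⟨b, k, hk⟩ := List.exists_cons_of_ne_nil
          (β.path_ne_nil (j := 1) (by omega) (by omega) (by omega))
        rw [hk]; rfl
      simp only [List.length_cons, List.length_append] at h1
      exact List.length_eq_zero_iff.1 (by omega)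
    subst hm
    rw [List.nil_append, ← hcore] at hcore'
    have h1 : γ.first = x := by simp [Gam.first, hγ, hcore']
    have h2 : γ.tail.1.arrows = coreList β := by
      change γ.1.arrows.tail = _
      rw [hγ, hcore']; rfl
    rw [compG_pos K _ γ hγ, compG_pos K β γ.tail h2, map_sign_smul, hy, List.nil_append,
      List.dropLast_singleton, listProd_nil, mul_one,
      csContr_succ_pos K β.lead γ (by rw [hlast, h1]), hpath, hpath', hzero,
      BarWord.shift_lead, Bp.triv_degree, Bp.cls_triv, mul_zero, zero_add, BarWord.sigma_shift,
      hx, List.dropLast_concat, cs_idem_mul_listProd K β.lead γ (by rw [hx, h1])]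
  · push Not at hγ'
    rw [compG_neg K _ hγ']
    by_cases hγ : ∃ γ : T.Gam (n + 2), γ.1.arrows = coreList β
    · obtain ⟨γ, hγ⟩ := hγ
      rw [compG_pos K β γ hγ, map_sign_smul, hy, List.dropLast_concat]
      have h1 : γ.first = y := by simp [Gam.first, hγ, hcore]
      -- The old core lies in `Γ` but the new one does not. Either `x` cannot be prepended, or the
      -- factor `m y` has arrows before `y`; these remain in the left factor and block the
      -- contraction.
      by_cases hm : m = []
      · subst hm
        rw [List.nil_append, ← hcore] at hcore'
        rw [listProd_nil, mul_one, csContr_succ_neg, smul_zero]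
        intro γ' h2 h3
        refine hγ' γ' ?_
        rw [γ'.arrows_eq, h2, hγ, hcore', Option.some.inj (h3.symm.trans hlast)]
      · rw [csContr_mul_eq_zero K β.lead (β.tuple ⟨n + 2, by omega⟩) (m := []) γ
          (by rw [h1]; exact hy) hm, smul_zero]
    · push Not at hγ
      rw [compG_neg K _ hγ, map_zero]

theorem compG_shift {n : ℕ} (β : T.BarWord n) (h : β.lead.1.arrows ≠ []) :
    T.compG K (n + 1) (T.barBasis K (n + 1) (β.shift h)) =
      T.csContr K n (T.compG K n (T.barBasis K n β)) := by
  match n, β, h with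
  | 0, β, h => exact compG_shift_zero K β h
  | 1, β, h => exact compG_shift_one K β h
  | _ + 2, β, h => exact compG_shift_add_two K β h

/-- `G` of a contraction is zero or a contraction, and contracting twice on `T_*` gives zero. -/
theorem csContr_compG_barContr {n : ℕ} (x : T.Bar K n) :
    T.csContr K (n + 1) (T.compG K (n + 1) (T.barContr K n x)) = 0 := by
  refine LinearMap.congr_fun (f := T.csContr K (n + 1) ∘ₗ T.compG K (n + 1) ∘ₗ T.barContr K n)
    (g := 0) ((T.barBasis K n).ext fun β => ?_) x
  rw [LinearMap.comp_apply, LinearMap.comp_apply, LinearMap.zero_apply]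
  by_cases h : β.lead.1.arrows = []
  · rw [barBasis_eq, barContr_eq_zero K β.lead.1.src (congrArg (Bp.cls K) (Bp.eq_triv h)),
      map_zero, map_zero]
  · rw [barContr_word K β h, compG_shift, csContr_csContr]

theorem compG_barUnit (a : T.Alg K) : T.compG K 0 (T.barUnit K a) = T.csUnit K a := by
  refine LinearMap.congr_fun (f := T.compG K 0 ∘ₗ T.barUnit K) (g := T.csUnit K)
    ((T.basis K).ext fun p => ?_) a
  rw [LinearMap.comp_apply, basis_apply, barUnit_apply,
    ← barLin_zero_idem K (p.cls K) p.1.tgt (Bp.idem_tgt_mul_cls K p)]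
  have := compG_zero K (BarWord.mk (n := 0) ![p, Bp.triv T p.1.tgt]
    (fun i hi => absurd (by fin_cases i; exacts [Or.inl rfl, Or.inr rfl]) hi)
    (fun j => by
      obtain rfl : j = 0 := Subsingleton.elim (α := Fin 1) _ _
      rfl))
  rw [csUnit_eq K p.1.tgt _ (Bp.idem_tgt_mul_cls K p), cs_one]
  rw [barBasis_eq] at this
  refine Eq.trans (congrArg (fun y => T.compG K 0 (T.barLin K 0 y)) ?_) this
  funext j
  fin_cases j <;> rfl

theorem csContr_csUnit (a : T.Alg K) : T.csContr K 0 (T.csUnit K a) = 0 := by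
  rw [csUnit_apply, map_sum]
  exact Finset.sum_eq_zero fun v _ => csContr_one K _ _

theorem compG_gen {n : ℕ} (α : T.BarWord n) : T.compG K n (T.barBasis K n α) =
    (n * α.lead.1.degree).negOnePow • T.csLeft K n (α.lead.cls K)
      (T.compG K n (T.barBasis K n α.gen)) := by
  have hzero : α.gen.tuple 0 = α.tuple 0 := by
    rw [BarWord.gen_tuple, Function.update_of_ne (by simp [Fin.ext_iff])]
  match n, α with
  | 0, α =>
    rw [compG_zero, compG_zero, csLeft_cs, BarWord.gen_lead, Bp.cls_triv, Bp.cls_mul_idem_src,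
      hzero]
    simp [Bp.triv_src]
  | 1, α =>
    have h1 : (α.gen.tuple 1).1 = (α.tuple 1).1 := α.gen_path (show 1 < 1 + 2 by omega) le_rfl
    rw [compG_one, compG_one, map_sign_smul, ← csLeft_mul, BarWord.gen_lead, Bp.cls_triv,
      Bp.cls_mul_idem_src, hzero, h1, Bp.triv_degree, Int.negOnePow_zero, one_smul, Nat.cast_one,
      one_mul]
  | n + 2, α =>
    by_cases hγ : ∃ γ : T.Gam (n + 2), γ.1.arrows = coreList α
    · obtain ⟨γ, hγ⟩ := hγ
      rw [compG_pos K α γ hγ, compG_pos K α.gen γ (hγ.trans α.coreList_gen.symm),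
        map_sign_smul, csLeft_cs, ← mul_assoc, BarWord.gen_lead, Bp.cls_triv, Bp.cls_mul_idem_src,
        hzero, α.gen_path _ le_rfl, α.gen_path _ (by omega), Bp.triv_degree, mul_zero, zero_add,
        α.sigma_gen, smul_smul, ← Int.negOnePow_add]
    · push Not at hγ
      rw [compG_neg K α hγ, compG_neg K α.gen (by rwa [α.coreList_gen]), map_zero, smul_zero]

theorem comparison_totG :
    ContractedComplex.Comparison (T.barComplex K) (T.csComplex K) (T.totG K) where
  parity_eq := ⟨1, rfl⟩
  map_level n x hx := by
    rw [barComplex_level] at hx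
    obtain ⟨x, rfl⟩ := hx
    rw [csComplex_level, totG_lof]
    exact ⟨_, rfl⟩
  map_word {n} α := by
    change T.BarWord n at α
    change T.totG K (DirectSum.lof K ℕ (T.Bar K) n (T.barBasis K n α)) =
      (n * α.lead.1.degree).negOnePow • T.totCSLeft K (α.lead.cls K) (T.totG K
        (DirectSum.lof K ℕ (T.Bar K) n (T.barBasis K n α.gen)))
    rw [totG_lof, totG_lof, totCSLeft_lof, ← map_sign_smul, compG_gen]
  map_gen {n} α := by
    change T.BarWord n at α
    change T.totG K (DirectSum.lof K ℕ (T.Bar K) n (T.barBasis K n α.gen)) =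
      T.totCSContr K (T.totG K (T.totBarDiff K
        (DirectSum.lof K ℕ (T.Bar K) n (T.barBasis K n α.gen)))) +
      DirectSum.lof K ℕ (T.CS K) 0 (T.csUnit K (T.totBarAug K
        (DirectSum.lof K ℕ (T.Bar K) n (T.barBasis K n α.gen))))
    cases n with
    | zero =>
      rw [totBarDiff_lof_zero, map_zero, map_zero, zero_add, totBarAug_lof_zero, barAug_word,
        totG_lof, compG_zero]
      have h1 : α.gen.tuple 1 = Bp.triv T α.lead.1.src := α.gen_lead
      have h2 : (α.gen.tuple 0).1.tgt = α.lead.1.src := by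
        have := α.gen.tuple_comp 0
        rw [show (0 : Fin 1).succ = 1 from rfl, h1] at this
        exact this
      have h3 : T.idem K α.lead.1.src * (α.gen.tuple 0).cls K = (α.gen.tuple 0).cls K := by
        rw [← h2, Bp.idem_tgt_mul_cls]
      rw [h1, Bp.cls_triv, h3, csUnit_eq K α.lead.1.src _ h3, cs_one, BarWord.gen_lead]
      rfl
    | succ n =>
      -- Write the generator as `s β`. Then `d s β = β - u ε β - s d β`, and `s G` kills the last
      -- two terms. What remains is `s G d s β = s G β = G s β`, the recursion for `G`.
      have h1 := (T.barComplex K).homotopy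
        (DirectSum.lof K ℕ (T.Bar K) n (T.barBasis K n α.unshift))
      change T.totBarDiff K (T.totBarContr K _) + T.totBarContr K (T.totBarDiff K _) =
        _ - DirectSum.lof K ℕ (T.Bar K) 0 (T.barUnit K _) at h1
      rw [totBarContr_lof, barContr_word K _ α.unshift_lead_ne_nil] at h1
      have h2 : ∀ y, T.totCSContr K (T.totG K (T.totBarContr K y)) = 0 := by
        refine LinearMap.congr_fun (f := T.totCSContr K ∘ₗ T.totG K ∘ₗ T.totBarContr K) (g := 0)
          (DirectSum.linearMap_ext _ fun n => LinearMap.ext fun x => ?_)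
        simp only [LinearMap.comp_apply, totBarContr_lof, totG_lof, totCSContr_lof,
          csContr_compG_barContr, map_zero, LinearMap.zero_apply]
      rw [totBarAug_lof_succ, map_zero, map_zero, add_zero, α.gen_eq_shift, eq_sub_of_add_eq h1,
        map_sub, map_sub, map_sub, map_sub, h2, sub_zero, totG_lof, totG_lof, totG_lof,
        totCSContr_lof, totCSContr_lof, compG_barUnit, csContr_csUnit, map_zero, sub_zero,
        compG_shift]

/-! ### The homotopy -/

variable (T) in
/-- The components of the homotopy from `F G` to the identity. -/
def compH : ∀ n : ℕ, T.Bar K n →ₗ[K] T.Bar K (n + 1)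
  | 0 => (T.barBasis K 0).constr K fun α =>
      α.lead.1.degree.negOnePow • T.barLeft K 1 (α.lead.cls K) (T.barContr K 0
        (T.barBasis K 0 α.gen - T.compF K 0 (T.compG K 0 (T.barBasis K 0 α.gen))))
  | n + 1 => (T.barBasis K (n + 1)).constr K fun α =>
      α.lead.1.degree.negOnePow • T.barLeft K (n + 2) (α.lead.cls K) (T.barContr K (n + 1)
        (T.barBasis K (n + 1) α.gen - T.compF K (n + 1) (T.compG K (n + 1)
          (T.barBasis K (n + 1) α.gen)) - compH n (T.barDiff K n (T.barBasis K (n + 1) α.gen))))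

variable (T) in
/-- The homotopy from `F G` to the identity. -/
def totH : T.TotBar K →ₗ[K] T.TotBar K :=
  DirectSum.toModule K ℕ _ fun n => DirectSum.lof K ℕ (T.Bar K) (n + 1) ∘ₗ T.compH K n

theorem totH_lof (n : ℕ) (x : T.Bar K n) :
    T.totH K (DirectSum.lof K ℕ (T.Bar K) n x) =
      DirectSum.lof K ℕ (T.Bar K) (n + 1) (T.compH K n x) := by
  rw [totH, DirectSum.toModule_lof, LinearMap.comp_apply]

theorem totH_basis {n : ℕ} (α : T.BarWord n) :
    T.totH K (DirectSum.lof K ℕ (T.Bar K) n (T.barBasis K n α)) =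
      α.lead.1.degree.negOnePow • T.totBarLeft K (α.lead.cls K) (T.totBarContr K
        (DirectSum.lof K ℕ (T.Bar K) n (T.barBasis K n α.gen) -
          T.totF K (T.totG K (DirectSum.lof K ℕ (T.Bar K) n (T.barBasis K n α.gen))) -
          T.totH K (T.totBarDiff K (DirectSum.lof K ℕ (T.Bar K) n (T.barBasis K n α.gen))))) := by
  cases n with
  | zero =>
    rw [totH_lof, compH, Module.Basis.constr_basis, totBarDiff_lof_zero, map_zero, sub_zero,
      totG_lof, totF_lof, ← map_sub, totBarContr_lof, totBarLeft_lof, map_sign_smul]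
  | succ n =>
    rw [totH_lof, compH, Module.Basis.constr_basis, totBarDiff_lof_succ, totH_lof,
      totG_lof, totF_lof, ← map_sub, ← map_sub, totBarContr_lof, totBarLeft_lof, map_sign_smul]

/-- The contraction is not left linear over `A`, but it is over `E`: an idempotent moves from the
new leading factor `1` to the old one. -/
theorem barLeft_idem_barContr {n : ℕ} (v : V) (x : T.Bar K n) :
    T.barLeft K (n + 1) (T.idem K v) (T.barContr K n x) =
      T.barContr K n (T.barLeft K n (T.idem K v) x) := by
  refine LinearMap.congr_fun (f := T.barLeft K (n + 1) (T.idem K v) ∘ₗ T.barContr K n)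
    (g := T.barContr K n ∘ₗ T.barLeft K n (T.idem K v)) ((T.barBasis K n).ext fun α => ?_) x
  rw [LinearMap.comp_apply, LinearMap.comp_apply, barBasis_eq, ← barLin_snoc, barLeft_barLin,
    barContr_barLin]
  have := barLin_balance K (Fin.snoc (α := fun _ => T.Alg K) (fun j => (α.tuple j).cls K) 1)
    (Fin.last (n + 1)) v
  rw [Fin.succ_last, Fin.snoc_last, one_mul, Fin.update_snoc_last, Fin.snoc_castSucc] at this
  rw [this, Fin.snoc_update]

theorem totBarLeft_idem_totBarContr (v : V) (x : T.TotBar K) :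
    T.totBarLeft K (T.idem K v) (T.totBarContr K x) =
      T.totBarContr K (T.totBarLeft K (T.idem K v) x) := by
  refine LinearMap.congr_fun (f := T.totBarLeft K (T.idem K v) ∘ₗ T.totBarContr K)
    (g := T.totBarContr K ∘ₗ T.totBarLeft K (T.idem K v)) (totBar_ext K fun n α => ?_) x
  simp only [LinearMap.comp_apply, totBarContr_lof, totBarLeft_lof, barLeft_idem_barContr]

theorem totH_word {n : ℕ} (α : (T.barComplex K).Word n) :
    T.totH K ((T.barComplex K).word α) =
      (1 * ((T.barComplex K).lead α).1.degree).negOnePow • (T.barComplex K).act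
        (((T.barComplex K).lead α).cls K) (T.totH K ((T.barComplex K).gen α)) := by
  change T.BarWord n at α
  change T.totH K (DirectSum.lof K ℕ (T.Bar K) n (T.barBasis K n α)) =
    (1 * α.lead.1.degree).negOnePow • T.totBarLeft K (α.lead.cls K)
      (T.totH K (DirectSum.lof K ℕ (T.Bar K) n (T.barBasis K n α.gen)))
  have hm := fun a b x => (T.barComplex K).act_mul a b x
  change ∀ a b x, T.totBarLeft K (a * b) x = T.totBarLeft K a (T.totBarLeft K b x) at hm
  rw [totH_basis, totH_basis K α.gen, BarWord.gen_gen, BarWord.gen_lead, Bp.triv_degree,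
    Int.negOnePow_zero, one_smul, one_mul, ← hm, Bp.cls_triv, Bp.cls_mul_idem_src]

theorem totH_act {i : ℤ} {a : T.Alg K} (ha : a ∈ T.algDeg K i) (x : T.TotBar K) :
    T.totH K (T.totBarLeft K a x) = i.negOnePow • T.totBarLeft K a (T.totH K x) := by
  have := (T.barComplex K).hom_ext (f := T.totH K ∘ₗ T.totBarLeft K a)
    (g := i.negOnePow • T.totBarLeft K a ∘ₗ T.totH K) fun n x hx => by
      have h := (T.barComplex K).map_act (T.barComplex K) (T.totH K) 1 (totH_word K) ha hx
      rw [one_mul] at h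
      exact h
  exact LinearMap.congr_fun this x

theorem idem_mem_algDeg (v : V) : T.idem K v ∈ T.algDeg K 0 := by
  have := Bp.cls_mem_algDeg K (Bp.triv T v)
  rwa [Bp.triv_degree] at this

/-- The definition of `h` on a generator has an additional left factor, the idempotent that leads
the generator. It can be removed: idempotents have degree `0` and commute without sign with all maps
in the recursion, and this one fixes the generator. -/
theorem totH_gen {n : ℕ} (α : (T.barComplex K).Word n) :
    T.totH K ((T.barComplex K).gen α) = (T.barComplex K).contr ((T.barComplex K).gen α -
      T.totF K (T.totG K ((T.barComplex K).gen α)) -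
      T.totH K ((T.barComplex K).diff ((T.barComplex K).gen α))) := by
  change T.BarWord n at α
  have hgen : T.totBarLeft K (T.idem K α.lead.1.src)
      (DirectSum.lof K ℕ (T.Bar K) n (T.barBasis K n α.gen)) =
        DirectSum.lof K ℕ (T.Bar K) n (T.barBasis K n α.gen) := by
    have := (T.barComplex K).word_eq α.gen
    change DirectSum.lof K ℕ (T.Bar K) n (T.barBasis K n α.gen) =
      T.totBarLeft K (α.gen.lead.cls K)
        (DirectSum.lof K ℕ (T.Bar K) n (T.barBasis K n α.gen.gen)) at this
    rw [BarWord.gen_gen, BarWord.gen_lead, Bp.cls_triv] at this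
    exact this.symm
  change T.totH K (DirectSum.lof K ℕ (T.Bar K) n (T.barBasis K n α.gen)) = T.totBarContr K
    (DirectSum.lof K ℕ (T.Bar K) n (T.barBasis K n α.gen) -
      T.totF K (T.totG K (DirectSum.lof K ℕ (T.Bar K) n (T.barBasis K n α.gen))) -
      T.totH K (T.totBarDiff K (DirectSum.lof K ℕ (T.Bar K) n (T.barBasis K n α.gen))))
  have he := idem_mem_algDeg K (T := T) α.lead.1.src
  have hG := (comparison_totG K (T := T)).map_act he ((T.barComplex K).gen_mem α)
  have hF := (comparison_totF K (T := T)).map_act he ((comparison_totG K (T := T)).map_level n _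
    ((T.barComplex K).gen_mem α))
  have hD := (T.barComplex K).diff_act he ((T.barComplex K).gen α)
  change T.totG K (T.totBarLeft K _ (DirectSum.lof K ℕ (T.Bar K) n (T.barBasis K n α.gen))) =
    _ • T.totCSLeft K _ (T.totG K (DirectSum.lof K ℕ (T.Bar K) n (T.barBasis K n α.gen))) at hG
  change T.totF K (T.totCSLeft K _ (T.totG K (DirectSum.lof K ℕ (T.Bar K) n
    (T.barBasis K n α.gen)))) = _ • T.totBarLeft K _ (T.totF K (T.totG K
      (DirectSum.lof K ℕ (T.Bar K) n (T.barBasis K n α.gen)))) at hF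
  change T.totBarDiff K (T.totBarLeft K _ (DirectSum.lof K ℕ (T.Bar K) n
    (T.barBasis K n α.gen))) = _ • T.totBarLeft K _ (T.totBarDiff K
      (DirectSum.lof K ℕ (T.Bar K) n (T.barBasis K n α.gen))) at hD
  rw [hgen, mul_zero, Int.negOnePow_zero, one_smul] at hG hD
  rw [mul_zero, Int.negOnePow_zero, one_smul, ← hG] at hF
  have hH := totH_act K he (T.totBarDiff K (DirectSum.lof K ℕ (T.Bar K) n (T.barBasis K n α.gen)))
  rw [← hD, Int.negOnePow_zero, one_smul] at hH
  rw [totH_basis, BarWord.gen_gen, BarWord.gen_lead, Bp.triv_degree, Int.negOnePow_zero, one_smul,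
    Bp.cls_triv, totBarLeft_idem_totBarContr, map_sub (T.totBarLeft K _), map_sub (T.totBarLeft K _),
    hgen, ← hF, ← hH]

theorem totH_homotopy : LinearMap.id - T.totF K ∘ₗ T.totG K =
    T.totBarDiff K ∘ₗ T.totH K + T.totH K ∘ₗ T.totBarDiff K :=
  (comparison_totF K).homotopy (comparison_totG K) rfl (totH_word K) (totH_gen K)

theorem totH_right (b : T.Alg K) (x : T.TotBar K) :
    T.totH K (T.totBarRight K b x) = T.totBarRight K b (T.totH K x) := by
  have hF := (isRightMul_totCSRight K b).comparison (isRightMul_totBarRight K b)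
    (comparison_totF K (T := T))
  have hG := (isRightMul_totBarRight K b).comparison (isRightMul_totCSRight K b)
    (comparison_totG K (T := T))
  refine LinearMap.congr_fun ((isRightMul_totBarRight K b).homotopy
    (k := T.totF K ∘ₗ T.totG K) (fun x => ?_) (totH_word K) (totH_gen K)) x
  have h1 := LinearMap.congr_fun hG x
  have h2 := LinearMap.congr_fun hF (T.totG K x)
  simp only [LinearMap.comp_apply] at h1 h2 ⊢
  rw [h1, h2]

/-! ### Degrees -/

theorem listProd_mem_algDeg (l : List Ar) : T.listProd K l ∈ T.algDeg K (l.map T.deg).sum := by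
  induction l with
  | nil => exact one_mem_algDeg K
  | cons a l ih =>
    rw [listProd_cons, List.map_cons, List.sum_cons]
    exact mul_mem_algDeg K (arr_mem_algDeg K a) ih

theorem cs_mem_csDeg {n : ℕ} {i k : ℤ} {a b : T.Alg K} (q : T.Gam n) (ha : a ∈ T.algDeg K i)
    (hb : b ∈ T.algDeg K k) {r : ℤ} (h : i + q.1.degree + k = r) :
    T.cs K n a q b ∈ T.csDeg K n r :=
  Submodule.subset_span ⟨i, k, a, b, q, ha, hb, h, rfl⟩

/-- The words of degree `r` span the component of degree `r`. -/
theorem csDeg_le {n : ℕ} {r : ℤ} {P : Submodule K (T.CS K n)}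
    (h : ∀ (p : T.Bp) (q : T.Gam n) (u : T.Bp), p.1.src = q.1.tgt → q.1.src = u.1.tgt →
      p.1.degree + q.1.degree + u.1.degree = r → T.cs K n (p.cls K) q (u.cls K) ∈ P) :
    T.csDeg K n r ≤ P := by
  refine Submodule.span_le.2 ?_
  rintro _ ⟨i, k, a, b, q, ha, hb, hr, rfl⟩
  rw [algDeg_eq_span] at ha hb
  have := Submodule.apply_mem_map₂ (T.csLin K n q) ha hb
  rw [Submodule.map₂_span_span] at this
  refine Submodule.span_le.2 ?_ this
  rintro _ ⟨_, ⟨p, hp, rfl⟩, _, ⟨u, hu, rfl⟩, rfl⟩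
  simp only [Set.mem_ofPred_eq] at hp hu
  simp only [basis_apply, csLin_apply]
  by_cases h1 : p.1.src = q.1.tgt
  · by_cases h2 : q.1.src = u.1.tgt
    · exact h p q u h1 h2 (by rw [hp, hu, hr])
    · rw [cs_eq_zero_right K u h2]; exact zero_mem _
  · rw [cs_eq_zero_left K p h1]; exact zero_mem _

theorem word_mem_barDeg {n : ℕ} {N : ℤ} (α : T.BarWord n)
    (h : ∑ j, (α.tuple j).1.degree - n = N) : T.barBasis K n α ∈ T.barDeg K n N :=
  Submodule.subset_span ⟨fun j => (α.tuple j).1.degree, _, cls_path_mem K α,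
    fun j => Bp.cls_mem_algDeg K (α.tuple j), h, barBasis_apply K n α⟩

/-- A submodule that contains the words of a given degree contains the tensors of that degree. -/
theorem barLin_mem {n : ℕ} {d : Fin (n + 2) → ℤ} {x : Fin (n + 2) → T.Alg K}
    (hx : ∀ j, x j ∈ T.algDeg K (d j)) {P : Submodule K (T.Bar K n)}
    (h : ∀ α : T.BarWord n, (∀ j, (α.tuple j).1.degree = d j) → T.barBasis K n α ∈ P) :
    T.barLin K n x ∈ P := by
  classical
  have hx' : x = fun j => ∑ p ∈ ((T.basis K).repr (x j)).support,
      (T.basis K).repr (x j) p • T.basis K p := by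
    funext j
    exact ((T.basis K).linearCombination_repr (x j)).symm
  rw [hx', MultilinearMap.map_sum_finset]
  refine Submodule.sum_mem _ fun b hb => ?_
  rw [MultilinearMap.map_smul_univ]
  refine Submodule.smul_mem _ _ ?_
  have hd : ∀ j, (b j).1.degree = d j := by
    intro j
    have h1 := hx j
    -- The expansion of a homogeneous element involves only basis elements of its degree.
    rw [algDeg_eq_span, Module.Basis.mem_span_image] at h1
    exact h1 (Fintype.mem_piFinset.1 hb j)
  simp only [basis_apply]
  by_cases h1 : ∀ i, ¬(i = 0 ∨ i = Fin.last (n + 1)) → (b i).1.arrows ≠ []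
  · by_cases h2 : ∀ j : Fin (n + 1), (b j.castSucc).1.tgt = (b j.succ).1.src
    · have := h (BarWord.mk b h1 h2) hd
      rw [barBasis_eq] at this
      exact this
    · push Not at h2
      obtain ⟨j, hj⟩ := h2
      rw [barLin_eq_zero K j (b j.succ).1.src (Bp.cls_mul_idem_src K _)
        (Bp.idem_mul_cls_ne K _ hj)]
      exact zero_mem _
  · push Not at h1
    obtain ⟨i, h1, h2⟩ := h1
    rw [barLin_eq_zero_of_inner K i (not_or.2 h1) _ h2 rfl]
    exact zero_mem _

theorem barLin_mem_barDeg {n : ℕ} {d : Fin (n + 2) → ℤ} {x : Fin (n + 2) → T.Alg K}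
    (hx : ∀ j, x j ∈ T.algDeg K (d j)) {N : ℤ} (hN : ∑ j, d j - n = N) :
    T.barLin K n x ∈ T.barDeg K n N :=
  barLin_mem K hx fun α hα => word_mem_barDeg K α (by simp only [hα, hN])

/-- The words of degree `N` span the component of degree `N`. -/
theorem barDeg_le {n : ℕ} {N : ℤ} {P : Submodule K (T.Bar K n)}
    (h : ∀ α : T.BarWord n, ∑ j, (α.tuple j).1.degree - n = N → T.barBasis K n α ∈ P) :
    T.barDeg K n N ≤ P := by
  refine Submodule.span_le.2 ?_
  rintro _ ⟨d, x, hx, hd, hN, rfl⟩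
  rw [bar_eq_barLin]
  exact barLin_mem K hd fun α hα => h α (by simp only [hα, hN])

theorem sign_smul_mem {M : Type*} [AddCommGroup M] [Module K M] (P : Submodule K M) (u : ℤˣ)
    {x : M} (hx : x ∈ P) : u • x ∈ P := by
  rw [Units.smul_def]
  exact zsmul_mem hx _

/-- The contracted family is the given one with the entry `j` removed and added to the next, so the
total does not change. -/
theorem sum_contract (n : ℕ) (j : Fin (n + 2)) (d : Fin (n + 3) → ℤ) :
    ∑ k : Fin (n + 2), (if k < j then d k.castSucc else if k = j then d k.succ + d k.castSucc
      else d k.succ) = ∑ k, d k := by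
  rw [Fin.sum_univ_succAbove d j.castSucc]
  have h : ∀ k : Fin (n + 2), (if k < j then d k.castSucc else if k = j then
      d k.succ + d k.castSucc else d k.succ) =
      (if k = j then d j.castSucc else 0) + d (j.castSucc.succAbove k) := by
    intro k
    rcases lt_trichotomy k j with hk | rfl | hk
    · rw [if_pos hk, if_neg hk.ne, zero_add, Fin.succAbove_of_castSucc_lt _ _ (by simpa using hk)]
    · rw [if_neg (lt_irrefl _), if_pos rfl, if_pos rfl, Fin.succAbove_of_le_castSucc _ _ le_rfl,
        add_comm]
    · rw [if_neg hk.not_gt, if_neg hk.ne', if_neg hk.ne', zero_add,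
        Fin.succAbove_of_le_castSucc _ _ (by simpa using hk.le)]
  rw [Finset.sum_congr rfl fun k _ => h k, Finset.sum_add_distrib, Finset.sum_ite_eq' Finset.univ j]
  simp

/-- The degrees of the factors keep their sum while one suspension, of degree `-1`, disappears. -/
theorem barDiff_mem {n : ℕ} {N : ℤ} {x : T.Bar K (n + 1)} (hx : x ∈ T.barDeg K (n + 1) N) :
    T.barDiff K n x ∈ T.barDeg K n (N + 1) := by
  refine barDeg_le K (P := (T.barDeg K n (N + 1)).comap (T.barDiff K n)) (fun α hα => ?_) hx
  rw [Submodule.mem_comap, barDiff_word]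
  refine Submodule.sum_mem _ fun j _ => sign_smul_mem K _ _ ?_
  refine barLin_mem_barDeg K (d := fun k => if k < j then (α.tuple k.castSucc).1.degree else
    if k = j then (α.tuple k.succ).1.degree + (α.tuple k.castSucc).1.degree
    else (α.tuple k.succ).1.degree) (fun k => ?_) ?_
  · simp only [contract]
    split_ifs
    · exact Bp.cls_mem_algDeg K _
    · exact mul_mem_algDeg K (Bp.cls_mem_algDeg K _) (Bp.cls_mem_algDeg K _)
    · exact Bp.cls_mem_algDeg K _
  · rw [sum_contract n j fun k => (α.tuple k).1.degree]
    push_cast at hα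
    linarith

theorem barContr_mem {n : ℕ} {N : ℤ} {x : T.Bar K n} (hx : x ∈ T.barDeg K n N) :
    T.barContr K n x ∈ T.barDeg K (n + 1) (N - 1) := by
  refine barDeg_le K (P := (T.barDeg K (n + 1) (N - 1)).comap (T.barContr K n))
    (fun α hα => ?_) hx
  rw [Submodule.mem_comap, barBasis_eq, barContr_barLin]
  refine barLin_mem_barDeg K (d := Fin.snoc (α := fun _ => ℤ) (fun j => (α.tuple j).1.degree) 0)
    (fun k => ?_) ?_
  · refine Fin.lastCases ?_ (fun k => ?_) k
    · rw [Fin.snoc_last, Fin.snoc_last]; exact one_mem_algDeg K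
    · rw [Fin.snoc_castSucc, Fin.snoc_castSucc]; exact Bp.cls_mem_algDeg K _
  · rw [Fin.sum_univ_castSucc]
    simp only [Fin.snoc_castSucc, Fin.snoc_last]
    push_cast
    linarith

theorem barLeft_mem {n : ℕ} {N i : ℤ} {a : T.Alg K} (ha : a ∈ T.algDeg K i) {x : T.Bar K n}
    (hx : x ∈ T.barDeg K n N) : T.barLeft K n a x ∈ T.barDeg K n (i + N) := by
  refine barDeg_le K (P := (T.barDeg K n (i + N)).comap (T.barLeft K n a)) (fun α hα => ?_) hx
  rw [Submodule.mem_comap, barBasis_eq, barLeft_barLin]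
  refine barLin_mem_barDeg K (d := fun j => (if j = Fin.last (n + 1) then i else 0) +
    (α.tuple j).1.degree) (fun k => ?_) ?_
  · by_cases h : k = Fin.last (n + 1)
    · subst h
      rw [Function.update_self, if_pos rfl]
      exact mul_mem_algDeg K ha (Bp.cls_mem_algDeg K _)
    · rw [Function.update_of_ne h, if_neg h, zero_add]
      exact Bp.cls_mem_algDeg K _
  · rw [Finset.sum_add_distrib, Finset.sum_ite_eq' Finset.univ, if_pos (Finset.mem_univ _)]
    linarith

theorem csLeft_mem {n : ℕ} {r i : ℤ} {a : T.Alg K} (ha : a ∈ T.algDeg K i) {x : T.CS K n}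
    (hx : x ∈ T.csDeg K n r) : T.csLeft K n a x ∈ T.csDeg K n (i + r) := by
  refine csDeg_le K (P := (T.csDeg K n (i + r)).comap (T.csLeft K n a))
    (fun p q u _ _ h => ?_) hx
  rw [Submodule.mem_comap, csLeft_cs]
  exact cs_mem_csDeg K q (mul_mem_algDeg K ha (Bp.cls_mem_algDeg K _)) (Bp.cls_mem_algDeg K _)
    (by linarith)

theorem Gam.degree_eq {n : ℕ} (q : T.Gam (n + 1)) :
    q.1.degree = T.deg q.first + q.tail.1.degree := by
  rw [Path.degree, q.arrows_eq, List.map_cons, List.sum_cons]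
  rfl

theorem Gam.degree_eq' {n : ℕ} (q : T.Gam (n + 1)) :
    q.1.degree = q.init.1.degree + T.deg q.last := by
  rw [Path.degree, q.arrows_eq', List.map_append, List.sum_append]
  simp [Path.degree]

theorem csDiff_mem {n : ℕ} {r : ℤ} {x : T.CS K (n + 1)} (hx : x ∈ T.csDeg K (n + 1) r) :
    T.csDiff K n x ∈ T.csDeg K n r := by
  classical
  refine csDeg_le K (P := (T.csDeg K n r).comap (T.csDiff K n)) (fun p q u _ _ h => ?_) hx
  rw [Submodule.mem_comap, csDiff_cs]
  have hp := Bp.cls_mem_algDeg K p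
  have hu := Bp.cls_mem_algDeg K u
  have h1 := q.degree_eq
  have h2 := q.degree_eq'
  refine sub_mem (add_mem ?_ (Submodule.smul_mem _ _ ?_)) ?_
  · exact cs_mem_csDeg K _ (mul_mem_algDeg K hp (arr_mem_algDeg K _)) hu (by linarith)
  · exact cs_mem_csDeg K _ hp (mul_mem_algDeg K (arr_mem_algDeg K _) hu) (by linarith)
  -- The extra summand drops a special loop from `q`; the internal degree survives because the loop
  -- has degree `0`.
  · split_ifs with hs
    · have := T.deg_special _ hs.1.first_mem
      exact cs_mem_csDeg K _ hp hu (by linarith)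
    · exact zero_mem _

theorem csDer_mem (l : List Ar) {k : ℤ} {b : T.Alg K} (hb : b ∈ T.algDeg K k) :
    T.csDer K l b ∈ T.csDeg K 1 ((l.map T.deg).sum + k) := by
  induction l with
  | nil => rw [csDer_nil]; exact zero_mem _
  | cons a l ih =>
    rw [csDer_cons, List.map_cons, List.sum_cons]
    refine add_mem ?_ ?_
    · refine cs_mem_csDeg K _ (one_mem_algDeg K) (mul_mem_algDeg K (listProd_mem_algDeg K l) hb) ?_
      simp [Gam.arrow, Path.single, Path.degree]
      ring
    · rw [add_assoc]
      exact csLeft_mem K (arr_mem_algDeg K a) ih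

theorem csContr_mem {n : ℕ} {r : ℤ} {x : T.CS K n} (hx : x ∈ T.csDeg K n r) :
    T.csContr K n x ∈ T.csDeg K (n + 1) r := by
  refine csDeg_le K (P := (T.csDeg K (n + 1) r).comap (T.csContr K n))
    (fun p q u hs _ h => ?_) hx
  rw [Submodule.mem_comap]
  have hu := Bp.cls_mem_algDeg K u
  cases n with
  | zero =>
    rw [csContr_zero K p q hs]
    have hq : q.1.degree = 0 := by rw [q.eq_vertex]; exact Bp.triv_degree _
    rw [hq, add_zero] at h
    exact h ▸ csDer_mem K p.1.arrows hu
  | succ n =>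
    by_cases hγ : ∃ γ : T.Gam (n + 2), γ.tail = q ∧ p.1.arrows.getLast? = some γ.first
    · obtain ⟨γ, rfl, hl⟩ := hγ
      rw [csContr_succ_pos K p γ hl]
      refine cs_mem_csDeg K γ (listProd_mem_algDeg K _) hu ?_
      obtain ⟨l, hl⟩ := List.getLast?_eq_some_iff.1 hl
      have h1 : p.1.degree = (l.map T.deg).sum + T.deg γ.first := by
        simp [Path.degree, hl]
      rw [hl, List.dropLast_concat, γ.degree_eq]
      linarith
    · push Not at hγ
      rw [csContr_succ_neg K p q hγ]
      exact zero_mem _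

theorem exists_fTuple_mem {n : ℕ} (p : T.Bp) (q : T.Gam n) (u : T.Bp) :
    ∃ d : Fin (n + 2) → ℤ, (∀ j, fTuple K p q u j ∈ T.algDeg K (d j)) ∧
      ∑ j, d j = p.1.degree + q.1.degree + u.1.degree := by
  induction n generalizing p with
  | zero =>
    refine ⟨![u.1.degree, p.1.degree], fun j => ?_, ?_⟩
    · fin_cases j
      · exact (fTuple_zero K p q u).symm ▸ Bp.cls_mem_algDeg K u
      · exact (fTuple_last K p q u).symm ▸ Bp.cls_mem_algDeg K p
    · have hq : q.1.degree = 0 := by rw [q.eq_vertex]; exact Bp.triv_degree _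
      rw [hq, Fin.sum_univ_two]
      simp [add_comm]
  | succ n ih =>
    obtain ⟨d, hd, hs⟩ := ih (Bp.single T q.first) q.tail
    refine ⟨Fin.snoc (α := fun _ => ℤ) d p.1.degree, fun j => ?_, ?_⟩
    · rw [fTuple_succ]
      refine Fin.lastCases ?_ (fun j => ?_) j
      · rw [Fin.snoc_last, Fin.snoc_last]; exact Bp.cls_mem_algDeg K _
      · rw [Fin.snoc_castSucc, Fin.snoc_castSucc]; exact hd j
    · rw [Fin.sum_univ_castSucc]
      simp only [Fin.snoc_castSucc, Fin.snoc_last]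
      rw [hs, q.degree_eq]
      have : (Bp.single T q.first).1.degree = T.deg q.first := by
        simp [Bp.single, Path.single, Path.degree]
      rw [this]
      ring

theorem compF_mem {n : ℕ} {N : ℤ} {x : T.CS K n} (hx : x ∈ T.csDeg K n (N + n)) :
    T.compF K n x ∈ T.barDeg K n N := by
  refine csDeg_le K (P := (T.barDeg K n N).comap (T.compF K n)) (fun p q u hs hr h => ?_) hx
  rw [Submodule.mem_comap, compF_cs K p q u hs hr]
  obtain ⟨d, hd, hsum⟩ := exists_fTuple_mem K p q u
  exact sign_smul_mem K _ _ (barLin_mem_barDeg K hd (by linarith))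

theorem sum_degree_eq {n : ℕ} (α : T.BarWord n) : ∑ j, (α.tuple j).1.degree =
    ∑ j, (α.gen.tuple j).1.degree + α.lead.1.degree := by
  rw [Fin.sum_univ_castSucc, Fin.sum_univ_castSucc (fun j => (α.gen.tuple j).1.degree),
    BarWord.gen_tuple, Function.update_self, Bp.triv_degree, add_zero]
  congr 1
  refine Finset.sum_congr rfl fun j _ => ?_
  rw [Function.update_of_ne (Fin.castSucc_ne_last _)]

/-- Induction through `G s β = s G β` avoids counting degrees in the core list. -/
theorem compG_mem {n : ℕ} {N : ℤ} {x : T.Bar K n} (hx : x ∈ T.barDeg K n N) :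
    T.compG K n x ∈ T.csDeg K n (N + n) := by
  induction n generalizing N with
  | zero =>
    refine barDeg_le K (P := (T.csDeg K 0 (N + (0 : ℕ))).comap (T.compG K 0)) (fun α h => ?_) hx
    rw [Submodule.mem_comap, compG_zero]
    refine cs_mem_csDeg K _ (Bp.cls_mem_algDeg K _) (Bp.cls_mem_algDeg K _) ?_
    have hv : (Gam.vertex T α.lead.1.src).1.degree = 0 := Bp.triv_degree _
    rw [Fin.sum_univ_two] at h
    rw [hv]
    change α.lead.1.degree + 0 + (α.tuple 0).1.degree = _
    have : α.lead = α.tuple 1 := rfl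
    rw [this]
    linarith
  | succ n ih =>
    refine barDeg_le K (P := (T.csDeg K (n + 1) (N + (n + 1 : ℕ))).comap (T.compG K (n + 1)))
      (fun α h => ?_) hx
    rw [Submodule.mem_comap, compG_gen, α.gen_eq_shift, compG_shift]
    refine sign_smul_mem K _ _ ?_
    have h1 : ∑ j, (α.unshift.tuple j).1.degree - n = N + 1 - α.lead.1.degree := by
      rw [Fin.sum_univ_castSucc] at h
      rw [BarWord.unshift_tuple]
      change _ + α.lead.1.degree - _ = _ at h
      push_cast at h
      linarith
    have h2 := csLeft_mem K (Bp.cls_mem_algDeg K α.lead)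
      (csContr_mem K (ih (word_mem_barDeg K α.unshift h1)))
    have h3 : α.lead.1.degree + (N + 1 - α.lead.1.degree + n) = N + (n + 1 : ℕ) := by
      push_cast
      ring
    rwa [h3] at h2

theorem compH_mem {n : ℕ} {N : ℤ} {x : T.Bar K n} (hx : x ∈ T.barDeg K n N) :
    T.compH K n x ∈ T.barDeg K (n + 1) (N - 1) := by
  have hgen : ∀ {m : ℕ} {M : ℤ} (α : T.BarWord m), ∑ j, (α.tuple j).1.degree - m = M →
      T.barBasis K m α.gen ∈ T.barDeg K m (M - α.lead.1.degree) := by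
    intro m M α h
    refine word_mem_barDeg K _ ?_
    rw [sum_degree_eq] at h
    linarith
  have hlead : ∀ {m : ℕ} {M : ℤ} (α : T.BarWord m) {y : T.Bar K m},
      y ∈ T.barDeg K m (M - α.lead.1.degree) → α.lead.1.degree.negOnePow •
        T.barLeft K (m + 1) (α.lead.cls K) (T.barContr K m y) ∈ T.barDeg K (m + 1) (M - 1) := by
    intro m M α y hy
    have := barLeft_mem K (Bp.cls_mem_algDeg K α.lead) (barContr_mem K hy)
    rw [show α.lead.1.degree + (M - α.lead.1.degree - 1) = M - 1 by ring] at this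
    exact sign_smul_mem K _ _ this
  induction n generalizing N with
  | zero =>
    refine barDeg_le K (P := (T.barDeg K 1 (N - 1)).comap (T.compH K 0)) (fun α h => ?_) hx
    rw [Submodule.mem_comap, compH, Module.Basis.constr_basis]
    exact hlead α (sub_mem (hgen α h) (compF_mem K (compG_mem K (hgen α h))))
  | succ n ih =>
    refine barDeg_le K (P := (T.barDeg K (n + 2) (N - 1)).comap (T.compH K (n + 1)))
      (fun α h => ?_) hx
    rw [Submodule.mem_comap, compH, Module.Basis.constr_basis]
    refine hlead α (sub_mem (sub_mem (hgen α h) (compF_mem K (compG_mem K (hgen α h)))) ?_)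
    have := ih (barDiff_mem K (hgen α h))
    rwa [add_sub_cancel_right] at this

/-! ### Degrees and bimodule structure on the total complexes. -/

theorem lof_mem_totBarDeg {n : ℕ} {N : ℤ} {x : T.Bar K n} (hx : x ∈ T.barDeg K n N) :
    DirectSum.lof K ℕ (T.Bar K) n x ∈ T.totBarDeg K N :=
  Submodule.mem_iSup_of_mem n ⟨x, hx, rfl⟩

theorem lof_mem_totCSDeg {n : ℕ} {N : ℤ} {x : T.CS K n} (hx : x ∈ T.csDeg K n (N + n)) :
    DirectSum.lof K ℕ (T.CS K) n x ∈ T.totCSDeg K N :=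
  Submodule.mem_iSup_of_mem n ⟨x, hx, rfl⟩

theorem totBarDeg_le {N : ℤ} {P : Submodule K (T.TotBar K)}
    (h : ∀ n, ∀ x ∈ T.barDeg K n N, DirectSum.lof K ℕ (T.Bar K) n x ∈ P) :
    T.totBarDeg K N ≤ P :=
  iSup_le fun n => Submodule.map_le_iff_le_comap.2 (h n)

theorem totCSDeg_le {N : ℤ} {P : Submodule K (T.TotCS K)}
    (h : ∀ n, ∀ x ∈ T.csDeg K n (N + n), DirectSum.lof K ℕ (T.CS K) n x ∈ P) :
    T.totCSDeg K N ≤ P :=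
  iSup_le fun n => Submodule.map_le_iff_le_comap.2 (h n)

theorem totCSDiff_mem {N : ℤ} {x : T.TotCS K} (hx : x ∈ T.totCSDeg K N) :
    T.totCSDiff K x ∈ T.totCSDeg K (N + 1) := by
  refine totCSDeg_le K (P := (T.totCSDeg K (N + 1)).comap (T.totCSDiff K)) (fun n x hx => ?_) hx
  rw [Submodule.mem_comap]
  cases n with
  | zero => rw [totCSDiff_lof_zero]; exact zero_mem _
  | succ n =>
    rw [totCSDiff_lof_succ]
    refine lof_mem_totCSDeg K ?_
    have := csDiff_mem K hx
    rwa [show N + ((n + 1 : ℕ) : ℤ) = N + 1 + n by push_cast; ring] at this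

theorem totBarDiff_mem {N : ℤ} {x : T.TotBar K} (hx : x ∈ T.totBarDeg K N) :
    T.totBarDiff K x ∈ T.totBarDeg K (N + 1) := by
  refine totBarDeg_le K (P := (T.totBarDeg K (N + 1)).comap (T.totBarDiff K))
    (fun n x hx => ?_) hx
  rw [Submodule.mem_comap]
  cases n with
  | zero => rw [totBarDiff_lof_zero]; exact zero_mem _
  | succ n =>
    rw [totBarDiff_lof_succ]
    exact lof_mem_totBarDeg K (barDiff_mem K hx)

theorem totF_mem {N : ℤ} {x : T.TotCS K} (hx : x ∈ T.totCSDeg K N) :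
    T.totF K x ∈ T.totBarDeg K N := by
  refine totCSDeg_le K (P := (T.totBarDeg K N).comap (T.totF K)) (fun n x hx => ?_) hx
  rw [Submodule.mem_comap, totF_lof]
  exact lof_mem_totBarDeg K (compF_mem K hx)

theorem totG_mem {N : ℤ} {x : T.TotBar K} (hx : x ∈ T.totBarDeg K N) :
    T.totG K x ∈ T.totCSDeg K N := by
  refine totBarDeg_le K (P := (T.totCSDeg K N).comap (T.totG K)) (fun n x hx => ?_) hx
  rw [Submodule.mem_comap, totG_lof]
  exact lof_mem_totCSDeg K (compG_mem K hx)

theorem totH_mem {N : ℤ} {x : T.TotBar K} (hx : x ∈ T.totBarDeg K N) :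
    T.totH K x ∈ T.totBarDeg K (N - 1) := by
  refine totBarDeg_le K (P := (T.totBarDeg K (N - 1)).comap (T.totH K)) (fun n x hx => ?_) hx
  rw [Submodule.mem_comap, totH_lof]
  exact lof_mem_totBarDeg K (compH_mem K hx)

/-- Right multiplication commutes with `F` and preserves the length, so the two-sided rule follows
from the left one applied to `x b`. -/
theorem totF_act {n : ℕ} {i : ℤ} {a : T.Alg K} (b : T.Alg K) (x : T.CS K n)
    (ha : a ∈ T.algDeg K i) :
    T.totF K (T.totCSAct K a b (DirectSum.lof K ℕ (T.CS K) n x)) =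
      (n * i).negOnePow • T.totBarAct K a b (T.totF K (DirectSum.lof K ℕ (T.CS K) n x)) := by
  rw [totCSAct_eq, totBarAct_eq]
  have hx : T.totCSRight K b (DirectSum.lof K ℕ (T.CS K) n x) ∈ (T.csComplex K).level n := by
    rw [csComplex_level, totCSRight_lof]
    exact ⟨_, rfl⟩
  have h1 := (comparison_totF K (T := T)).map_act ha hx
  have h2 := LinearMap.congr_fun ((isRightMul_totCSRight K b).comparison
    (isRightMul_totBarRight K b) (comparison_totF K (T := T))) (DirectSum.lof K ℕ (T.CS K) n x)
  rw [LinearMap.comp_apply, LinearMap.comp_apply] at h2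
  rw [← h2]
  exact h1

theorem totG_act {n : ℕ} {i : ℤ} {a : T.Alg K} (b : T.Alg K) (x : T.Bar K n)
    (ha : a ∈ T.algDeg K i) :
    T.totG K (T.totBarAct K a b (DirectSum.lof K ℕ (T.Bar K) n x)) =
      (n * i).negOnePow • T.totCSAct K a b (T.totG K (DirectSum.lof K ℕ (T.Bar K) n x)) := by
  rw [totCSAct_eq, totBarAct_eq]
  have hx : T.totBarRight K b (DirectSum.lof K ℕ (T.Bar K) n x) ∈ (T.barComplex K).level n := by
    rw [barComplex_level, totBarRight_lof]
    exact ⟨_, rfl⟩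
  have h1 := (comparison_totG K (T := T)).map_act ha hx
  have h2 := LinearMap.congr_fun ((isRightMul_totBarRight K b).comparison
    (isRightMul_totCSRight K b) (comparison_totG K (T := T))) (DirectSum.lof K ℕ (T.Bar K) n x)
  rw [LinearMap.comp_apply, LinearMap.comp_apply] at h2
  rw [← h2]
  exact h1

end SkewGentleTriple

end
theorem mainTheorem9 {V Ar K : Type*} [Fintype V] [Field K] (T : SkewGentleTriple V Ar) :
    -- `T_*` is a complex augmented over `A`, with differential of degree `1`
    ((∀ N, ∀ x ∈ T.totCSDeg K N, T.totCSDiff K x ∈ T.totCSDeg K (N + 1)) ∧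
      T.totCSDiff K ∘ₗ T.totCSDiff K = 0 ∧ T.totCSAug K ∘ₗ T.totCSDiff K = 0) ∧
    -- so is `B(A, A, A)`
    ((∀ N, ∀ x ∈ T.totBarDeg K N, T.totBarDiff K x ∈ T.totBarDeg K (N + 1)) ∧
      T.totBarDiff K ∘ₗ T.totBarDiff K = 0 ∧ T.totBarAug K ∘ₗ T.totBarDiff K = 0) ∧
    -- `F` is a comparison morphism of graded bimodules
    ((∀ N, ∀ x ∈ T.totCSDeg K N, T.totF K x ∈ T.totBarDeg K N) ∧
      (∀ (n : ℕ) (i : ℤ) (a b : T.Alg K) (x : T.CS K n), a ∈ T.algDeg K i →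
        T.totF K (T.totCSAct K a b (DirectSum.lof K ℕ (T.CS K) n x)) =
          (n * i).negOnePow • T.totBarAct K a b (T.totF K (DirectSum.lof K ℕ (T.CS K) n x))) ∧
      T.totF K ∘ₗ T.totCSDiff K = T.totBarDiff K ∘ₗ T.totF K ∧
      T.totBarAug K ∘ₗ T.totF K = T.totCSAug K) ∧
    -- `G` is a comparison morphism of graded bimodules
    ((∀ N, ∀ x ∈ T.totBarDeg K N, T.totG K x ∈ T.totCSDeg K N) ∧
      (∀ (n : ℕ) (i : ℤ) (a b : T.Alg K) (x : T.Bar K n), a ∈ T.algDeg K i →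
        T.totG K (T.totBarAct K a b (DirectSum.lof K ℕ (T.Bar K) n x)) =
          (n * i).negOnePow • T.totCSAct K a b (T.totG K (DirectSum.lof K ℕ (T.Bar K) n x))) ∧
      T.totG K ∘ₗ T.totBarDiff K = T.totCSDiff K ∘ₗ T.totG K ∧
      T.totCSAug K ∘ₗ T.totG K = T.totBarAug K) ∧
    -- `G F = id`
    T.totG K ∘ₗ T.totF K = LinearMap.id ∧
    -- `F G` is homotopic to the identity through a map of graded bimodules of degree `-1`
    ∃ h : T.TotBar K →ₗ[K] T.TotBar K,
      (∀ N, ∀ x ∈ T.totBarDeg K N, h x ∈ T.totBarDeg K (N - 1)) ∧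
      (∀ (i : ℤ) (a b : T.Alg K) (x : T.TotBar K), a ∈ T.algDeg K i →
        h (T.totBarAct K a b x) = i.negOnePow • T.totBarAct K a b (h x)) ∧
      LinearMap.id - T.totF K ∘ₗ T.totG K = T.totBarDiff K ∘ₗ h + h ∘ₗ T.totBarDiff K := by
  exact ⟨⟨fun N x hx => SkewGentleTriple.totCSDiff_mem K hx, (T.csComplex K).diff_diff,
      (T.csComplex K).aug_diff⟩,
    ⟨fun N x hx => SkewGentleTriple.totBarDiff_mem K hx, (T.barComplex K).diff_diff,
      (T.barComplex K).aug_diff⟩,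
    ⟨fun N x hx => SkewGentleTriple.totF_mem K hx,
      fun n i a b x ha => SkewGentleTriple.totF_act K b x ha,
      (SkewGentleTriple.comparison_totF K).diff_comp,
      (SkewGentleTriple.comparison_totF K).aug_comp⟩,
    ⟨fun N x hx => SkewGentleTriple.totG_mem K hx,
      fun n i a b x ha => SkewGentleTriple.totG_act K b x ha,
      (SkewGentleTriple.comparison_totG K).diff_comp,
      (SkewGentleTriple.comparison_totG K).aug_comp⟩,
    (SkewGentleTriple.comparison_totF K).comp_eq_id (SkewGentleTriple.comparison_totG K)
      fun n α => SkewGentleTriple.totF_gen K α,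
    T.totH K, fun N x hx => SkewGentleTriple.totH_mem K hx,
    fun i a b x ha => by
      rw [SkewGentleTriple.totBarAct_eq, SkewGentleTriple.totBarAct_eq,
        SkewGentleTriple.totH_act K ha, SkewGentleTriple.totH_right],
    SkewGentleTriple.totH_homotopy K⟩
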